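/- **Setting.** Let $M$ be a smooth Hausdorff manifold of finite dimension with a smooth affine connection $\nabla$, with torsion $T(X,Y)=\nabla_XY-\nabla_YX-[X,Y]$, $(\nabla_ZT)(Y,X)=\nabla_Z(T(Y,X))-T(\nabla_ZY,X)-T(Y,\nabla_ZX)$ and curvature $R(X,Y)Z=\nabla_X\nabla_YZ-\nabla_Y\nabla_XZ-\nabla_{[X,Y]}Z$. *Iterated tangent bundles.* Let $p$ denote the projections $TM\to M$, $T^2M=T(TM)\to TM$, $T^3M=T(T^2M)\to T^2M$, and $p_*$, $p_{**}$ their differentials, and $\kappa$ the canonical involution of $T^2M$, with differential $\kappa_*:T^3M\to T^3M$. Write $T^k_xM$ for the part of $T^kM$ over $x$. The tangent space $T_yM$ acts freely and transitively on each non-empty fibre of $(p,p_*,p_{**}):T^3M\to (T^2M)^3$ over $y\in M$: a vector $V$ translates $\mathfrak X$ by the vertical vector at $p(\mathfrak X)$ determined by the vertical vector at $p(p(\mathfrak X))$ determined by $V$. For $\mathfrak X_1,\mathfrak X_2$ in one fibre, $\Pi(\mathfrak X_1,\mathfrak X_2)$ is the vector $V\in T_yM$ whose translation carries $\mathfrak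 X_2$ to $\mathfrak X_1$. *Jets.* A 1-jet is a linear isomorphism $\xi:T_xM\to T_yM$. A $(1,1)$-jet at $x$ is the 1-jet $j^1_xb$ of a smooth local field $b$ of 1-jets, $b(x'):T_{x'}M\to T_{\beta(x')}M$, whose target map $\beta$ is a local diffeomorphism. It extends $b(x)$ and acts on $T^2_xM$ by $\frac{d}{dt}X_t\mapsto\frac{d}{dt}\,b\cdot X_t$. A $(1,1,1)$-jet is in the same way the 1-jet of a field of $(1,1)$-jets, and acts on $T^3_xM$. A $(1,1)$-jet (resp. $(1,1,1)$-jet) is *holonomic*, or a genuine 2-jet (resp. 3-jet), if it is $j^2_xf$ (resp. $j^3_xf$) for a local diffeomorphism $f$ of $M$, that is, acts as the second (resp. third) tangent map of $f$. For a $(1,1)$-jet $j$ put $\kappa(j)\cdot\mathfrak X=\kappa(j\cdot\kappa(\mathfrak X))$; for a $(1,1,1)$-jet $J$ put $\kappa_*(J)\cdot\mathfrak X=\kappa_*(J\cdot\kappa_*(\mathfrak X))$. The jet is called $\kappa$-invariant, respectively $\kappa_*$-invariant, if this map is its own action. *Affine extensions.* A $(1,1)$-jet is *affine* if it is $j^1_xb$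 for a field $b$ such that the differential of the target map of $b$ at $x$ is $b(x)$ and $b(x)(\nabla_XY)=\nabla_{b(x)X}(bY)$ for all $X\in T_xM$ and all vector fields $Y$ near $x$. Each 1-jet $\xi$ at $x$ has a unique affine $(1,1)$-jet $S(\xi)$ extending it. Let $\mathbb S(\xi)=j^1_x(S\circ a)$, where $a$ is a local field of 1-jets with $j^1_xa=S(\xi)$; this $(1,1,1)$-jet does not depend on $a$. **Proposition.** Let $\xi:T_xM\to T_yM$ be a linear isomorphism. 1. Suppose $S(\xi)$ is holonomic. For $X,Y,Z\in T_xM$ and every $\mathfrak X\in T^3_xM$ with $p\circ p(\mathfrak X)=X$, $p_*\circ p(\mathfrak X)=Y$, $p_*\circ p_*(\mathfrak X)=Z$, in particular for $\mathfrak X=X_{**}Y_*Z$ where $X,Y$ are extended to vector fields near $x$, the vector $\Pi\big(\mathbb S(\xi)\cdot\mathfrak X,\ \kappa_*(\mathbb S(\xi))\cdot\mathfrak X\big)$ is defined and $$\Pi\big(\mathbb S(\xi)\cdot\mathfrak X,\ \kappa_*(\mathbb S(\xi))\cdot\mathfrak X\big)=\xi\big((\nabla_{Z}T)(Y,X)\big)-(\nabla_{\xi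 Z}T)(\xi Y,\xi X).$$ 2. If $S(\xi)$ is $\kappa$-invariant, then $\mathbb S(\xi)$ is $\kappa_*$-invariant if and only if $\xi$ preserves $\nabla T$, i.e. $\xi((\nabla_ZT)(Y,X))=(\nabla_{\xi Z}T)(\xi Y,\xi X)$ for all $X,Y,Z\in T_xM$. 3. $\mathbb S(\xi)$ is a genuine 3-jet if and only if $\xi$ preserves $T$, $\nabla T$ and $R$. 4. If $T=0$, then $\mathbb S(\xi)$ is $\kappa_*$-invariant. -/

import Mathlib

open scoped Manifold ContDiff Topology

noncomputable section

namespace JetAffine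

/-! ### Iterated tangent bundles -/

section Tangent

variable {F : Type*} [NormedAddCommGroup F] [NormedSpace ℝ F]
  {H : Type*} [TopologicalSpace H] (I : ModelWithCorners ℝ F H)
  {N : Type*} [TopologicalSpace N] [ChartedSpace H N] [IsManifold I 1 N]

/-- The canonical involution `κ` of the second tangent bundle `T(TN)`.  A point of `T(TN)` is
`⟨⟨x, u⟩, (v, w)⟩`, and `(x, u, v, w)` are exactly its coordinates in the chart of `T(TN)` induced
by the preferred chart of `N` at `x`; `κ` exchanges the two middle coordinates. -/
def kappa (X : TangentBundle I.tangent (TangentBundle I N)) :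
    TangentBundle I.tangent (TangentBundle I N) :=
  ⟨⟨X.1.1, X.2.1⟩, (X.1.2, X.2.2)⟩

/-- The vertical vector `d/dt (u + t v)` at `t = 0`, tangent to `TN` at `u`, for `u`, `v` in one
tangent space of `N`.  In the coordinates induced by the preferred chart at the base point its
components are `(0, v)`. -/
def vlift (u : TangentBundle I N) (v : TangentSpace I u.1) : TangentSpace I.tangent u :=
  ((0 : F), (v : F))

end Tangent

variable (E : Type*) [NormedAddCommGroup E] [NormedSpace ℝ E]

section Bundles

variable (M : Type*) [TopologicalSpace M] [ChartedSpace E M] [IsManifold 𝓘(ℝ, E) ∞ M]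

/-- The tangent bundle `TM`. -/
abbrev T1 := TangentBundle 𝓘(ℝ, E) M

/-- The second tangent bundle `T²M = T(TM)`. -/
abbrev T2 := TangentBundle 𝓘(ℝ, E).tangent (T1 E M)

/-- The third tangent bundle `T³M = T(T²M)`. -/
abbrev T3 := TangentBundle 𝓘(ℝ, E).tangent.tangent (T2 E M)

variable {M}

/-- The fibre `T²ₓM` of `T²M → M`. -/
abbrev T2At (x : M) := {X : T2 E M // X.1.1 = x}

/-- The fibre `T³ₓM` of `T³M → M`. -/
abbrev T3At (x : M) := {X : T3 E M // X.1.1.1 = x}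

/-- The projection `p_* : T²M → TM`, the differential of `p : TM → M`.  (The projections `p` of
`T²M` and `T³M` are the bundle projections `X ↦ X.1`.) -/
def pStar : T2 E M → T1 E M :=
  tangentMap 𝓘(ℝ, E).tangent 𝓘(ℝ, E) (fun v : T1 E M => v.1)

/-- The projection `p_* : T³M → T²M`, the differential of `p : T²M → TM`. -/
def pStar₃ : T3 E M → T2 E M :=
  tangentMap 𝓘(ℝ, E).tangent.tangent 𝓘(ℝ, E).tangent (fun X : T2 E M => X.1)

/-- The involution `κ` of `T³M = T²(TM)`. -/
def kappa₃ : T3 E M → T3 E M := kappa 𝓘(ℝ, E).tangent (N := T1 E M)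

/-- The involution `κ_*` of `T³M`, the differential of the involution `κ` of `T²M`. -/
def kappaStar : T3 E M → T3 E M :=
  tangentMap 𝓘(ℝ, E).tangent.tangent 𝓘(ℝ, E).tangent.tangent
    (kappa 𝓘(ℝ, E) : T2 E M → T2 E M)

/-- The translate of `X ∈ T³M` by a tangent vector `V` of `M`, that is the parameterization
`V ↦ X + (e(X) +_* (e_*(e(X)) +_** I(V)))` of the fibre of `(p, p_*, p_**)` through `X`. The second
summand is the vertical vector at `p(X)` of the vertical vector at `p(p(X))` of `V`. -/
def translate₃ (X : T3 E M) (V : TangentSpace 𝓘(ℝ, E) X.1.1.1) : T3 E M :=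
  ⟨X.1, X.2 + vlift 𝓘(ℝ, E).tangent X.1 (vlift 𝓘(ℝ, E) X.1.1 V)⟩

/-- `PiEq E X₁ X₂ V` says that `Π(X₁, X₂)` is defined and equal to `V`: the elements `X₁`, `X₂` of
`T³M` lie in one fibre of `(p, p_*, p_**)` and `X₁` is the translate of `X₂` by `V`. -/
def PiEq (X₁ X₂ : T3 E M) (V : T1 E M) : Prop :=
  ∃ W : TangentSpace 𝓘(ℝ, E) X₂.1.1.1, (⟨X₂.1.1.1, W⟩ : T1 E M) = V ∧ X₁ = translate₃ E X₂ W

end Bundles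

/-! ### Jets of bisections -/

section Jets

variable {M : Type*} [TopologicalSpace M] [ChartedSpace E M] [IsManifold 𝓘(ℝ, E) ∞ M]

/-- A 1-jet at `x` of a local diffeomorphism of `M`, that is a linear isomorphism from `TₓM` onto
some tangent space of `M`. -/
structure Jet1 (x : M) where
  /-- the target point -/
  tgt : M
  /-- the linear isomorphism -/
  lin : TangentSpace 𝓘(ℝ, E) x ≃L[ℝ] TangentSpace 𝓘(ℝ, E) tgt

variable {E}

/-- The action on `TM` of a field of 1-jets. -/
def hat₁ (b : (x : M) → Jet1 E x) : T1 E M → T1 E M := fun v => ⟨(b v.1).tgt, (b v.1).lin v.2⟩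

/-- `b` is, near `x`, a (smooth) local bisection of the groupoid of 1-jets: its target map is a
local diffeomorphism and the family of linear isomorphisms `b(x')` depends smoothly on `x'`. -/
structure IsBisection₁ (b : (x : M) → Jet1 E x) (x : M) : Prop where
  tgt : IsLocalDiffeomorphAt 𝓘(ℝ, E) 𝓘(ℝ, E) ∞ (fun x' => (b x').tgt) x
  smooth : ∃ U : Set M, IsOpen U ∧ x ∈ U ∧
    ContMDiffOn 𝓘(ℝ, E).tangent 𝓘(ℝ, E).tangent ∞ (hat₁ b) {v | v.1 ∈ U}

variable (E) in
/-- A (non-holonomic) `(1,1)`-jet at `x`: the 1-jet `j¹ₓb` of a local bisection `b` of the groupoid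
of 1-jets.  It is recorded by its value `b(x)` and by its (faithful) action
`d/dt X_t ↦ d/dt (b · X_t)` on `T²ₓM`. -/
@[ext]
structure Jet11 (x : M) where
  /-- the projection `p` of the jet, the value `b(x)` -/
  fst : Jet1 E x
  /-- the action of the jet on `T²ₓM` -/
  act : T2At E x → T2 E M
  exists_rep : ∃ b : (x' : M) → Jet1 E x', IsBisection₁ b x ∧ b x = fst ∧
    ∀ X, act X = tangentMap 𝓘(ℝ, E).tangent 𝓘(ℝ, E).tangent (hat₁ b) X.1

/-- The jet `j¹ₓb` of a local bisection `b` of the groupoid of 1-jets. -/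
def jet₁ (b : (x : M) → Jet1 E x) (x : M) (hb : IsBisection₁ b x) : Jet11 E x where
  fst := b x
  act X := tangentMap 𝓘(ℝ, E).tangent 𝓘(ℝ, E).tangent (hat₁ b) X.1
  exists_rep := ⟨b, hb, rfl, fun _ => rfl⟩

/-- The action on `T²M` of a field of `(1,1)`-jets. -/
def hat₂ (c : (x : M) → Jet11 E x) : T2 E M → T2 E M := fun X => (c X.1.1).act ⟨X, rfl⟩

/-- `c` is, near `x`, a (smooth) local bisection of the groupoid of `(1,1)`-jets. -/
structure IsBisection₂ (c : (x : M) → Jet11 E x) (x : M) : Prop where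
  tgt : IsLocalDiffeomorphAt 𝓘(ℝ, E) 𝓘(ℝ, E) ∞ (fun x' => (c x').fst.tgt) x
  smooth : ∃ U : Set M, IsOpen U ∧ x ∈ U ∧
    ContMDiffOn 𝓘(ℝ, E).tangent.tangent 𝓘(ℝ, E).tangent.tangent ∞ (hat₂ c) {X | X.1.1 ∈ U}

variable (E) in
/-- A (non-holonomic) `(1,1,1)`-jet at `x`: the 1-jet `j¹ₓc` of a local bisection `c` of the
groupoid of `(1,1)`-jets, recorded by its value `c(x)` and its (faithful) action
`d/dt X_t ↦ d/dt (c · X_t)` on `T³ₓM`. -/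
@[ext]
structure Jet111 (x : M) where
  /-- the projection `p` of the jet, the value `c(x)` -/
  fst : Jet11 E x
  /-- the action of the jet on `T³ₓM` -/
  act : T3At E x → T3 E M
  exists_rep : ∃ c : (x' : M) → Jet11 E x', IsBisection₂ c x ∧ c x = fst ∧
    ∀ X, act X = tangentMap 𝓘(ℝ, E).tangent.tangent 𝓘(ℝ, E).tangent.tangent (hat₂ c) X.1

/-- The jet `j¹ₓc` of a local bisection `c` of the groupoid of `(1,1)`-jets. -/
def jet₂ (c : (x : M) → Jet11 E x) (x : M) (hc : IsBisection₂ c x) : Jet111 E x where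
  fst := c x
  act X := tangentMap 𝓘(ℝ, E).tangent.tangent 𝓘(ℝ, E).tangent.tangent (hat₂ c) X.1
  exists_rep := ⟨c, hc, rfl, fun _ => rfl⟩

/-- A `(1,1)`-jet is holonomic if it is a genuine 2-jet `j²ₓf` of a local diffeomorphism `f`. -/
def Jet11.IsHolonomic {x : M} (j : Jet11 E x) : Prop :=
  ∃ f : M → M, IsLocalDiffeomorphAt 𝓘(ℝ, E) 𝓘(ℝ, E) ∞ f x ∧
    ∀ X, j.act X = tangentMap 𝓘(ℝ, E).tangent 𝓘(ℝ, E).tangent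
      (tangentMap 𝓘(ℝ, E) 𝓘(ℝ, E) f) X.1

/-- A `(1,1,1)`-jet is holonomic if it is a genuine 3-jet `j³ₓf` of a local diffeomorphism `f`. -/
def Jet111.IsHolonomic {x : M} (J : Jet111 E x) : Prop :=
  ∃ f : M → M, IsLocalDiffeomorphAt 𝓘(ℝ, E) 𝓘(ℝ, E) ∞ f x ∧
    ∀ X, J.act X = tangentMap 𝓘(ℝ, E).tangent.tangent 𝓘(ℝ, E).tangent.tangent
      (tangentMap 𝓘(ℝ, E).tangent 𝓘(ℝ, E).tangent (tangentMap 𝓘(ℝ, E) 𝓘(ℝ, E) f)) X.1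

/-- The map `κ(j) : X ↦ κ(j · κ(X))` on `T²ₓM`. -/
def Jet11.kappaAct {x : M} (j : Jet11 E x) : T2At E x → T2 E M :=
  fun X => kappa 𝓘(ℝ, E) (j.act ⟨kappa 𝓘(ℝ, E) X.1, X.2⟩)

/-- The map `κ_*(J) : X ↦ κ_*(J · κ_*(X))` on `T³ₓM`. -/
def Jet111.kappaStarAct {x : M} (J : Jet111 E x) : T3At E x → T3 E M :=
  fun X => kappaStar E (J.act ⟨kappaStar E X.1, X.2⟩)

/-- The identity bisection is a local bisection. -/
theorem isBisection₁_id (x : M) :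
    IsBisection₁ (fun x' : M => (⟨x', ContinuousLinearEquiv.refl ℝ _⟩ : Jet1 E x')) x where
  tgt := (Diffeomorph.refl 𝓘(ℝ, E) M ∞).isLocalDiffeomorph x
  smooth := ⟨Set.univ, isOpen_univ, trivial, contMDiff_id.contMDiffOn⟩

instance (x : M) : Nonempty (Jet11 E x) := ⟨jet₁ _ x (isBisection₁_id x)⟩

/-- The field of the 2-jets of the identity is a local bisection. -/
theorem isBisection₂_id (x : M) :
    IsBisection₂ (fun x' : M => jet₁ _ x' (isBisection₁_id (E := E) x')) x where
  tgt := (Diffeomorph.refl 𝓘(ℝ, E) M ∞).isLocalDiffeomorph x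
  smooth := by
    refine ⟨Set.univ, isOpen_univ, trivial, ContMDiff.contMDiffOn ?_⟩
    exact contMDiff_id.congr fun X =>
      congrFun (tangentMap_id (I := 𝓘(ℝ, E).tangent) (M := T1 E M)) X

instance (x : M) : Nonempty (Jet111 E x) := ⟨jet₂ _ x (isBisection₂_id x)⟩

end Jets

/-! ### Affine connections and affine extensions -/

section Connection

variable {E}
variable {M : Type*} [TopologicalSpace M] [ChartedSpace E M] [IsManifold 𝓘(ℝ, E) ∞ M]

/-- A `(1,1)`-jet `j = j¹ₓb` is affine for the connection `∇` if it is semi-holonomic, that is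
`p_*(j) = p(j)`, where `p_*(j)` is the differential at `x` of the target map of `b`, and if
`b(x)(∇_X Y) = ∇_{b(x)X} (bY)` for all `X ∈ TₓM` and all vector fields `Y` near `x`.  Here `bY` is
the vector field `W` near the target of `b(x)` with `W(tgt b(x')) = b(x') Y(x')`. Mathlib
writes `cov Y x X` for `∇_X Y`. -/
def IsAffine (cov : CovariantDerivative 𝓘(ℝ, E) E (TangentSpace 𝓘(ℝ, E) : M → Type _)) {x : M}
    (j : Jet11 E x) : Prop :=
  ∃ (b : (x' : M) → Jet1 E x') (hb : IsBisection₁ b x), jet₁ b x hb = j ∧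
    (∀ v : TangentSpace 𝓘(ℝ, E) x,
      mfderiv 𝓘(ℝ, E) 𝓘(ℝ, E) (fun x' => (b x').tgt) x v = (b x).lin v) ∧
    ∀ (Y W : (z : M) → TangentSpace 𝓘(ℝ, E) z),
      ContMDiffAt 𝓘(ℝ, E) 𝓘(ℝ, E).tangent ∞ (fun z => (⟨z, Y z⟩ : T1 E M)) x →
      ContMDiffAt 𝓘(ℝ, E) 𝓘(ℝ, E).tangent ∞ (fun z => (⟨z, W z⟩ : T1 E M)) (b x).tgt →
      (∀ᶠ x' in 𝓝 x, W (b x').tgt = (b x').lin (Y x')) →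
      ∀ X : TangentSpace 𝓘(ℝ, E) x, (b x).lin (cov Y x X) = cov W (b x).tgt ((b x).lin X)

/-- The affine extension `S(ξ)` of a 1-jet `ξ`: the affine `(1,1)`-jet whose first order part is
`ξ` (it exists and is unique). -/
def affineExt (cov : CovariantDerivative 𝓘(ℝ, E) E (TangentSpace 𝓘(ℝ, E) : M → Type _)) {x : M}
    (ξ : Jet1 E x) : Jet11 E x :=
  Classical.epsilon fun j => j.fst = ξ ∧ IsAffine cov j

/-- `J = j¹ₓ(S ∘ a)`, where `a` is a local bisection of the groupoid of 1-jets with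
`j¹ₓa = S(ξ)`. -/
def IsAffineExt₃ (cov : CovariantDerivative 𝓘(ℝ, E) E (TangentSpace 𝓘(ℝ, E) : M → Type _)) {x : M}
    (ξ : Jet1 E x) (J : Jet111 E x) : Prop :=
  ∃ (a : (x' : M) → Jet1 E x') (ha : IsBisection₁ a x)
    (hSa : IsBisection₂ (fun x' => affineExt cov (a x')) x),
    jet₁ a x ha = affineExt cov ξ ∧ jet₂ (fun x' => affineExt cov (a x')) x hSa = J

/-- The affine extension `𝕊(ξ) = j¹ₓ(S ∘ a)`, where `j¹ₓa = S(ξ)`, of a 1-jet `ξ` to a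
`(1,1,1)`-jet (it exists and does not depend on `a`). -/
def affineExt₃ (cov : CovariantDerivative 𝓘(ℝ, E) E (TangentSpace 𝓘(ℝ, E) : M → Type _)) {x : M}
    (ξ : Jet1 E x) : Jet111 E x :=
  Classical.epsilon (IsAffineExt₃ cov ξ)

/-- The covariant derivative `(∇_Z T)(Y, X)` of the torsion tensor `T`. The vectors `Y`, `X` are
extended to smooth vector fields near `x`; the choice of the extensions is irrelevant. -/
def covTorsion [FiniteDimensional ℝ E] [CompleteSpace E]
    (cov : CovariantDerivative 𝓘(ℝ, E) E (TangentSpace 𝓘(ℝ, E) : M → Type _)) (x : M)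
    (Z Y X : TangentSpace 𝓘(ℝ, E) x) : TangentSpace 𝓘(ℝ, E) x :=
  cov (fun z => cov.torsion z (FiberBundle.extend E Y z) (FiberBundle.extend E X z)) x Z
    - cov.torsion x (cov (FiberBundle.extend E Y) x Z) X
    - cov.torsion x Y (cov (FiberBundle.extend E X) x Z)

/-- The curvature `R(X, Y)Z = ∇_X ∇_Y Z - ∇_Y ∇_X Z - ∇_{[X, Y]} Z`.  The vectors are extended to
smooth vector fields near `x`; the choice of the extensions is irrelevant. -/
def curvature (cov : CovariantDerivative 𝓘(ℝ, E) E (TangentSpace 𝓘(ℝ, E) : M → Type _)) (x : M)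
    (X Y Z : TangentSpace 𝓘(ℝ, E) x) : TangentSpace 𝓘(ℝ, E) x :=
  cov (fun z => cov (FiberBundle.extend E Z) z (FiberBundle.extend E Y z)) x X
    - cov (fun z => cov (FiberBundle.extend E Z) z (FiberBundle.extend E X z)) x Y
    - cov (FiberBundle.extend E Z) x (VectorField.mlieBracket 𝓘(ℝ, E)
        (FiberBundle.extend E X) (FiberBundle.extend E Y) x)

/-- The 1-jet `ξ` preserves the torsion `T` of the connection. -/
def PreservesTorsion [FiniteDimensional ℝ E] [CompleteSpace E]
    (cov : CovariantDerivative 𝓘(ℝ, E) E (TangentSpace 𝓘(ℝ, E) : M → Type _)) {x : M}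
    (ξ : Jet1 E x) : Prop :=
  ∀ X Y, ξ.lin (cov.torsion x X Y) = cov.torsion ξ.tgt (ξ.lin X) (ξ.lin Y)

/-- The 1-jet `ξ` preserves the covariant derivative `∇T` of the torsion. -/
def PreservesCovTorsion [FiniteDimensional ℝ E] [CompleteSpace E]
    (cov : CovariantDerivative 𝓘(ℝ, E) E (TangentSpace 𝓘(ℝ, E) : M → Type _)) {x : M}
    (ξ : Jet1 E x) : Prop :=
  ∀ Z Y X, ξ.lin (covTorsion cov x Z Y X) =
    covTorsion cov ξ.tgt (ξ.lin Z) (ξ.lin Y) (ξ.lin X)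

/-- The 1-jet `ξ` preserves the curvature `R` of the connection. -/
def PreservesCurvature
    (cov : CovariantDerivative 𝓘(ℝ, E) E (TangentSpace 𝓘(ℝ, E) : M → Type _)) {x : M}
    (ξ : Jet1 E x) : Prop :=
  ∀ X Y Z, ξ.lin (curvature cov x X Y Z) =
    curvature cov ξ.tgt (ξ.lin X) (ξ.lin Y) (ξ.lin Z)

end Connection

end JetAffine

end

noncomputable section

set_option linter.unusedSectionVars false

/-! Everything is computed in the preferred charts at the source `x` and the target `y` of `ξ`. Let
`L` be the matrix of `ξ`, and let `Γ`, `Γ'` be the Christoffel symbols at the two ends, with `Γ(v,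
u)` the derivative in direction `v` of the constant field `u`. Differentiating `b(∇_X Y) =
∇_{bX}(bY)` in coordinates shows that the second order part of `S(ξ)` must be `G(v, u) = L Γ(v, u) -
Γ'(L v, L u)`, whatever representative is used (`IsJetRep.fderiv_eq`, `affineExt_act`). Applying
this formula along a field `a` with 1-jet `S(ξ)` and differentiating once more gives the third order
part `C(p, v, u)` of `𝕊(ξ)` as an expression in `L`, `G`, `Γ`, `Γ'` and the derivatives of `Γ`, `Γ'`
(`affineExt₃_act`).

The proposition then reduces to the symmetries of `G` and `C`. Antisymmetrizing `G` gives the defect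
of invariance of the torsion, so `G` is symmetric iff `ξ` preserves `T` (`preservesTorsion_iff`). If
`G` is symmetric, exchanging the last two arguments of `C` changes it by the defect for `∇T`
(`third_sub_swap_right`), and exchanging the first two changes it by the defect for `R`
(`third_sub_swap_left`).

The involution `κ_*` exchanges the last two arguments of `C`; it also exchanges the arguments of
`G`. This gives the formula for `Π` and the criterion for `κ_*`-invariance (`Jet111.HasCoord.piEq`,
`Jet111.HasCoord.kappaStarAct_eq_iff`). A jet with components `L`, `G`, `C` is a genuine 3-jet iff
`G` and `C` are totally symmetric: derivatives of a map are symmetric, and conversely a cubic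
polynomial has prescribed symmetric derivatives (`Jet111.isHolonomic_iff`). The two transpositions
generate all permutations of the arguments of `C`, which is why `T`, `∇T` and `R` together suffice.
-/

namespace JetAffine

/-! ### Tangent coordinates in a preferred chart -/

section Charts

variable {F : Type*} [NormedAddCommGroup F] [NormedSpace ℝ F]
  {H : Type*} [TopologicalSpace H] {I : ModelWithCorners ℝ F H}
  {N : Type*} [TopologicalSpace N] [ChartedSpace H N] [IsManifold I ∞ N]

variable (I) in
/-- The coordinates of the tangent vectors at `z` in the preferred chart at `x₀`. -/
def tcoord (x₀ z : N) : TangentSpace I z →L[ℝ] F :=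
  (trivializationAt F (TangentSpace I) x₀).continuousLinearMapAt ℝ z

variable (I) in
/-- The tangent vector at `z` with given coordinates in the preferred chart at `x₀`. -/
def tcoordSymm (x₀ z : N) : F →L[ℝ] TangentSpace I z :=
  (trivializationAt F (TangentSpace I) x₀).symmL ℝ z

theorem tcoord_tcoordSymm {x₀ z : N} (hz : z ∈ (extChartAt I x₀).source) (u : F) :
    tcoord I x₀ z (tcoordSymm I x₀ z u) = u :=
  (trivializationAt F (TangentSpace I) x₀).continuousLinearMapAt_symmL
    (by simpa using hz) u

theorem tcoordSymm_tcoord {x₀ z : N} (hz : z ∈ (extChartAt I x₀).source)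
    (v : TangentSpace I z) : tcoordSymm I x₀ z (tcoord I x₀ z v) = v :=
  (trivializationAt F (TangentSpace I) x₀).symmL_continuousLinearMapAt
    (by simpa using hz) v

theorem tcoord_injective {x₀ z : N} (hz : z ∈ (extChartAt I x₀).source) :
    Function.Injective (tcoord I x₀ z) :=
  Function.LeftInverse.injective (g := tcoordSymm I x₀ z) (tcoordSymm_tcoord hz)

theorem tcoord_eq_mfderiv {x₀ z : N} (hz : z ∈ (extChartAt I x₀).source) :
    tcoord I x₀ z = mfderiv I 𝓘(ℝ, F) (extChartAt I x₀) z :=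
  TangentBundle.continuousLinearMapAt_trivializationAt (by simpa using hz)

/-- The tangent space at `x` is identified with the model space through the preferred chart at `x`
itself. This makes the literal components of a point of an iterated tangent bundle usable as
coordinates. -/
theorem tcoord_self (x : N) (v : F) : tcoord I x x v = v := by
  have := tangentCoordChange_self (I := I) (x := x) (z := x) (v := v) (mem_extChartAt_source x)
  rw [tcoord, TangentBundle.continuousLinearMapAt_trivializationAt_eq_core (mem_chart_source H x)]
  exact this

theorem mem_extChartAt_tangent_source {p q : TangentBundle I N} :
    q ∈ (extChartAt I.tangent p).source ↔ q.1 ∈ (extChartAt I p.1).source := by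
  rw [extChartAt_source, extChartAt_source]
  exact TangentBundle.mem_chart_source_iff q p

theorem extChartAt_tangent_apply {p q : TangentBundle I N}
    (hq : q.1 ∈ (extChartAt I p.1).source) :
    extChartAt I.tangent p q = (extChartAt I p.1 q.1, tcoord I p.1 q.1 q.2) := by
  have h := TangentBundle.continuousLinearMapAt_trivializationAt_eq_core (I := I)
    (b₀ := p.1) (b := q.1) (by simpa using hq)
  exact Prod.ext rfl (DFunLike.congr_fun h q.2).symm

theorem extChartAt_tangent_apply_self (x : N) (u : F) (v : F) :
    extChartAt I.tangent (⟨x, u⟩ : TangentBundle I N) (⟨x, v⟩ : TangentBundle I N) =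
      (extChartAt I x x, v) :=
  (extChartAt_tangent_apply (I := I) (p := ⟨x, u⟩) (q := ⟨x, v⟩)
    (mem_extChartAt_source (I := I) x)).trans
    (congrArg (Prod.mk (extChartAt I x x)) (tcoord_self (I := I) x v))

end Charts

/-! ### Maps between manifolds and their local expressions in charts -/

section Rep

variable {F : Type*} [NormedAddCommGroup F] [NormedSpace ℝ F]
  {H : Type*} [TopologicalSpace H] {I : ModelWithCorners ℝ F H} [I.Boundaryless]
  {N : Type*} [TopologicalSpace N] [ChartedSpace H N] [IsManifold I ∞ N]
  {F' : Type*} [NormedAddCommGroup F'] [NormedSpace ℝ F']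
  {H' : Type*} [TopologicalSpace H'] {I' : ModelWithCorners ℝ F' H'} [I'.Boundaryless]
  {N' : Type*} [TopologicalSpace N'] [ChartedSpace H' N'] [IsManifold I' ∞ N']

variable (I I') in
/-- On the open set `W`, the map `h` is given by `g` in the preferred charts at `x₀` and `y₀`. -/
structure IsRep (x₀ : N) (y₀ : N') (h : N → N') (g : F → F') (W : Set N) : Prop where
  isOpen : IsOpen W
  source : ∀ q ∈ W, q ∈ (extChartAt I x₀).source
  mapsTo : ∀ q ∈ W, h q ∈ (extChartAt I' y₀).source
  eq : ∀ q ∈ W, extChartAt I' y₀ (h q) = g (extChartAt I x₀ q)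

namespace IsRep

variable {x₀ : N} {y₀ : N'} {h : N → N'} {g : F → F'} {W : Set N}

theorem eventuallyEq (r : IsRep I I' x₀ y₀ h g W) {q : N} (hq : q ∈ W) :
    h =ᶠ[𝓝 q] fun z => (extChartAt I' y₀).symm (g (extChartAt I x₀ z)) := by
  filter_upwards [r.isOpen.mem_nhds hq] with z hz
  rw [← r.eq z hz, (extChartAt I' y₀).left_inv (r.mapsTo z hz)]

theorem map_mem_target (r : IsRep I I' x₀ y₀ h g W) {q : N} (hq : q ∈ W) :
    g (extChartAt I x₀ q) ∈ (extChartAt I' y₀).target := by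
  rw [← r.eq q hq]
  exact (extChartAt I' y₀).map_source (r.mapsTo q hq)

theorem eventually_mem (r : IsRep I I' x₀ y₀ h g W) {q : N} (hq : q ∈ W) :
    ∀ᶠ e in 𝓝 (extChartAt I x₀ q), e ∈ (extChartAt I x₀).target ∧ (extChartAt I x₀).symm e ∈ W := by
  have hs := r.source q hq
  refine Filter.Eventually.and
    ((isOpen_extChartAt_target x₀).mem_nhds ((extChartAt I x₀).map_source hs)) ?_
  exact (continuousAt_extChartAt_symm' hs).preimage_mem_nhds
    (by rw [(extChartAt I x₀).left_inv hs]; exact r.isOpen.mem_nhds hq)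

theorem eventuallyEq_coord (r : IsRep I I' x₀ y₀ h g W) {q : N} (hq : q ∈ W) :
    g =ᶠ[𝓝 (extChartAt I x₀ q)] fun e => extChartAt I' y₀ (h ((extChartAt I x₀).symm e)) := by
  filter_upwards [r.eventually_mem hq] with e he
  rw [r.eq _ he.2, (extChartAt I x₀).right_inv he.1]

theorem contMDiffAt (r : IsRep I I' x₀ y₀ h g W) {n : ℕ∞} {q : N} (hq : q ∈ W)
    (hg : ContDiffAt ℝ n g (extChartAt I x₀ q)) : ContMDiffAt I I' n h q := by
  have := IsManifold.of_le (I := I) (M := N) (m := n) (n := ∞) (by exact_mod_cast le_top)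
  have := IsManifold.of_le (I := I') (M := N') (m := n) (n := ∞) (by exact_mod_cast le_top)
  refine ContMDiffAt.congr_of_eventuallyEq ?_ (r.eventuallyEq hq)
  have h1 : ContMDiffAt I 𝓘(ℝ, F) n (extChartAt I x₀) q :=
    contMDiffAt_extChartAt' (by simpa using r.source q hq)
  have h3 : ContMDiffAt 𝓘(ℝ, F') I' n (extChartAt I' y₀).symm (g (extChartAt I x₀ q)) :=
    (contMDiffOn_extChartAt_symm y₀).contMDiffAt
      ((isOpen_extChartAt_target y₀).mem_nhds (r.map_mem_target hq))
  exact h3.comp q (hg.contMDiffAt.comp q h1)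

theorem contDiffAt (r : IsRep I I' x₀ y₀ h g W) {n : ℕ∞} {q : N} (hq : q ∈ W)
    (hh : ContMDiffAt I I' n h q) : ContDiffAt ℝ n g (extChartAt I x₀ q) := by
  have := IsManifold.of_le (I := I) (M := N) (m := n) (n := ∞) (by exact_mod_cast le_top)
  have := IsManifold.of_le (I := I') (M := N') (m := n) (n := ∞) (by exact_mod_cast le_top)
  have hs := r.source q hq
  refine ContDiffAt.congr_of_eventuallyEq ?_ (r.eventuallyEq_coord hq)
  have h1 : ContMDiffAt I' 𝓘(ℝ, F') n (extChartAt I' y₀) (h q) :=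
    contMDiffAt_extChartAt' (by simpa using r.mapsTo q hq)
  have h3 : ContMDiffAt 𝓘(ℝ, F) I n (extChartAt I x₀).symm (extChartAt I x₀ q) :=
    (contMDiffOn_extChartAt_symm x₀).contMDiffAt
      ((isOpen_extChartAt_target x₀).mem_nhds ((extChartAt I x₀).map_source hs))
  have hq' := (extChartAt I x₀).left_inv hs
  refine ContMDiffAt.contDiffAt ?_
  refine ContMDiffAt.comp (I' := I') (g := extChartAt I' y₀) _ ?_ ?_
  · rwa [hq']
  · exact ContMDiffAt.comp (I' := I) (g := h) _ (by rwa [hq']) h3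

theorem mdifferentiableAt (r : IsRep I I' x₀ y₀ h g W) {q : N} (hq : q ∈ W)
    (hg : DifferentiableAt ℝ g (extChartAt I x₀ q)) : MDifferentiableAt I I' h q := by
  refine MDifferentiableAt.congr_of_eventuallyEq ?_ (r.eventuallyEq hq)
  have h1 : MDifferentiableAt I 𝓘(ℝ, F) (extChartAt I x₀) q :=
    mdifferentiableAt_extChartAt (by simpa using r.source q hq)
  have h3 : MDifferentiableAt 𝓘(ℝ, F') I' (extChartAt I' y₀).symm (g (extChartAt I x₀ q)) :=
    ((contMDiffOn_extChartAt_symm (n := 1) y₀).contMDiffAt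
      ((isOpen_extChartAt_target y₀).mem_nhds (r.map_mem_target hq))).mdifferentiableAt one_ne_zero
  exact h3.comp q (hg.mdifferentiableAt.comp q h1)

/-- Both sides are the derivative of the common composite `ψ ∘ h = g ∘ φ`, expanded by the chain
rule, with `φ` and `ψ` the two charts. -/
theorem tcoord_mfderiv (r : IsRep I I' x₀ y₀ h g W) {q : N} (hq : q ∈ W)
    (hg : DifferentiableAt ℝ g (extChartAt I x₀ q)) (v : TangentSpace I q) :
    tcoord I' y₀ (h q) (mfderiv I I' h q v) =
      fderiv ℝ g (extChartAt I x₀ q) (tcoord I x₀ q v) := by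
  have h1 : MDifferentiableAt I 𝓘(ℝ, F) (extChartAt I x₀) q :=
    mdifferentiableAt_extChartAt (by simpa using r.source q hq)
  have h2 : MDifferentiableAt I' 𝓘(ℝ, F') (extChartAt I' y₀) (h q) :=
    mdifferentiableAt_extChartAt (by simpa using r.mapsTo q hq)
  have e1 := mfderiv_comp q h2 (r.mdifferentiableAt hq hg)
  have e2 := mfderiv_comp (I' := 𝓘(ℝ, F)) (I'' := 𝓘(ℝ, F')) q hg.mdifferentiableAt h1
  have e3 : (extChartAt I' y₀ ∘ h) =ᶠ[𝓝 q] g ∘ extChartAt I x₀ := by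
    filter_upwards [r.isOpen.mem_nhds hq] with z hz using r.eq z hz
  rw [tcoord_eq_mfderiv (r.source q hq), tcoord_eq_mfderiv (r.mapsTo q hq)]
  have e4 := e1.symm.trans (e3.mfderiv_eq.trans e2)
  have e5 := DFunLike.congr_fun e4 v
  rw [mfderiv_eq_fderiv] at e5
  exact e5

/-- Iterating this lifts a local expression of a map to one of its second and third tangent maps.
The vectors `u`, `u'` are free because the chart of the tangent bundle at a point depends only on
the base point. -/
theorem tangentMap (r : IsRep I I' x₀ y₀ h g W)
    (hg : ∀ q ∈ W, DifferentiableAt ℝ g (extChartAt I x₀ q)) (u : F) (u' : F') :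
    IsRep I.tangent I'.tangent (⟨x₀, u⟩ : TangentBundle I N) (⟨y₀, u'⟩ : TangentBundle I' N')
      (_root_.tangentMap I I' h) (fun e => (g e.1, fderiv ℝ g e.1 e.2)) {q | q.1 ∈ W} where
  isOpen := r.isOpen.preimage (FiberBundle.continuous_proj F (TangentSpace I))
  source q hq := mem_extChartAt_tangent_source.2 (r.source _ hq)
  mapsTo q hq := mem_extChartAt_tangent_source.2 (r.mapsTo _ hq)
  eq q hq := by
    rw [extChartAt_tangent_apply (p := ⟨x₀, u⟩) (r.source _ hq)]
    refine (extChartAt_tangent_apply (I := I') (p := ⟨y₀, u'⟩)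
      (q := _root_.tangentMap I I' h q) (r.mapsTo _ hq)).trans (Prod.ext ?_ ?_)
    · exact r.eq _ hq
    · exact r.tcoord_mfderiv hq (hg _ hq) _

/-- The tangent map at a point where both charts are the preferred ones. -/
theorem tangentMap_self {q : N} (r : IsRep I I' q (h q) h g W) (hq : q ∈ W)
    (hg : DifferentiableAt ℝ g (extChartAt I q q)) (v : F) :
    _root_.tangentMap I I' h ⟨q, v⟩ = ⟨h q, fderiv ℝ g (extChartAt I q q) v⟩ := by
  have e := r.tcoord_mfderiv hq hg v
  have e' : tcoord I' (h q) (h q) (mfderiv I I' h q v) = mfderiv I I' h q v := tcoord_self _ _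
  have e'' : tcoord I q q v = v := tcoord_self _ _
  rw [e', e''] at e
  exact congrArg (Bundle.TotalSpace.mk (h q)) e

end IsRep

end Rep

/-! ### Vector fields in coordinates, constant fields and their brackets -/

section Fields

variable {E : Type*} [NormedAddCommGroup E] [NormedSpace ℝ E]
  {M : Type*} [TopologicalSpace M] [ChartedSpace E M] [IsManifold 𝓘(ℝ, E) ∞ M]

theorem trivializationAt_snd {x₀ z : M} (hz : z ∈ (extChartAt 𝓘(ℝ, E) x₀).source)
    (v : TangentSpace 𝓘(ℝ, E) z) :
    (trivializationAt E (TangentSpace 𝓘(ℝ, E)) x₀ ⟨z, v⟩).2 = tcoord 𝓘(ℝ, E) x₀ z v := by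
  have hz' : z ∈ (trivializationAt E (TangentSpace 𝓘(ℝ, E)) x₀).baseSet := by simpa using hz
  rw [tcoord, Bundle.Trivialization.continuousLinearMapAt_apply,
    Bundle.Trivialization.linearMapAt_apply, if_pos hz']

theorem eventually_mem_source {x₀ z : M} (hz : z ∈ (extChartAt 𝓘(ℝ, E) x₀).source) :
    ∀ᶠ z' in 𝓝 z, z' ∈ (extChartAt 𝓘(ℝ, E) x₀).source :=
  (isOpen_extChartAt_source x₀).mem_nhds hz

theorem contMDiffAt_field {x₀ z : M} (hz : z ∈ (extChartAt 𝓘(ℝ, E) x₀).source)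
    {Y : (z : M) → TangentSpace 𝓘(ℝ, E) z} :
    ContMDiffAt 𝓘(ℝ, E) 𝓘(ℝ, E).tangent ∞ (fun z => (⟨z, Y z⟩ : T1 E M)) z ↔
      ContMDiffAt 𝓘(ℝ, E) 𝓘(ℝ, E) ∞ (fun z' => tcoord 𝓘(ℝ, E) x₀ z' (Y z')) z := by
  refine ((trivializationAt E (TangentSpace 𝓘(ℝ, E)) x₀).contMDiffAt_section_iff
    (IB := 𝓘(ℝ, E)) (s := Y) (by simpa using hz)).trans ?_
  refine Filter.EventuallyEq.contMDiffAt_iff ?_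
  filter_upwards [eventually_mem_source hz] with z' hz' using trivializationAt_snd hz' _

theorem mdifferentiableAt_field {x₀ z : M} (hz : z ∈ (extChartAt 𝓘(ℝ, E) x₀).source)
    {Y : (z : M) → TangentSpace 𝓘(ℝ, E) z} :
    MDifferentiableAt 𝓘(ℝ, E) 𝓘(ℝ, E).tangent (fun z => (⟨z, Y z⟩ : T1 E M)) z ↔
      MDifferentiableAt 𝓘(ℝ, E) 𝓘(ℝ, E) (fun z' => tcoord 𝓘(ℝ, E) x₀ z' (Y z')) z := by
  refine ((trivializationAt E (TangentSpace 𝓘(ℝ, E)) x₀).mdifferentiableAt_section_iff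
    𝓘(ℝ, E) Y (by simpa using hz)).trans ?_
  refine Filter.EventuallyEq.mdifferentiableAt_iff ?_
  filter_upwards [eventually_mem_source hz] with z' hz' using trivializationAt_snd hz' _

theorem mdifferentiableAt_comp_chart {x₀ z : M} (hz : z ∈ (extChartAt 𝓘(ℝ, E) x₀).source)
    {G : Type*} [NormedAddCommGroup G] [NormedSpace ℝ G] {g : E → G}
    (hg : DifferentiableAt ℝ g (extChartAt 𝓘(ℝ, E) x₀ z)) :
    MDifferentiableAt 𝓘(ℝ, E) 𝓘(ℝ, G) (fun z' => g (extChartAt 𝓘(ℝ, E) x₀ z')) z :=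
  hg.mdifferentiableAt.comp z (mdifferentiableAt_extChartAt (by simpa using hz))

theorem mfderiv_comp_chart {x₀ z : M} (hz : z ∈ (extChartAt 𝓘(ℝ, E) x₀).source)
    {G : Type*} [NormedAddCommGroup G] [NormedSpace ℝ G] {g : E → G}
    (hg : DifferentiableAt ℝ g (extChartAt 𝓘(ℝ, E) x₀ z)) (v : TangentSpace 𝓘(ℝ, E) z) :
    (mfderiv 𝓘(ℝ, E) 𝓘(ℝ, G) (fun z' => g (extChartAt 𝓘(ℝ, E) x₀ z')) z v : G) =
      fderiv ℝ g (extChartAt 𝓘(ℝ, E) x₀ z) (tcoord 𝓘(ℝ, E) x₀ z v) := by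
  have h1 : MDifferentiableAt 𝓘(ℝ, E) 𝓘(ℝ, E) (extChartAt 𝓘(ℝ, E) x₀) z :=
    mdifferentiableAt_extChartAt (by simpa using hz)
  have e := DFunLike.congr_fun (mfderiv_comp (I'' := 𝓘(ℝ, G)) z hg.mdifferentiableAt h1) v
  rw [mfderiv_eq_fderiv] at e
  rw [tcoord_eq_mfderiv hz]
  exact e

/-- The vector field with constant coordinates in the preferred chart at `x₀`. -/
def constField (x₀ : M) (u : E) (z : M) : TangentSpace 𝓘(ℝ, E) z := tcoordSymm 𝓘(ℝ, E) x₀ z u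

theorem extend_eq_constField {x z : M} (hz : z ∈ (extChartAt 𝓘(ℝ, E) x).source)
    (v : TangentSpace 𝓘(ℝ, E) x) : FiberBundle.extend E v z = constField (E := E) x v z := by
  have h : (trivializationAt E (TangentSpace 𝓘(ℝ, E)) x ⟨x, v⟩).2 = v :=
    (trivializationAt_snd (mem_extChartAt_source x) v).trans (tcoord_self x _)
  rw [FiberBundle.extend, h]
  exact (Bundle.Trivialization.symmL_apply _ (by simpa using hz) _).symm

theorem contMDiffAt_constField {x₀ z : M} (hz : z ∈ (extChartAt 𝓘(ℝ, E) x₀).source) (u : E) :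
    ContMDiffAt 𝓘(ℝ, E) 𝓘(ℝ, E).tangent ∞ (fun z => (⟨z, constField x₀ u z⟩ : T1 E M)) z := by
  rw [contMDiffAt_field hz]
  refine (contMDiffAt_const (c := u)).congr_of_eventuallyEq ?_
  filter_upwards [eventually_mem_source hz] with z' hz' using tcoord_tcoordSymm hz' u

theorem mdifferentiableAt_constField {x₀ z : M} (hz : z ∈ (extChartAt 𝓘(ℝ, E) x₀).source) (u : E) :
    MDifferentiableAt 𝓘(ℝ, E) 𝓘(ℝ, E).tangent
      (fun z => (⟨z, constField x₀ u z⟩ : T1 E M)) z :=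
  (contMDiffAt_constField hz u).mdifferentiableAt (by simp)

theorem mdifferentiableAt_of_tcoord {x₀ z : M} (hz : z ∈ (extChartAt 𝓘(ℝ, E) x₀).source)
    {Y : (z : M) → TangentSpace 𝓘(ℝ, E) z} {g : E → E}
    (hY : ∀ᶠ z' in 𝓝 z, tcoord 𝓘(ℝ, E) x₀ z' (Y z') = g (extChartAt 𝓘(ℝ, E) x₀ z'))
    (hg : DifferentiableAt ℝ g (extChartAt 𝓘(ℝ, E) x₀ z)) :
    MDifferentiableAt 𝓘(ℝ, E) 𝓘(ℝ, E).tangent (fun z => (⟨z, Y z⟩ : T1 E M)) z :=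
  (mdifferentiableAt_field hz).2 ((mdifferentiableAt_comp_chart hz hg).congr_of_eventuallyEq hY)

/-- The constant vector field on the model space. -/
def modelField (u : E) (e : E) : TangentSpace 𝓘(ℝ, E) e := u

theorem mdifferentiableAt_modelField (u e : E) :
    MDifferentiableAt 𝓘(ℝ, E) 𝓘(ℝ, E).tangent
      (fun e : E => (⟨e, modelField u e⟩ : TangentBundle 𝓘(ℝ, E) E)) e :=
  (contMDiffAt_vectorSpace_iff_contDiffAt (n := 1) (V := modelField u).2
    contDiffAt_const).mdifferentiableAt one_ne_zero

theorem mlieBracket_modelField (u v e : E) :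
    VectorField.mlieBracket 𝓘(ℝ, E) (modelField u) (modelField v) e = 0 := by
  rw [← VectorField.mlieBracketWithin_univ, VectorField.mlieBracketWithin_eq_lieBracketWithin]
  have h : ∀ w : E, fderivWithin ℝ (fun e : E => (modelField w e : E)) Set.univ e = 0 := fun w =>
    fderivWithin_const_apply w
  exact (congrArg₂ (fun a b : E => a - b) (DFunLike.congr_fun (h v) u)
    (DFunLike.congr_fun (h u) v)).trans (sub_self (0 : E))

theorem constField_eventuallyEq {x₀ z : M} (hz : z ∈ (extChartAt 𝓘(ℝ, E) x₀).source) (w : E) :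
    constField x₀ w =ᶠ[𝓝 z]
      VectorField.mpullback 𝓘(ℝ, E) 𝓘(ℝ, E) (extChartAt 𝓘(ℝ, E) x₀) (modelField w) := by
  filter_upwards [eventually_mem_source hz] with z' hz'
  have hinv : (mfderiv 𝓘(ℝ, E) 𝓘(ℝ, E) (extChartAt 𝓘(ℝ, E) x₀) z').IsInvertible :=
    isInvertible_mfderiv_extChartAt hz'
  have h : mfderiv 𝓘(ℝ, E) 𝓘(ℝ, E) (extChartAt 𝓘(ℝ, E) x₀) z' (constField x₀ w z') = w := by
    rw [← tcoord_eq_mfderiv hz']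
    exact tcoord_tcoordSymm hz' w
  have h2 := congrArg (mfderiv 𝓘(ℝ, E) 𝓘(ℝ, E) (extChartAt 𝓘(ℝ, E) x₀) z').inverse h
  exact (DFunLike.congr_fun hinv.inverse_comp_self _).symm.trans h2

/-- Constant coordinate fields are pullbacks under the chart of constant fields on the model space,
and the Lie bracket is natural under pullback. -/
theorem mlieBracket_constField [CompleteSpace E] {x₀ z : M}
    (hz : z ∈ (extChartAt 𝓘(ℝ, E) x₀).source) (u v : E) :
    VectorField.mlieBracket 𝓘(ℝ, E) (constField x₀ u) (constField x₀ v) z = 0 := by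
  have hmem : ContMDiffAt 𝓘(ℝ, E) 𝓘(ℝ, E) 2 (extChartAt 𝓘(ℝ, E) x₀) z :=
    contMDiffAt_extChartAt' (by simpa using hz)
  have hm2 : minSmoothness ℝ 2 = 2 := minSmoothness_of_isRCLikeNormedField
  have : IsManifold 𝓘(ℝ, E) (minSmoothness ℝ 2) M := by rw [hm2]; infer_instance
  rw [(constField_eventuallyEq hz u).mlieBracket_vectorField_eq (constField_eventuallyEq hz v),
    ← VectorField.mpullback_mlieBracket (mdifferentiableAt_modelField u _)
      (mdifferentiableAt_modelField v _) hmem hm2.le]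
  exact (congrArg _ (mlieBracket_modelField u v _)).trans (map_zero _)

end Fields

/-! ### Christoffel symbols; torsion, its derivative and curvature in coordinates -/

section Christoffel

variable {E : Type*} [NormedAddCommGroup E] [NormedSpace ℝ E] [FiniteDimensional ℝ E]
  {M : Type*} [TopologicalSpace M] [ChartedSpace E M] [IsManifold 𝓘(ℝ, E) ∞ M]
  (cov : CovariantDerivative 𝓘(ℝ, E) E (TangentSpace 𝓘(ℝ, E) : M → Type _))

/-- The covariant derivatives of a constant coordinate field, in the preferred chart at `x₀`. -/
def covConst (x₀ : M) (u e : E) : E →L[ℝ] E :=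
  (tcoord 𝓘(ℝ, E) x₀ ((extChartAt 𝓘(ℝ, E) x₀).symm e)).comp
    ((cov (constField x₀ u) ((extChartAt 𝓘(ℝ, E) x₀).symm e)).comp
      (tcoordSymm 𝓘(ℝ, E) x₀ ((extChartAt 𝓘(ℝ, E) x₀).symm e)))

/-- The Christoffel symbols of a connection in the preferred chart at `x₀`. -/
def christoffel (x₀ : M) (e : E) : E →L[ℝ] E →L[ℝ] E :=
  ∑ i, (ContinuousLinearMap.smulRightL ℝ E E
    (((Module.finBasis ℝ E).coord i).toContinuousLinearMap)).comp
      (covConst cov x₀ (Module.finBasis ℝ E i) e)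

theorem christoffel_apply (x₀ : M) (e v u : E) :
    christoffel cov x₀ e v u = ∑ i, (Module.finBasis ℝ E).repr u i •
      covConst cov x₀ (Module.finBasis ℝ E i) e v := by
  simp [christoffel]

theorem contDiffOn_covConst [T2Space M] [cov.ContMDiffCovariantDerivative ∞] (x₀ : M) (u : E) :
    ContDiffOn ℝ ∞ (covConst cov x₀ u) (extChartAt 𝓘(ℝ, E) x₀).target := by
  rw [contDiffOn_clm_apply]
  intro v e he
  refine ContDiffAt.contDiffWithinAt ?_
  set z := (extChartAt 𝓘(ℝ, E) x₀).symm e with hz_def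
  have hz : z ∈ (extChartAt 𝓘(ℝ, E) x₀).source := (extChartAt 𝓘(ℝ, E) x₀).map_target he
  -- Smoothness of the connection is a statement about globally smooth sections, so the constant
  -- field is cut off by a bump function supported in the chart domain.
  obtain ⟨χ, -, hχ⟩ := (SmoothBumpFunction.nhds_basis_tsupport (I := 𝓘(ℝ, E)) z).mem_iff.1
    ((isOpen_extChartAt_source x₀).mem_nhds hz)
  have hσ : ContMDiff 𝓘(ℝ, E) 𝓘(ℝ, E).tangent ∞
      (fun z => (⟨z, ((χ : M → ℝ) • constField x₀ u) z⟩ : T1 E M)) :=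
    ContMDiffOn.smul_section_of_tsupport χ.contMDiff.contMDiffOn
      (isOpen_extChartAt_source (I := 𝓘(ℝ, E)) x₀) hχ
      (fun z' hz' => (contMDiffAt_constField hz' u).contMDiffWithinAt)
  have hc := (ContMDiffCovariantDerivativeOn.contMDiff (k := ∞)
    (self := CovariantDerivative.ContMDiffCovariantDerivative.contMDiff (cov := cov))
    (σ := (χ : M → ℝ) • constField x₀ u) hσ.contMDiffOn).contMDiffAt (x := z) Filter.univ_mem
  have h1 := (contMDiffAt_field hz).1 (hc.clm_bundle_apply (contMDiffAt_constField hz v))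
  have h2 : ContMDiffAt 𝓘(ℝ, E) 𝓘(ℝ, E) ∞ (extChartAt 𝓘(ℝ, E) x₀).symm e :=
    (contMDiffOn_extChartAt_symm x₀).contMDiffAt ((isOpen_extChartAt_target x₀).mem_nhds he)
  refine ContDiffAt.congr_of_eventuallyEq (ContMDiffAt.comp e h1 h2).contDiffAt ?_
  -- A covariant derivative at `z'` sees the germ of the section there, so the cutoff must equal 1
  -- near every nearby `z'`, not only at it.
  have h3 : ∀ᶠ z' in 𝓝 z, χ =ᶠ[𝓝 z'] 1 := χ.eventuallyEq_one.eventuallyEq_nhds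
  have h4 := (h2.continuousAt.eventually h3).and
    ((isOpen_extChartAt_target (I := 𝓘(ℝ, E)) x₀).mem_nhds he)
  filter_upwards [h4] with e' he'
  have hz' := (extChartAt 𝓘(ℝ, E) x₀).map_target he'.2
  have h5 : cov (constField x₀ u) ((extChartAt 𝓘(ℝ, E) x₀).symm e') =
      cov ((χ : M → ℝ) • constField x₀ u) ((extChartAt 𝓘(ℝ, E) x₀).symm e') :=
    cov.isCovariantDerivativeOnUniv.congr_of_eventuallyEq (mdifferentiableAt_constField hz' u)
      (hσ.contMDiffAt.mdifferentiableAt (by simp)) Filter.univ_mem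
      (he'.1.mono fun z'' h => by simp [h])
  simp only [covConst, ContinuousLinearMap.comp_apply, h5, Function.comp]
  rfl

theorem contDiffOn_christoffel [T2Space M] [cov.ContMDiffCovariantDerivative ∞] (x₀ : M) :
    ContDiffOn ℝ ∞ (christoffel cov x₀) (extChartAt 𝓘(ℝ, E) x₀).target :=
  ContDiffOn.sum fun _ _ => contDiffOn_const.clm_comp (contDiffOn_covConst cov x₀ _)

theorem mdifferentiableAt_sum_smul {ι : Type*} (s : Finset ι) {z : M} {c : ι → M → ℝ}
    {σ : ι → (z : M) → TangentSpace 𝓘(ℝ, E) z}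
    (hc : ∀ i, MDifferentiableAt 𝓘(ℝ, E) 𝓘(ℝ, ℝ) (c i) z)
    (hσ : ∀ i, MDifferentiableAt 𝓘(ℝ, E) 𝓘(ℝ, E).tangent (fun z => (⟨z, σ i z⟩ : T1 E M)) z) :
    MDifferentiableAt 𝓘(ℝ, E) 𝓘(ℝ, E).tangent
      (fun z => (⟨z, (∑ i ∈ s, c i • σ i) z⟩ : T1 E M)) z := by
  have h := MDifferentiableAt.sum_section (I := 𝓘(ℝ, E)) (s := s)
    (t := fun i => c i • σ i) fun i _ => MDifferentiableAt.smul_section (hc i) (hσ i)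
  convert! h using 3
  exact Finset.sum_apply _ _ _

theorem cov_sum_smul {ι : Type*} (s : Finset ι) {z : M} {c : ι → M → ℝ}
    {σ : ι → (z : M) → TangentSpace 𝓘(ℝ, E) z}
    (hc : ∀ i, MDifferentiableAt 𝓘(ℝ, E) 𝓘(ℝ, ℝ) (c i) z)
    (hσ : ∀ i, MDifferentiableAt 𝓘(ℝ, E) 𝓘(ℝ, E).tangent (fun z => (⟨z, σ i z⟩ : T1 E M)) z) :
    cov (∑ i ∈ s, c i • σ i) z =
      ∑ i ∈ s, (c i z • cov (σ i) z + (mvfderiv 𝓘(ℝ, E) (c i) z).smulRight (σ i z)) := by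
  classical
  induction s using Finset.induction_on with
  | empty => simp
  | insert i s hi ih =>
    rw [Finset.sum_insert hi, Finset.sum_insert hi, ← ih,
      ← cov.isCovariantDerivativeOnUniv.leibniz (hσ i) (hc i)]
    exact cov.isCovariantDerivativeOnUniv.add
      (MDifferentiableAt.smul_section (hc i) (hσ i)) (mdifferentiableAt_sum_smul s hc hσ)

/-- Near `z` the field is a combination of the constant frame fields with the components of `g` as
coefficients. The Leibniz rule yields one sum that reassembles to `Dg` and another that is the
Christoffel term. -/
theorem tcoord_cov {x₀ z : M} (hz : z ∈ (extChartAt 𝓘(ℝ, E) x₀).source)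
    {Y : (z : M) → TangentSpace 𝓘(ℝ, E) z} {g : E → E}
    (hY : ∀ᶠ z' in 𝓝 z, tcoord 𝓘(ℝ, E) x₀ z' (Y z') = g (extChartAt 𝓘(ℝ, E) x₀ z'))
    (hg : DifferentiableAt ℝ g (extChartAt 𝓘(ℝ, E) x₀ z)) (v : TangentSpace 𝓘(ℝ, E) z) :
    tcoord 𝓘(ℝ, E) x₀ z (cov Y z v) =
      fderiv ℝ g (extChartAt 𝓘(ℝ, E) x₀ z) (tcoord 𝓘(ℝ, E) x₀ z v) +
        christoffel cov x₀ (extChartAt 𝓘(ℝ, E) x₀ z) (tcoord 𝓘(ℝ, E) x₀ z v)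
          (g (extChartAt 𝓘(ℝ, E) x₀ z)) := by
  set b := Module.finBasis ℝ E with hb
  set φ := extChartAt 𝓘(ℝ, E) x₀ with hφ
  let L : ∀ i, E →L[ℝ] ℝ := fun i => (b.coord i).toContinuousLinearMap
  have hLb : ∀ w : E, ∑ i, L i w • b i = w := fun w => b.sum_repr w
  let c : Fin (Module.finrank ℝ E) → M → ℝ := fun i z' => L i (g (φ z'))
  have hLg : ∀ i, DifferentiableAt ℝ (fun e => L i (g e)) (φ z) := fun i =>
    (L i).differentiableAt.comp _ hg
  have hc : ∀ i, MDifferentiableAt 𝓘(ℝ, E) 𝓘(ℝ, ℝ) (c i) z := fun i =>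
    mdifferentiableAt_comp_chart hz (hLg i)
  have hσ := fun i => mdifferentiableAt_constField hz (b i)
  have hYσ : ∀ᶠ z' in 𝓝 z, Y z' = (∑ i, c i • constField x₀ (b i)) z' := by
    filter_upwards [hY, eventually_mem_source hz] with z' h1 h2
    apply tcoord_injective h2
    rw [h1, Finset.sum_apply, map_sum]
    conv_lhs => rw [← hLb (g (φ z'))]
    refine Finset.sum_congr rfl fun i _ => ?_
    refine Eq.trans ?_ ((tcoord 𝓘(ℝ, E) x₀ z').map_smul (c i z') (constField x₀ (b i) z')).symm
    rw [constField, tcoord_tcoordSymm h2]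
  rw [cov.isCovariantDerivativeOnUniv.congr_of_eventuallyEq
    (mdifferentiableAt_of_tcoord hz hY hg) (mdifferentiableAt_sum_smul Finset.univ hc hσ)
    Filter.univ_mem hYσ, cov_sum_smul cov Finset.univ hc hσ]
  have hd : ∀ i, mvfderiv 𝓘(ℝ, E) (c i) z v = L i (fderiv ℝ g (φ z) (tcoord 𝓘(ℝ, E) x₀ z v)) := by
    intro i
    refine (mfderiv_comp_chart hz (hLg i) v).trans ?_
    rw [fderiv_fun_comp _ (L i).differentiableAt hg, ContinuousLinearMap.fderiv]
    rfl
  have hz' : φ.symm (φ z) = z := φ.left_inv hz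
  have hcv : ∀ i, covConst cov x₀ (b i) (φ z) (tcoord 𝓘(ℝ, E) x₀ z v) =
      tcoord 𝓘(ℝ, E) x₀ z (cov (constField x₀ (b i)) z v) := by
    intro i
    simp only [covConst, ContinuousLinearMap.comp_apply]
    rw [← hφ, hz', tcoordSymm_tcoord hz]
  rw [christoffel_apply, sum_apply, map_sum]
  conv_rhs => rw [← hLb (fderiv ℝ g (φ z) (tcoord 𝓘(ℝ, E) x₀ z v)), ← Finset.sum_add_distrib]
  refine Finset.sum_congr rfl fun i _ => ?_
  rw [← hb, hcv, add_apply, map_add, add_comm]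
  congr 1
  · rw [ContinuousLinearMap.smulRight_apply, hd, map_smul]
    congr 1
    exact tcoord_tcoordSymm hz _
  · rw [smul_apply, map_smul]
    rfl

theorem tcoord_cov_constField {x₀ z : M} (hz : z ∈ (extChartAt 𝓘(ℝ, E) x₀).source)
    (u : E) (v : TangentSpace 𝓘(ℝ, E) z) :
    tcoord 𝓘(ℝ, E) x₀ z (cov (constField x₀ u) z v) =
      christoffel cov x₀ (extChartAt 𝓘(ℝ, E) x₀ z) (tcoord 𝓘(ℝ, E) x₀ z v) u := by
  have h := tcoord_cov cov hz (Y := constField x₀ u) (g := fun _ => u)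
    (by filter_upwards [eventually_mem_source hz] with z' hz' using tcoord_tcoordSymm hz' u)
    (differentiableAt_const u) v
  simpa using h

/-- Torsion is tensorial, so it may be evaluated on the constant fields through the two vectors,
whose bracket vanishes. -/
theorem tcoord_torsion [CompleteSpace E] {x₀ z : M} (hz : z ∈ (extChartAt 𝓘(ℝ, E) x₀).source)
    (X Y : TangentSpace 𝓘(ℝ, E) z) :
    tcoord 𝓘(ℝ, E) x₀ z (cov.torsion z X Y) =
      christoffel cov x₀ (extChartAt 𝓘(ℝ, E) x₀ z) (tcoord 𝓘(ℝ, E) x₀ z X)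
          (tcoord 𝓘(ℝ, E) x₀ z Y) -
        christoffel cov x₀ (extChartAt 𝓘(ℝ, E) x₀ z) (tcoord 𝓘(ℝ, E) x₀ z Y)
          (tcoord 𝓘(ℝ, E) x₀ z X) := by
  have h := cov.torsion_apply
    (mdifferentiableAt_constField hz (tcoord 𝓘(ℝ, E) x₀ z X))
    (mdifferentiableAt_constField hz (tcoord 𝓘(ℝ, E) x₀ z Y))
  have hX : ∀ X : TangentSpace 𝓘(ℝ, E) z,
    constField x₀ (tcoord 𝓘(ℝ, E) x₀ z X) z = X := fun X => tcoordSymm_tcoord hz X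
  rw [mlieBracket_constField hz, hX, hX, sub_zero] at h
  rw [h, map_sub, tcoord_cov_constField cov hz, tcoord_cov_constField cov hz]

/-- The torsion in the preferred chart at `x₀`. -/
def torsionCoord (x₀ : M) (e : E) : E →L[ℝ] E →L[ℝ] E :=
  christoffel cov x₀ e - (christoffel cov x₀ e).flip

theorem torsionCoord_apply (x₀ : M) (e u v : E) :
    torsionCoord cov x₀ e u v = christoffel cov x₀ e u v - christoffel cov x₀ e v u := rfl

theorem torsion_eq [CompleteSpace E] (x : M) (X Y : E) :
    (cov.torsion x X Y : E) = torsionCoord cov x (extChartAt 𝓘(ℝ, E) x x) X Y := by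
  have h := tcoord_torsion cov (mem_extChartAt_source (I := 𝓘(ℝ, E)) x) X Y
  have h' : ∀ v : E, tcoord 𝓘(ℝ, E) x x v = v := tcoord_self x
  rw [h' X, h' Y] at h
  exact (h' _).symm.trans h

theorem differentiableAt_christoffel [T2Space M] [cov.ContMDiffCovariantDerivative ∞] (x₀ : M)
    {e : E} (he : e ∈ (extChartAt 𝓘(ℝ, E) x₀).target) :
    DifferentiableAt ℝ (christoffel cov x₀) e :=
  ((contDiffOn_christoffel cov x₀).contDiffAt
    ((isOpen_extChartAt_target x₀).mem_nhds he)).differentiableAt (by simp)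

theorem differentiableAt_torsionCoord [T2Space M] [cov.ContMDiffCovariantDerivative ∞] (x₀ : M)
    {e : E} (he : e ∈ (extChartAt 𝓘(ℝ, E) x₀).target) :
    DifferentiableAt ℝ (torsionCoord cov x₀) e := by
  have h := differentiableAt_christoffel cov x₀ he
  exact h.sub ((ContinuousLinearMap.flipₗᵢ ℝ E E E).toContinuousLinearEquiv.differentiableAt.comp
    e h)

theorem cov_eq_self (x : M) {Y : (z : M) → TangentSpace 𝓘(ℝ, E) z} {g : E → E}
    (hY : ∀ᶠ z' in 𝓝 x, tcoord 𝓘(ℝ, E) x z' (Y z') = g (extChartAt 𝓘(ℝ, E) x z'))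
    (hg : DifferentiableAt ℝ g (extChartAt 𝓘(ℝ, E) x x)) (v : E) :
    (cov Y x v : E) = fderiv ℝ g (extChartAt 𝓘(ℝ, E) x x) v +
      christoffel cov x (extChartAt 𝓘(ℝ, E) x x) v (g (extChartAt 𝓘(ℝ, E) x x)) := by
  have h := tcoord_cov cov (mem_extChartAt_source x) hY hg v
  have h' : ∀ v : E, tcoord 𝓘(ℝ, E) x x v = v := tcoord_self x
  rw [h' v] at h
  exact (h' _).symm.trans h

theorem cov_constField_self (x : M) (u v : E) :
    (cov (constField x u) x v : E) = christoffel cov x (extChartAt 𝓘(ℝ, E) x x) v u := by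
  have h := tcoord_cov_constField cov (mem_extChartAt_source (I := 𝓘(ℝ, E)) x) u v
  have h' : ∀ v : E, tcoord 𝓘(ℝ, E) x x v = v := tcoord_self x
  rw [h' v] at h
  exact (h' _).symm.trans h

theorem cov_extend {x z : M} (hz : z ∈ (extChartAt 𝓘(ℝ, E) x).source)
    (v : TangentSpace 𝓘(ℝ, E) x) :
    cov (FiberBundle.extend E v) z = cov (constField (E := E) x v) z := by
  have hev : ∀ᶠ z' in 𝓝 z, FiberBundle.extend E v z' = constField (E := E) x v z' := by
    filter_upwards [eventually_mem_source hz] with z' hz' using extend_eq_constField hz' v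
  have hm := mdifferentiableAt_constField hz v
  refine cov.isCovariantDerivativeOnUniv.congr_of_eventuallyEq
    (hm.congr_of_eventuallyEq ?_) hm Filter.univ_mem hev
  filter_upwards [hev] with z' hz'
  rw [hz']

/-- The extensions chosen in `covTorsion` are constant fields on the chart domain, so `T(Y, X)` has
coordinates `torsionCoord` evaluated on fixed vectors, and `cov_eq_self` applies to it. -/
theorem covTorsion_eq [CompleteSpace E] [T2Space M] [cov.ContMDiffCovariantDerivative ∞]
    (x : M) (Z Y X : E) :
    (covTorsion cov x Z Y X : E) =
      fderiv ℝ (torsionCoord cov x) (extChartAt 𝓘(ℝ, E) x x) Z Y X +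
      christoffel cov x (extChartAt 𝓘(ℝ, E) x x) Z
        (torsionCoord cov x (extChartAt 𝓘(ℝ, E) x x) Y X) -
      torsionCoord cov x (extChartAt 𝓘(ℝ, E) x x)
        (christoffel cov x (extChartAt 𝓘(ℝ, E) x x) Z Y) X -
      torsionCoord cov x (extChartAt 𝓘(ℝ, E) x x) Y
        (christoffel cov x (extChartAt 𝓘(ℝ, E) x x) Z X) := by
  have hx := mem_extChartAt_source (I := 𝓘(ℝ, E)) x
  have ht := differentiableAt_torsionCoord cov x (mem_extChartAt_target (I := 𝓘(ℝ, E)) x)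
  have h1 := cov_eq_self cov x
    (Y := fun z => cov.torsion z (FiberBundle.extend (x := x) E Y z)
      (FiberBundle.extend (x := x) E X z))
    (g := fun e => torsionCoord cov x e Y X)
    (by
      filter_upwards [eventually_mem_source hx] with z hz
      refine (congrArg (tcoord 𝓘(ℝ, E) x z) (congrArg₂ (fun a b => cov.torsion z a b)
        (extend_eq_constField hz Y) (extend_eq_constField hz X))).trans ?_
      rw [tcoord_torsion cov hz, constField,
        constField, tcoord_tcoordSymm hz, tcoord_tcoordSymm hz, torsionCoord_apply])
    ((ht.clm_apply (differentiableAt_const Y)).clm_apply (differentiableAt_const X)) Z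
  have h2 : fderiv ℝ (fun e => torsionCoord cov x e Y X) (extChartAt 𝓘(ℝ, E) x x) Z =
      fderiv ℝ (torsionCoord cov x) (extChartAt 𝓘(ℝ, E) x x) Z Y X := by
    rw [fderiv_clm_apply (ht.clm_apply (differentiableAt_const Y)) (differentiableAt_const X),
      fderiv_clm_apply ht (differentiableAt_const Y)]
    simp
  rw [h2] at h1
  have h3 : ∀ v : E, (cov (FiberBundle.extend (x := x) E v) x Z : E) =
      christoffel cov x (extChartAt 𝓘(ℝ, E) x x) Z v := fun v =>
    (DFunLike.congr_fun (cov_extend cov hx v) Z).trans (cov_constField_self cov x v Z)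
  refine congrArg₂ (fun a b : E => a - b) (congrArg₂ (fun a b : E => a - b) h1 ?_) ?_
  · exact (torsion_eq cov x _ X).trans (by rw [h3])
  · exact (torsion_eq cov x Y _).trans (by rw [h3])

/-- The extended fields commute near the base point, so only the two iterated derivatives remain.
Each is `cov_eq_self` applied to the field with coordinates `Γ(Y, Z)`. -/
theorem curvature_eq [CompleteSpace E] [T2Space M] [cov.ContMDiffCovariantDerivative ∞]
    (x : M) (X Y Z : E) :
    (curvature cov x X Y Z : E) =
      fderiv ℝ (christoffel cov x) (extChartAt 𝓘(ℝ, E) x x) X Y Z +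
      christoffel cov x (extChartAt 𝓘(ℝ, E) x x) X
        (christoffel cov x (extChartAt 𝓘(ℝ, E) x x) Y Z) -
      (fderiv ℝ (christoffel cov x) (extChartAt 𝓘(ℝ, E) x x) Y X Z +
      christoffel cov x (extChartAt 𝓘(ℝ, E) x x) Y
        (christoffel cov x (extChartAt 𝓘(ℝ, E) x x) X Z)) := by
  have hx := mem_extChartAt_source (I := 𝓘(ℝ, E)) x
  have ht := differentiableAt_christoffel cov x (mem_extChartAt_target (I := 𝓘(ℝ, E)) x)
  have h1 : ∀ X Y : E, (cov (fun z => cov (FiberBundle.extend (x := x) E Z) z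
      (FiberBundle.extend (x := x) E Y z)) x X : E) =
      fderiv ℝ (christoffel cov x) (extChartAt 𝓘(ℝ, E) x x) X Y Z +
      christoffel cov x (extChartAt 𝓘(ℝ, E) x x) X
        (christoffel cov x (extChartAt 𝓘(ℝ, E) x x) Y Z) := by
    intro X Y
    have h2 : fderiv ℝ (fun e => christoffel cov x e Y Z) (extChartAt 𝓘(ℝ, E) x x) X =
        fderiv ℝ (christoffel cov x) (extChartAt 𝓘(ℝ, E) x x) X Y Z := by
      rw [fderiv_clm_apply (ht.clm_apply (differentiableAt_const Y)) (differentiableAt_const Z),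
        fderiv_clm_apply ht (differentiableAt_const Y)]
      simp
    rw [← h2]
    refine cov_eq_self cov x (g := fun e => christoffel cov x e Y Z) ?_
      ((ht.clm_apply (differentiableAt_const Y)).clm_apply (differentiableAt_const Z)) X
    filter_upwards [eventually_mem_source hx] with z hz
    refine (congrArg (tcoord 𝓘(ℝ, E) x z) (congrArg₂ (fun a b => a b)
      (cov_extend cov hz Z) (extend_eq_constField hz Y))).trans ?_
    rw [tcoord_cov_constField cov hz, constField, tcoord_tcoordSymm hz]
  have h3 : VectorField.mlieBracket 𝓘(ℝ, E) (FiberBundle.extend (x := x) E X)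
      (FiberBundle.extend (x := x) E Y) x = 0 := by
    rw [← mlieBracket_constField hx X Y]
    refine Filter.EventuallyEq.mlieBracket_vectorField_eq ?_ ?_ <;>
    filter_upwards [eventually_mem_source hx] with z hz using extend_eq_constField hz _
  refine (congrArg₂ (fun a b : E => a - b) (congrArg₂ (fun a b : E => a - b) (h1 X Y) (h1 Y X))
    ((congrArg _ h3).trans (map_zero _))).trans (sub_zero (G := E) _)

end Christoffel

/-! ### Local models of the actions of jet fields, and their derivatives -/

section Model

variable {E : Type*} [NormedAddCommGroup E] [NormedSpace ℝ E]

/-- The map of `E × E` with components `α(e)` and `A(e) u`. -/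
def model₁ (α : E → E) (A : E → E →L[ℝ] E) (e : E × E) : E × E := (α e.1, A e.1 e.2)

/-- The map of `(E × E) × (E × E)` that represents the action on `T²M` of a field of
`(1,1)`-jets. -/
def model₂ (α : E → E) (A B : E → E →L[ℝ] E) (G : E → E →L[ℝ] E →L[ℝ] E)
    (e : (E × E) × (E × E)) : (E × E) × (E × E) :=
  ((α e.1.1, A e.1.1 e.1.2), (B e.1.1 e.2.1, A e.1.1 e.2.2 + G e.1.1 e.2.1 e.1.2))

variable {α : E → E} {A B : E → E →L[ℝ] E} {G : E → E →L[ℝ] E →L[ℝ] E}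

/-- The derivative is given by its values only; the explicit operator assembled by the product rule
is never needed. -/
theorem hasFDerivAt_model₁ {e u : E} (hα : DifferentiableAt ℝ α e) (hA : DifferentiableAt ℝ A e) :
    ∃ L : E × E →L[ℝ] E × E, HasFDerivAt (model₁ α A) L (e, u) ∧
      ∀ v w, L (v, w) = (fderiv ℝ α e v, A e w + fderiv ℝ A e v u) := by
  have h1 : HasFDerivAt (Prod.fst : E × E → E) (ContinuousLinearMap.fst ℝ E E) (e, u) :=
    hasFDerivAt_fst
  have h2 : HasFDerivAt (Prod.snd : E × E → E) (ContinuousLinearMap.snd ℝ E E) (e, u) :=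
    hasFDerivAt_snd
  have hα' := HasFDerivAt.comp (e, u) hα.hasFDerivAt h1
  have hA' := HasFDerivAt.clm_apply (HasFDerivAt.comp (e, u) hA.hasFDerivAt h1) h2
  exact ⟨_, hα'.prodMk hA', fun v w => by simp⟩

theorem differentiableAt_model₁ {e : E × E} (hα : DifferentiableAt ℝ α e.1)
    (hA : DifferentiableAt ℝ A e.1) : DifferentiableAt ℝ (model₁ α A) e := by
  obtain ⟨L, hL, -⟩ := hasFDerivAt_model₁ (u := e.2) hα hA
  exact hL.differentiableAt

theorem fderiv_model₁ {e u v w : E} (hα : DifferentiableAt ℝ α e) (hA : DifferentiableAt ℝ A e) :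
    fderiv ℝ (model₁ α A) (e, u) (v, w) = (fderiv ℝ α e v, A e w + fderiv ℝ A e v u) := by
  obtain ⟨L, hL, h⟩ := hasFDerivAt_model₁ (u := u) hα hA
  rw [hL.fderiv, h]

theorem hasFDerivAt_model₂ {e : (E × E) × (E × E)} (hα : DifferentiableAt ℝ α e.1.1)
    (hA : DifferentiableAt ℝ A e.1.1) (hB : DifferentiableAt ℝ B e.1.1)
    (hG : DifferentiableAt ℝ G e.1.1) :
    ∃ L : (E × E) × (E × E) →L[ℝ] (E × E) × (E × E), HasFDerivAt (model₂ α A B G) L e ∧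
      ∀ p q r s, L ((p, q), (r, s)) =
      ((fderiv ℝ α e.1.1 p, A e.1.1 q + fderiv ℝ A e.1.1 p e.1.2),
        (B e.1.1 r + fderiv ℝ B e.1.1 p e.2.1,
          (A e.1.1 s + fderiv ℝ A e.1.1 p e.2.2) + (G e.1.1 e.2.1 q +
            (G e.1.1 r e.1.2 + fderiv ℝ G e.1.1 p e.2.1 e.1.2)))) := by
  have h0 : HasFDerivAt (𝕜 := ℝ) (Prod.fst : (E × E) × (E × E) → E × E) _ e := hasFDerivAt_fst
  have h0' : HasFDerivAt (𝕜 := ℝ) (Prod.snd : (E × E) × (E × E) → E × E) _ e := hasFDerivAt_snd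
  have h1 := h0.fst
  have h2 := h0.snd
  have h3 := h0'.fst
  have h4 := h0'.snd
  have hα' := HasFDerivAt.comp e hα.hasFDerivAt h1
  have hA' := HasFDerivAt.comp e hA.hasFDerivAt h1
  have hB' := HasFDerivAt.comp e hB.hasFDerivAt h1
  have hG' := HasFDerivAt.comp (g := G) (f := fun e : (E × E) × (E × E) => e.1.1) e
    hG.hasFDerivAt h1
  exact ⟨_, (hα'.prodMk (hA'.clm_apply h2)).prodMk ((hB'.clm_apply h3).prodMk
    ((hA'.clm_apply h4).add ((hG'.clm_apply h3).clm_apply h2))), fun p q r s => by simp⟩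

theorem differentiableAt_model₂ {e : (E × E) × (E × E)} (hα : DifferentiableAt ℝ α e.1.1)
    (hA : DifferentiableAt ℝ A e.1.1) (hB : DifferentiableAt ℝ B e.1.1)
    (hG : DifferentiableAt ℝ G e.1.1) : DifferentiableAt ℝ (model₂ α A B G) e := by
  obtain ⟨L, hL, -⟩ := hasFDerivAt_model₂ hα hA hB hG
  exact hL.differentiableAt

theorem contDiffAt_model₁ {e : E × E} {n : ℕ∞} (hα : ContDiffAt ℝ n α e.1)
    (hA : ContDiffAt ℝ n A e.1) : ContDiffAt ℝ n (model₁ α A) e :=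
  (hα.comp e contDiffAt_fst).prodMk ((hA.comp e contDiffAt_fst).clm_apply contDiffAt_snd)

theorem contDiffAt_model₂ {e : (E × E) × (E × E)} {n : ℕ∞} (hα : ContDiffAt ℝ n α e.1.1)
    (hA : ContDiffAt ℝ n A e.1.1) (hB : ContDiffAt ℝ n B e.1.1) (hG : ContDiffAt ℝ n G e.1.1) :
    ContDiffAt ℝ n (model₂ α A B G) e := by
  have h1 : ContDiffAt ℝ n (fun e : (E × E) × (E × E) => e.1.1) e :=
    contDiffAt_fst.comp e contDiffAt_fst
  have h2 : ContDiffAt ℝ n (fun e : (E × E) × (E × E) => e.1.2) e :=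
    contDiffAt_snd.comp e contDiffAt_fst
  have h3 : ContDiffAt ℝ n (fun e : (E × E) × (E × E) => e.2.1) e :=
    contDiffAt_fst.comp e contDiffAt_snd
  have h4 : ContDiffAt ℝ n (fun e : (E × E) × (E × E) => e.2.2) e :=
    contDiffAt_snd.comp e contDiffAt_snd
  have hA' := hA.comp e h1
  exact ((hα.comp e h1).prodMk (hA'.clm_apply h2)).prodMk (((hB.comp e h1).clm_apply h3).prodMk
    ((hA'.clm_apply h4).add (((hG.comp e h1).clm_apply h3).clm_apply h2)))

end Model

/-! ### The canonical involution in an arbitrary chart -/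

section Kappa

variable {F : Type*} [NormedAddCommGroup F] [NormedSpace ℝ F]
  {H : Type*} [TopologicalSpace H] {I : ModelWithCorners ℝ F H} [I.Boundaryless]
  {N : Type*} [TopologicalSpace N] [ChartedSpace H N] [IsManifold I ∞ N]

theorem isRep_id (x₀ z : N) : IsRep I I z x₀ id
    (fun e => extChartAt I x₀ ((extChartAt I z).symm e))
    ((extChartAt I z).source ∩ (extChartAt I x₀).source) where
  isOpen := (isOpen_extChartAt_source z).inter (isOpen_extChartAt_source x₀)
  source _ hq := hq.1
  mapsTo _ hq := hq.2
  eq q hq := by rw [(extChartAt I z).left_inv hq.1]; rfl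

/-- Here `τ` is the transition from the preferred chart at `z` to the one at `x₀`, that is the
identity of `N` read in two charts. Its tangent map is the transition map of the tangent bundle, and
differentiating that produces the second derivative of `τ`. -/
theorem tcoord_tangent {x₀ z : N} (hz : z ∈ (extChartAt I x₀).source) :
    ∃ τ : F → F, ContDiffAt ℝ 2 τ (extChartAt I z z) ∧
      (∀ u v w : F, tcoord I.tangent (⟨x₀, (0 : F)⟩ : TangentBundle I N) (⟨z, u⟩ : TangentBundle I N) (v, w) =
        (fderiv ℝ τ (extChartAt I z z) v,
          fderiv ℝ τ (extChartAt I z z) w + fderiv ℝ (fderiv ℝ τ) (extChartAt I z z) v u)) ∧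
      ∀ v : F, tcoord I x₀ z v = fderiv ℝ τ (extChartAt I z z) v := by
  have r := isRep_id (I := I) x₀ z
  set τ := fun e => extChartAt I x₀ ((extChartAt I z).symm e) with hτ
  have hs : ∀ q ∈ (extChartAt I z).source ∩ (extChartAt I x₀).source,
      ContDiffAt ℝ 2 τ (extChartAt I z q) := fun q hq => r.contDiffAt hq contMDiffAt_id
  have hzz : z ∈ (extChartAt I z).source ∩ (extChartAt I x₀).source :=
    ⟨mem_extChartAt_source z, hz⟩
  have r' := r.tangentMap (fun q hq => (hs q hq).differentiableAt (by simp)) (0 : F) (0 : F)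
  have hd := hs z hzz
  have hd1 : DifferentiableAt ℝ τ (extChartAt I z z) := hd.differentiableAt (by simp)
  have hd2 : DifferentiableAt ℝ (fderiv ℝ τ) (extChartAt I z z) :=
    (hd.fderiv_right (m := 1) (by norm_num)).differentiableAt (by simp)
  rw [tangentMap_id] at r'
  have hself : ∀ v : F, tcoord I z z v = v := tcoord_self z
  have h1 : ∀ v : F, tcoord I x₀ z v = fderiv ℝ τ (extChartAt I z z) v := by
    intro v
    have e := r.tcoord_mfderiv hzz hd1 v
    rw [mfderiv_id, hself] at e
    exact e
  refine ⟨τ, hd, fun u v w => ?_, h1⟩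
  have e := r'.tcoord_mfderiv (q := (⟨z, u⟩ : TangentBundle I N)) hzz (by
    rw [extChartAt_tangent_apply_self z (0 : F) u]
    exact differentiableAt_model₁ (α := τ) (A := fderiv ℝ τ) hd1 hd2) (v, w)
  rw [extChartAt_tangent_apply_self z (0 : F) u, mfderiv_id] at e
  have hself' : tcoord I.tangent (⟨z, (0 : F)⟩ : TangentBundle I N) (⟨z, u⟩ : TangentBundle I N)
    (v, w) = (v, w) := tcoord_self (⟨z, u⟩ : TangentBundle I N) (v, w)
  rw [hself'] at e
  exact e.trans (fderiv_model₁ (α := τ) (A := fderiv ℝ τ) hd1 hd2)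

theorem extChartAt_tangent_tangent_apply {x₀ : N} {q : TangentBundle I N}
    (hq : q.1 ∈ (extChartAt I x₀).source) (t : F × F) :
    extChartAt I.tangent.tangent
        (⟨⟨x₀, (0 : F)⟩, (0 : F × F)⟩ : TangentBundle I.tangent (TangentBundle I N))
        (⟨q, t⟩ : TangentBundle I.tangent (TangentBundle I N)) =
      ((extChartAt I x₀ q.1, tcoord I x₀ q.1 q.2),
        tcoord I.tangent (⟨x₀, (0 : F)⟩ : TangentBundle I N) q t) := by
  have h := extChartAt_tangent_apply (I := I) (p := (⟨x₀, (0 : F)⟩ : TangentBundle I N)) hq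
  rw [← h]
  exact extChartAt_tangent_apply (I := I.tangent)
    (p := (⟨⟨x₀, (0 : F)⟩, (0 : F × F)⟩ : TangentBundle I.tangent (TangentBundle I N)))
    (q := (⟨q, t⟩ : TangentBundle I.tangent (TangentBundle I N)))
    (mem_extChartAt_tangent_source.2 hq)

/-- The canonical involution exchanges the two middle coordinates in every chart. -/
theorem isRep_kappa (x₀ : N) :
    IsRep I.tangent.tangent I.tangent.tangent
      (⟨⟨x₀, (0 : F)⟩, (0 : F × F)⟩ : TangentBundle I.tangent (TangentBundle I N))
      (⟨⟨x₀, (0 : F)⟩, (0 : F × F)⟩ : TangentBundle I.tangent (TangentBundle I N))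
      (kappa I) (fun e => ((e.1.1, e.2.1), (e.1.2, e.2.2))) {X | X.1.1 ∈ (extChartAt I x₀).source} where
  isOpen := by
    have h1 := FiberBundle.continuous_proj F (TangentSpace I : N → Type _)
    have h2 := FiberBundle.continuous_proj (F × F)
      (TangentSpace I.tangent : TangentBundle I N → Type _)
    exact (isOpen_extChartAt_source x₀).preimage (h1.comp h2)
  source X hX := mem_extChartAt_tangent_source.2 (mem_extChartAt_tangent_source.2 hX)
  mapsTo X hX := mem_extChartAt_tangent_source.2 (mem_extChartAt_tangent_source.2 hX)
  eq X hX := by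
    obtain ⟨⟨z, u⟩, ⟨v, w⟩⟩ := X
    obtain ⟨τ, hτ, h2, h1⟩ := tcoord_tangent (show z ∈ (extChartAt I x₀).source from hX)
    have key : ∀ u v w : F, extChartAt I.tangent.tangent
        (⟨⟨x₀, (0 : F)⟩, (0 : F × F)⟩ : TangentBundle I.tangent (TangentBundle I N))
        (⟨⟨z, u⟩, (v, w)⟩ : TangentBundle I.tangent (TangentBundle I N)) =
        ((extChartAt I x₀ z, fderiv ℝ τ (extChartAt I z z) u),
          (fderiv ℝ τ (extChartAt I z z) v, fderiv ℝ τ (extChartAt I z z) w +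
            fderiv ℝ (fderiv ℝ τ) (extChartAt I z z) v u)) := by
      intro u v w
      refine (extChartAt_tangent_tangent_apply (q := (⟨z, u⟩ : TangentBundle I N)) hX _).trans ?_
      exact congrArg₂ (fun a b : F × F => (a, b))
        (congrArg (fun a => (extChartAt I x₀ z, a)) (h1 u)) (h2 u v w)
    -- The only obstruction to chart independence of the exchange is the second order term of the
    -- transition map, which is symmetric in the two exchanged vectors.
    have hsymm : IsSymmSndFDerivAt ℝ τ (extChartAt I z z) :=
      hτ.isSymmSndFDerivAt (by rw [minSmoothness_of_isRCLikeNormedField])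
    rw [key u v w]
    exact (key v u w).trans (congrArg (fun t => ((extChartAt I x₀ z, fderiv ℝ τ (extChartAt I z z) v),
      (fderiv ℝ τ (extChartAt I z z) u, fderiv ℝ τ (extChartAt I z z) w + t))) (hsymm.eq u v))

end Kappa

/-! ### Evaluating a local expression at a given point -/

section Rep

variable {F : Type*} [NormedAddCommGroup F] [NormedSpace ℝ F]
  {H : Type*} [TopologicalSpace H] {I : ModelWithCorners ℝ F H} [I.Boundaryless]
  {N : Type*} [TopologicalSpace N] [ChartedSpace H N] [IsManifold I ∞ N]
  {F' : Type*} [NormedAddCommGroup F'] [NormedSpace ℝ F']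
  {H' : Type*} [TopologicalSpace H'] {I' : ModelWithCorners ℝ F' H'} [I'.Boundaryless]
  {N' : Type*} [TopologicalSpace N'] [ChartedSpace H' N'] [IsManifold I' ∞ N']
  {x₀ : N} {y₀ : N'} {h : N → N'} {g : F → F'} {W : Set N}

theorem IsRep.apply_eq (r : IsRep I I' x₀ y₀ h g W) {q : N} (hq : q ∈ W) {q' : N'}
    (hq' : q' ∈ (extChartAt I' y₀).source) (e : extChartAt I' y₀ q' = g (extChartAt I x₀ q)) :
    h q = q' :=
  (extChartAt I' y₀).injOn (r.mapsTo q hq) hq' ((r.eq q hq).trans e.symm)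

/-- The chart equalities let an expression centred at a zero vector over `x` be used at every other
point over `x`: the charts of the iterated tangent bundles at these points coincide, so the
coordinates at `q` are still the literal ones. -/
theorem IsRep.tangentMap_eq (r : IsRep I I' x₀ y₀ h g W) {q : N} (hq : q ∈ W) {q' : N'}
    (hh : h q = q') (hx : extChartAt I q = extChartAt I x₀)
    (hy : extChartAt I' q' = extChartAt I' y₀)
    (hg : DifferentiableAt ℝ g (extChartAt I x₀ q)) (v : F) :
    _root_.tangentMap I I' h ⟨q, v⟩ = ⟨q', fderiv ℝ g (extChartAt I x₀ q) v⟩ := by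
  subst hh
  have r' : IsRep I I' q (h q) h g W :=
    ⟨r.isOpen, by rw [hx]; exact r.source, by rw [hy]; exact r.mapsTo,
      by rw [hx, hy]; exact r.eq⟩
  rw [← hx] at hg ⊢
  exact r'.tangentMap_self hq hg v

end Rep

/-! ### Explicit components over a base point -/

section Literal

variable {E : Type*} [NormedAddCommGroup E] [NormedSpace ℝ E]
  {M : Type*} [TopologicalSpace M] [ChartedSpace E M] [IsManifold 𝓘(ℝ, E) ∞ M]

/-- The point of `TM` over `x` with given coordinates in the preferred chart at `x`. -/
def pt₁ (x : M) (u : E) : T1 E M := ⟨x, u⟩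

/-- The point of `T²M` over `x` with given coordinates in the preferred chart at `x`. -/
def pt₂ (x : M) (u v w : E) : T2 E M := ⟨pt₁ x u, (v, w)⟩

/-- The point of `T³M` over `x` with given coordinates in the preferred chart at `x`. -/
def pt₃ (x : M) (u v w p q r s : E) : T3 E M := ⟨pt₂ x u v w, ((p, q), (r, s))⟩

theorem pt₁_inj {x : M} {u u' : E} : pt₁ x u = pt₁ x u' ↔ u = u' := by
  constructor
  · intro h
    cases h
    rfl
  · rintro rfl; rfl

theorem pt₂_inj {x : M} {u v w u' v' w' : E} :
    pt₂ x u v w = pt₂ x u' v' w' ↔ u = u' ∧ v = v' ∧ w = w' := by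
  constructor
  · intro h
    cases h
    exact ⟨rfl, rfl, rfl⟩
  · rintro ⟨rfl, rfl, rfl⟩; rfl

theorem pt₃_inj {x : M} {u v w p q r s u' v' w' p' q' r' s' : E} :
    pt₃ x u v w p q r s = pt₃ x u' v' w' p' q' r' s' ↔
      (u = u' ∧ v = v' ∧ w = w') ∧ p = p' ∧ q = q' ∧ r = r' ∧ s = s' := by
  constructor
  · intro h
    cases h
    exact ⟨⟨rfl, rfl, rfl⟩, rfl, rfl, rfl, rfl⟩
  · rintro ⟨⟨rfl, rfl, rfl⟩, rfl, rfl, rfl, rfl⟩; rfl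

theorem extChartAt_pt₁ (x : M) (u : E) :
    extChartAt 𝓘(ℝ, E).tangent (pt₁ x 0) (pt₁ x u) = (extChartAt 𝓘(ℝ, E) x x, u) :=
  extChartAt_tangent_apply_self x (0 : E) u

theorem extChartAt_pt₂ (x : M) (u v w : E) :
    extChartAt 𝓘(ℝ, E).tangent.tangent (pt₂ x 0 0 0) (pt₂ x u v w) =
      ((extChartAt 𝓘(ℝ, E) x x, u), (v, w)) :=
  (extChartAt_tangent_apply_self (I := 𝓘(ℝ, E).tangent) (pt₁ x u) (0 : E × E) (v, w)).trans
    (congrArg (fun a : E × E => (a, (v, w))) (extChartAt_pt₁ x u))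

variable {α : E → E} {A B : E → E →L[ℝ] E} {G : E → E →L[ℝ] E →L[ℝ] E} {W : Set M} {x y : M}

theorem IsRep.apply_pt₁ {h : T1 E M → T1 E M}
    (r : IsRep 𝓘(ℝ, E).tangent 𝓘(ℝ, E).tangent (pt₁ x 0) (pt₁ y 0) h (model₁ α A) {v | v.1 ∈ W})
    (hx : x ∈ W) (hy : α (extChartAt 𝓘(ℝ, E) x x) = extChartAt 𝓘(ℝ, E) y y) (u : E) :
    h (pt₁ x u) = pt₁ y (A (extChartAt 𝓘(ℝ, E) x x) u) := by
  refine r.apply_eq hx (mem_extChartAt_tangent_source.2 (mem_extChartAt_source (I := 𝓘(ℝ, E)) y)) ?_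
  rw [extChartAt_pt₁, extChartAt_pt₁, model₁, hy]

theorem IsRep.tangentMap_pt₂ {h : T1 E M → T1 E M}
    (r : IsRep 𝓘(ℝ, E).tangent 𝓘(ℝ, E).tangent (pt₁ x 0) (pt₁ y 0) h (model₁ α A) {v | v.1 ∈ W})
    (hx : x ∈ W) (hy : α (extChartAt 𝓘(ℝ, E) x x) = extChartAt 𝓘(ℝ, E) y y)
    (hα : DifferentiableAt ℝ α (extChartAt 𝓘(ℝ, E) x x))
    (hA : DifferentiableAt ℝ A (extChartAt 𝓘(ℝ, E) x x)) (u v w : E) :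
    _root_.tangentMap 𝓘(ℝ, E).tangent 𝓘(ℝ, E).tangent h (pt₂ x u v w) =
      pt₂ y (A (extChartAt 𝓘(ℝ, E) x x) u) (fderiv ℝ α (extChartAt 𝓘(ℝ, E) x x) v)
        (A (extChartAt 𝓘(ℝ, E) x x) w + fderiv ℝ A (extChartAt 𝓘(ℝ, E) x x) v u) := by
  have e := r.tangentMap_eq (q := pt₁ x u) hx (r.apply_pt₁ hx hy u) rfl rfl
    (by rw [extChartAt_pt₁]; exact differentiableAt_model₁ hα hA) (v, w)
  rw [extChartAt_pt₁, fderiv_model₁ hα hA] at e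
  exact e

theorem IsRep.apply_pt₂ {h : T2 E M → T2 E M}
    (r : IsRep 𝓘(ℝ, E).tangent.tangent 𝓘(ℝ, E).tangent.tangent (pt₂ x 0 0 0) (pt₂ y 0 0 0) h
      (model₂ α A B G) {v | v.1.1 ∈ W})
    (hx : x ∈ W) (hy : α (extChartAt 𝓘(ℝ, E) x x) = extChartAt 𝓘(ℝ, E) y y) (u v w : E) :
    h (pt₂ x u v w) = pt₂ y (A (extChartAt 𝓘(ℝ, E) x x) u) (B (extChartAt 𝓘(ℝ, E) x x) v)
      (A (extChartAt 𝓘(ℝ, E) x x) w + G (extChartAt 𝓘(ℝ, E) x x) v u) := by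
  refine r.apply_eq hx (mem_extChartAt_tangent_source.2 (mem_extChartAt_tangent_source.2
    (mem_extChartAt_source (I := 𝓘(ℝ, E)) y))) ?_
  rw [extChartAt_pt₂, extChartAt_pt₂, model₂, hy]

theorem IsRep.tangentMap_pt₃ {h : T2 E M → T2 E M}
    (r : IsRep 𝓘(ℝ, E).tangent.tangent 𝓘(ℝ, E).tangent.tangent (pt₂ x 0 0 0) (pt₂ y 0 0 0) h
      (model₂ α A B G) {v | v.1.1 ∈ W})
    (hx : x ∈ W) (hy : α (extChartAt 𝓘(ℝ, E) x x) = extChartAt 𝓘(ℝ, E) y y)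
    (hα : DifferentiableAt ℝ α (extChartAt 𝓘(ℝ, E) x x))
    (hA : DifferentiableAt ℝ A (extChartAt 𝓘(ℝ, E) x x))
    (hB : DifferentiableAt ℝ B (extChartAt 𝓘(ℝ, E) x x))
    (hG : DifferentiableAt ℝ G (extChartAt 𝓘(ℝ, E) x x)) (u v w p q s t : E) :
    _root_.tangentMap 𝓘(ℝ, E).tangent.tangent 𝓘(ℝ, E).tangent.tangent h (pt₃ x u v w p q s t) =
      pt₃ y (A (extChartAt 𝓘(ℝ, E) x x) u) (B (extChartAt 𝓘(ℝ, E) x x) v)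
        (A (extChartAt 𝓘(ℝ, E) x x) w + G (extChartAt 𝓘(ℝ, E) x x) v u)
        (fderiv ℝ α (extChartAt 𝓘(ℝ, E) x x) p)
        (A (extChartAt 𝓘(ℝ, E) x x) q + fderiv ℝ A (extChartAt 𝓘(ℝ, E) x x) p u)
        (B (extChartAt 𝓘(ℝ, E) x x) s + fderiv ℝ B (extChartAt 𝓘(ℝ, E) x x) p v)
        ((A (extChartAt 𝓘(ℝ, E) x x) t + fderiv ℝ A (extChartAt 𝓘(ℝ, E) x x) p w) +
          (G (extChartAt 𝓘(ℝ, E) x x) v q + (G (extChartAt 𝓘(ℝ, E) x x) s u +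
            fderiv ℝ G (extChartAt 𝓘(ℝ, E) x x) p v u))) := by
  have e := r.tangentMap_eq (q := pt₂ x u v w) hx (r.apply_pt₂ hx hy u v w) rfl rfl
    (by rw [extChartAt_pt₂]; exact differentiableAt_model₂ hα hA hB hG) ((p, q), (s, t))
  rw [extChartAt_pt₂] at e
  obtain ⟨L, hL, hL'⟩ := hasFDerivAt_model₂ (e := ((extChartAt 𝓘(ℝ, E) x x, u), (v, w))) hα hA hB hG
  rw [hL.fderiv, hL'] at e
  exact e

/-- In coordinates the involution is linear, so its differential performs the same exchange on the
base components and on the tangent components. -/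
theorem kappaStar_pt₃ (u v w p q s t : E) :
    kappaStar E (pt₃ x u v w p q s t) = pt₃ x v u w p s q t := by
  have r := isRep_kappa (I := 𝓘(ℝ, E)) x
  have e := r.tangentMap_eq (q := pt₂ x u v w) (q' := pt₂ x v u w)
    (mem_extChartAt_source (I := 𝓘(ℝ, E)) x) rfl rfl rfl (by fun_prop) ((p, q), (s, t))
  refine e.trans ?_
  have hL : HasFDerivAt (𝕜 := ℝ) (fun e : (E × E) × (E × E) => ((e.1.1, e.2.1), (e.1.2, e.2.2))) _
    (extChartAt 𝓘(ℝ, E).tangent.tangent (pt₂ x 0 0 0) (pt₂ x u v w)) :=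
    ((hasFDerivAt_fst.fst.prodMk hasFDerivAt_snd.fst).prodMk
      (hasFDerivAt_fst.snd.prodMk hasFDerivAt_snd.snd))
  have e2 := congrArg (fun L => L ((p, q), (s, t))) hL.fderiv
  exact congrArg (Bundle.TotalSpace.mk (pt₂ x v u w)) e2

end Literal

/-! ### Local diffeomorphisms from invertible derivatives -/

section Bisections

variable {E : Type*} [NormedAddCommGroup E] [NormedSpace ℝ E]
  {M : Type*} [TopologicalSpace M] [ChartedSpace E M] [IsManifold 𝓘(ℝ, E) ∞ M]

/-- This is the inverse function theorem for the local expression, transported by the two charts. -/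
theorem isLocalDiffeomorphAt_of_isRep [CompleteSpace E] {x₀ y₀ z : M} {f : M → M} {α : E → E}
    {W : Set M} (r : IsRep 𝓘(ℝ, E) 𝓘(ℝ, E) x₀ y₀ f α W) (hz : z ∈ W)
    (hα : ∀ q ∈ W, ContDiffAt ℝ ∞ α (extChartAt 𝓘(ℝ, E) x₀ q))
    (L : E ≃L[ℝ] E) (hL : fderiv ℝ α (extChartAt 𝓘(ℝ, E) x₀ z) = L) :
    IsLocalDiffeomorphAt 𝓘(ℝ, E) 𝓘(ℝ, E) ∞ f z := by
  set φ := extChartAt 𝓘(ℝ, E) x₀ with hφ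
  set ψ := extChartAt 𝓘(ℝ, E) y₀ with hψ
  have hαz := hα z hz
  have hd : HasFDerivAt α (L : E →L[ℝ] E) (φ z) := by
    rw [← hL]; exact (hαz.differentiableAt (by simp)).hasFDerivAt
  let A := hαz.toOpenPartialHomeomorph α hd (by simp)
  have hAz : φ z ∈ A.source := hαz.mem_toOpenPartialHomeomorph_source hd (by simp)
  have hA : ∀ e, A e = α e := fun e => rfl
  have hinv : ∀ᶠ e in 𝓝 (φ z), fderiv ℝ α e ∈ Set.range ((↑) : (E ≃L[ℝ] E) → E →L[ℝ] E) :=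
    ((hαz.fderiv_right (m := 0) (by simp)).continuousAt).eventually
      (by rw [hL]; exact ContinuousLinearEquiv.nhds L)
  -- The local inverse is smooth at the image of a point where the derivative is invertible. Since
  -- smoothness is required on the whole target, the domain is shrunk to an open set on which the
  -- derivative stays invertible.
  obtain ⟨O, hO, hOo, hzO⟩ := mem_nhds_iff.1
    ((r.eventually_mem hz).and (hinv.and (A.open_source.mem_nhds hAz)))
  let c : OpenPartialHomeomorph M E := chartAt E x₀
  let d : OpenPartialHomeomorph M E := chartAt E y₀
  have hc : ∀ q, c q = φ q := fun q => by simp [c, hφ]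
  have hdd : ∀ q, d q = ψ q := fun q => by simp [d, hψ]
  let Θ := c ≫ₕ (A.restrOpen O hOo) ≫ₕ d.symm
  have hΘ : ∀ q ∈ Θ.source, q ∈ φ.source ∧ φ q ∈ O ∧ q ∈ W := by
    intro q hq
    simp only [Θ, OpenPartialHomeomorph.trans_source, OpenPartialHomeomorph.restrOpen_source,
      Set.mem_inter_iff, Set.mem_preimage] at hq
    have h1 : q ∈ φ.source := by rw [hφ, extChartAt_source]; exact hq.1
    have h2 : φ q ∈ O := by rw [← hc]; exact hq.2.1.2
    refine ⟨h1, h2, ?_⟩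
    have := (hO h2).1.2
    rwa [φ.left_inv h1] at this
  have hfΘ : Set.EqOn f Θ Θ.source := by
    intro q hq
    obtain ⟨h1, h2, h3⟩ := hΘ q hq
    have h4 : Θ q = d.symm (α (φ q)) := by simp [Θ, hc, hA]
    rw [h4, ← r.eq q h3, ← hψ, ← hdd]
    exact (d.left_inv (by simpa [d] using r.mapsTo q h3)).symm
  refine ⟨⟨Θ.toPartialEquiv, Θ.open_source, Θ.open_target, ?_, ?_⟩, ?_, hfΘ⟩
  · intro q hq
    have := (r.contMDiffAt (n := ⊤) (hΘ q hq).2.2 (hα q (hΘ q hq).2.2)).contMDiffWithinAt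
      (s := Θ.source)
    exact this.congr (fun q' hq' => (hfΘ hq').symm) (hfΘ hq).symm
  · intro p hp
    set q := Θ.symm p with hq_def
    have hqs : q ∈ Θ.source := Θ.map_target hp
    obtain ⟨h1, h2, h3⟩ := hΘ q hqs
    have hpq : f q = p := (hfΘ hqs).trans (Θ.right_inv hp)
    have hps : p ∈ ψ.source := hpq ▸ r.mapsTo q h3
    have hψp : ψ p = A (φ q) := by rw [hA, ← r.eq q h3, hpq]
    have hAq : φ q ∈ A.source := (hO h2).2.2
    have hsymm : A.symm (ψ p) = φ q := by rw [hψp]; exact A.left_inv hAq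
    have hform : ∀ p', Θ.symm p' = φ.symm (A.symm (ψ p')) := by
      intro p'
      simp [Θ, c, hφ, ← hdd]
    obtain ⟨L', hL'⟩ := (hO h2).2.1
    have g1 : ContMDiffAt 𝓘(ℝ, E) 𝓘(ℝ, E) ∞ ψ p := contMDiffAt_extChartAt' (by simpa [hψ] using hps)
    have g2 : ContDiffAt ℝ ∞ A.symm (ψ p) := by
      refine A.contDiffAt_symm (f₀' := L') (hψp ▸ A.map_source hAq) ?_ ?_
      · rw [hsymm, hL']
        exact ((hα q h3).differentiableAt (by simp)).hasFDerivAt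
      · rw [hsymm]; exact hα q h3
    have g3 : ContMDiffAt 𝓘(ℝ, E) 𝓘(ℝ, E) ∞ φ.symm (A.symm (ψ p)) := by
      rw [hsymm]
      exact (contMDiffOn_extChartAt_symm x₀).contMDiffAt
        ((isOpen_extChartAt_target x₀).mem_nhds (φ.map_source h1))
    have := (g3.comp p (g2.contMDiffAt.comp p g1)).contMDiffWithinAt (s := Θ.target)
    exact this.congr (fun p' _ => hform p') (hform p)
  · have h1 : z ∈ c.source := by simpa [c] using r.source z hz
    simp only [Θ, OpenPartialHomeomorph.trans_source, OpenPartialHomeomorph.restrOpen_source,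
      Set.mem_inter_iff, Set.mem_preimage]
    refine ⟨h1, ⟨?_, ?_⟩, ?_⟩
    · rw [hc]; exact hAz
    · rw [hc]; exact hzO
    · have : A (φ z) ∈ d.target := by
        rw [hA, ← r.eq z hz, ← hψ, ← hdd]
        exact d.map_source (by simpa [d] using r.mapsTo z hz)
      simpa [hc] using this

end Bisections

/-! ### Fields of 1-jets in charts -/

section JetCoordinates

variable {E : Type*} [NormedAddCommGroup E] [NormedSpace ℝ E]
  {M : Type*} [TopologicalSpace M] [ChartedSpace E M] [IsManifold 𝓘(ℝ, E) ∞ M]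

/-- The linear part of a 1-jet in the preferred charts at `x₀` and `y₀`. -/
def Jet1.coord (x₀ y₀ : M) {z : M} (j : Jet1 E z) : E →L[ℝ] E :=
  (tcoord 𝓘(ℝ, E) y₀ j.tgt).comp ((j.lin : TangentSpace 𝓘(ℝ, E) z →L[ℝ] _).comp
    (tcoordSymm 𝓘(ℝ, E) x₀ z))

theorem Jet1.tcoord_lin {x₀ : M} (y₀ : M) {z : M} (j : Jet1 E z)
    (hz : z ∈ (extChartAt 𝓘(ℝ, E) x₀).source) (v : TangentSpace 𝓘(ℝ, E) z) :
    tcoord 𝓘(ℝ, E) y₀ j.tgt (j.lin v) = j.coord x₀ y₀ (tcoord 𝓘(ℝ, E) x₀ z v) := by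
  simp [Jet1.coord, tcoordSymm_tcoord hz]

theorem Jet1.coord_self {x : M} (j : Jet1 E x) (v : E) : (j.coord x j.tgt v : E) = j.lin (v : TangentSpace 𝓘(ℝ, E) x) := by
  have h := j.tcoord_lin j.tgt (mem_extChartAt_source x) v
  have h1 : tcoord 𝓘(ℝ, E) x x v = v := tcoord_self x v
  have h2 : ∀ w : E, tcoord 𝓘(ℝ, E) j.tgt j.tgt w = w := tcoord_self j.tgt
  rw [h1] at h
  exact h.symm.trans (h2 _)

/-- The isomorphism of a tangent space with the model space given by a chart. -/
def tcoordEquiv {x₀ z : M} (hz : z ∈ (extChartAt 𝓘(ℝ, E) x₀).source) :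
    TangentSpace 𝓘(ℝ, E) z ≃L[ℝ] E :=
  ContinuousLinearEquiv.equivOfInverse (tcoord 𝓘(ℝ, E) x₀ z) (tcoordSymm 𝓘(ℝ, E) x₀ z)
    (tcoordSymm_tcoord hz) (tcoord_tcoordSymm hz)

/-- The linear part of a 1-jet in the preferred charts at `x₀` and `y₀` as an isomorphism. -/
def Jet1.coordEquiv {x₀ y₀ z : M} (j : Jet1 E z) (hz : z ∈ (extChartAt 𝓘(ℝ, E) x₀).source)
    (hy : j.tgt ∈ (extChartAt 𝓘(ℝ, E) y₀).source) : E ≃L[ℝ] E :=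
  ((tcoordEquiv hz).symm.trans j.lin).trans (tcoordEquiv hy)

theorem Jet1.coe_coordEquiv {x₀ y₀ z : M} (j : Jet1 E z)
    (hz : z ∈ (extChartAt 𝓘(ℝ, E) x₀).source) (hy : j.tgt ∈ (extChartAt 𝓘(ℝ, E) y₀).source) :
    (j.coordEquiv hz hy : E →L[ℝ] E) = j.coord x₀ y₀ := rfl

/-- On the open set `W`, the field of 1-jets `b` is given by `α` and `A` in the preferred charts
at `x₀` and `y₀`. -/
structure IsJetRep (x₀ y₀ : M) (b : (x : M) → Jet1 E x) (α : E → E) (A : E → E →L[ℝ] E)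
    (W : Set M) : Prop where
  tgt : IsRep 𝓘(ℝ, E) 𝓘(ℝ, E) x₀ y₀ (fun x => (b x).tgt) α W
  coord : ∀ q ∈ W, (b q).coord x₀ y₀ = A (extChartAt 𝓘(ℝ, E) x₀ q)
  smooth_tgt : ∀ q ∈ W, ContDiffAt ℝ ∞ α (extChartAt 𝓘(ℝ, E) x₀ q)
  smooth_lin : ∀ q ∈ W, ContDiffAt ℝ ∞ A (extChartAt 𝓘(ℝ, E) x₀ q)

namespace IsJetRep

variable {x₀ y₀ : M} {b : (x : M) → Jet1 E x} {α : E → E} {A : E → E →L[ℝ] E} {W : Set M}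

theorem tcoord_lin (r : IsJetRep x₀ y₀ b α A W) {q : M} (hq : q ∈ W)
    (v : TangentSpace 𝓘(ℝ, E) q) :
    tcoord 𝓘(ℝ, E) y₀ (b q).tgt ((b q).lin v) =
      A (extChartAt 𝓘(ℝ, E) x₀ q) (tcoord 𝓘(ℝ, E) x₀ q v) := by
  rw [← r.coord q hq, (b q).tcoord_lin y₀ (r.tgt.source q hq)]

theorem hat (r : IsJetRep x₀ y₀ b α A W) :
    IsRep 𝓘(ℝ, E).tangent 𝓘(ℝ, E).tangent (pt₁ x₀ 0) (pt₁ y₀ 0) (hat₁ b) (model₁ α A)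
      {v : T1 E M | v.1 ∈ W} where
  isOpen := r.tgt.isOpen.preimage (FiberBundle.continuous_proj E (TangentSpace 𝓘(ℝ, E)))
  source v hv := mem_extChartAt_tangent_source.2 (r.tgt.source _ hv)
  mapsTo v hv := mem_extChartAt_tangent_source.2 (r.tgt.mapsTo _ hv)
  eq v hv := by
    rw [extChartAt_tangent_apply (p := pt₁ x₀ 0) (r.tgt.source _ hv)]
    refine (extChartAt_tangent_apply (p := pt₁ y₀ 0) (q := hat₁ b v)
      (r.tgt.mapsTo _ hv)).trans (Prod.ext ?_ ?_)
    · exact r.tgt.eq _ hv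
    · exact r.tcoord_lin hv v.2

theorem differentiableAt_tgt (r : IsJetRep x₀ y₀ b α A W) {q : M} (hq : q ∈ W) :
    DifferentiableAt ℝ α (extChartAt 𝓘(ℝ, E) x₀ q) :=
  (r.smooth_tgt q hq).differentiableAt (by simp)

theorem differentiableAt_lin (r : IsJetRep x₀ y₀ b α A W) {q : M} (hq : q ∈ W) :
    DifferentiableAt ℝ A (extChartAt 𝓘(ℝ, E) x₀ q) :=
  (r.smooth_lin q hq).differentiableAt (by simp)

theorem isBisection₁ [CompleteSpace E] (r : IsJetRep x₀ y₀ b α A W) {z : M} (hz : z ∈ W)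
    (L : E ≃L[ℝ] E) (hL : fderiv ℝ α (extChartAt 𝓘(ℝ, E) x₀ z) = L) : IsBisection₁ b z where
  tgt := isLocalDiffeomorphAt_of_isRep r.tgt hz r.smooth_tgt L hL
  smooth := by
    refine ⟨W, r.tgt.isOpen, hz, fun v hv => ContMDiffAt.contMDiffWithinAt ?_⟩
    refine r.hat.contMDiffAt (n := ⊤) hv (contDiffAt_model₁ ?_ ?_)
    · rw [extChartAt_tangent_apply (p := pt₁ x₀ 0) (r.tgt.source _ hv)]
      exact r.smooth_tgt _ hv
    · rw [extChartAt_tangent_apply (p := pt₁ x₀ 0) (r.tgt.source _ hv)]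
      exact r.smooth_lin _ hv

end IsJetRep

/-- In finite dimension an operator-valued map is smooth once its values on each fixed vector `u`
are. These values are read off from the smooth action of `b` on the constant field `u`. -/
theorem IsBisection₁.exists_isJetRep [FiniteDimensional ℝ E] {b : (x : M) → Jet1 E x} {z : M}
    (hb : IsBisection₁ b z) {x₀ y₀ : M} (hz : z ∈ (extChartAt 𝓘(ℝ, E) x₀).source)
    (hy : (b z).tgt ∈ (extChartAt 𝓘(ℝ, E) y₀).source) :
    ∃ α A W, z ∈ W ∧ IsJetRep x₀ y₀ b α A W := by
  obtain ⟨U, hU, hzU, hsm⟩ := hb.smooth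
  obtain ⟨Φ, hzΦ, hΦ⟩ := hb.tgt
  have hcont : ContMDiffOn 𝓘(ℝ, E) 𝓘(ℝ, E) ∞ (fun x => (b x).tgt) Φ.source :=
    Φ.contMDiffOn_toFun.congr hΦ
  set φ := extChartAt 𝓘(ℝ, E) x₀ with hφ
  set ψ := extChartAt 𝓘(ℝ, E) y₀ with hψ
  set W : Set M := (U ∩ φ.source) ∩ (Φ.source ∩ (fun x => (b x).tgt) ⁻¹' ψ.source) with hWdef
  have hW : IsOpen W := (hU.inter (isOpen_extChartAt_source x₀)).inter
    (hcont.continuousOn.isOpen_inter_preimage Φ.open_source (isOpen_extChartAt_source y₀))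
  have hzW : z ∈ W := ⟨⟨hzU, hz⟩, hzΦ, hy⟩
  have r : IsRep 𝓘(ℝ, E) 𝓘(ℝ, E) x₀ y₀ (fun x => (b x).tgt)
      (fun e => ψ (b (φ.symm e)).tgt) W :=
    ⟨hW, fun q hq => hq.1.2, fun q hq => hq.2.2, fun q hq => by rw [φ.left_inv hq.1.2]⟩
  have hα : ∀ q ∈ W, ContDiffAt ℝ ∞ (fun e => ψ (b (φ.symm e)).tgt) (φ q) := fun q hq =>
    r.contDiffAt (n := ⊤) hq (hcont.contMDiffAt (Φ.open_source.mem_nhds hq.2.1))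
  have hO : ∀ q ∈ W, ∀ᶠ e in 𝓝 (φ q), e ∈ φ.target ∧ φ.symm e ∈ W := fun q hq =>
    r.eventually_mem hq
  refine ⟨fun e => ψ (b (φ.symm e)).tgt, fun e => (b (φ.symm e)).coord x₀ y₀, W, hzW, r,
    fun q hq => by rw [φ.left_inv hq.1.2], hα, fun q hq => ?_⟩
  set O : Set E := φ.target ∩ φ.symm ⁻¹' W with hOdef
  have hOq : O ∈ 𝓝 (φ q) := hO q hq
  refine (contDiffOn_clm_apply.2 fun u => ?_ : ContDiffOn ℝ ∞ _ O).contDiffAt hOq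
  intro e he
  refine ContDiffAt.contDiffWithinAt ?_
  obtain ⟨he1, he2⟩ := he
  have hq' : φ.symm e ∈ W := he2
  have h1 := (contMDiffAt_constField (E := E) (x₀ := x₀) hq'.1.2 u)
  have h2 : ContMDiffAt 𝓘(ℝ, E).tangent 𝓘(ℝ, E).tangent ∞ (hat₁ b)
      (⟨φ.symm e, constField x₀ u (φ.symm e)⟩ : T1 E M) :=
    hsm.contMDiffAt ((hU.preimage (FiberBundle.continuous_proj E
      (TangentSpace 𝓘(ℝ, E) : M → Type _))).mem_nhds hq'.1.1)
  have h3 : ContMDiffAt 𝓘(ℝ, E) 𝓘(ℝ, E) ∞ φ.symm e :=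
    (contMDiffOn_extChartAt_symm x₀).contMDiffAt ((isOpen_extChartAt_target x₀).mem_nhds he1)
  have h4 : ContMDiffAt 𝓘(ℝ, E).tangent 𝓘(ℝ, E × E) ∞ (extChartAt 𝓘(ℝ, E).tangent (pt₁ y₀ (0 : E)))
      (hat₁ b (⟨φ.symm e, constField x₀ u (φ.symm e)⟩ : T1 E M)) := by
    refine contMDiffAt_extChartAt' ?_
    have := (mem_extChartAt_tangent_source (I := 𝓘(ℝ, E)) (p := pt₁ y₀ (0 : E))
      (q := hat₁ b (⟨φ.symm e, constField x₀ u (φ.symm e)⟩ : T1 E M))).2 hq'.2.2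
    simpa using this
  have h5 := (ContMDiffAt.comp (g := fun v => extChartAt 𝓘(ℝ, E).tangent (pt₁ y₀ (0 : E)) (hat₁ b v))
    (f := fun q => (⟨q, constField x₀ u q⟩ : T1 E M)) _ (h4.comp _ h2) h1).comp e h3
  have h6 := (contDiff_snd.contDiffAt.contMDiffAt.comp e h5).contDiffAt
  refine h6.congr_of_eventuallyEq ?_
  have hmem : ∀ᶠ e' in 𝓝 e, e' ∈ φ.target ∧ φ.symm e' ∈ W := by
    have := hO _ hq'
    rwa [φ.right_inv he1] at this
  filter_upwards [hmem] with e' he'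
  exact (congrArg Prod.snd (extChartAt_tangent_apply (I := 𝓘(ℝ, E)) (p := pt₁ y₀ (0 : E))
    (q := hat₁ b (⟨φ.symm e', constField x₀ u (φ.symm e')⟩ : T1 E M)) he'.2.2.2)).symm

end JetCoordinates

/-! ### The affine condition in coordinates -/

section Affine

variable {E : Type*} [NormedAddCommGroup E] [NormedSpace ℝ E] [FiniteDimensional ℝ E]
  {M : Type*} [TopologicalSpace M] [ChartedSpace E M] [IsManifold 𝓘(ℝ, E) ∞ M]

/-- Every 1-jet extends to a field of 1-jets with prescribed coordinates. -/
theorem exists_isJetRep {x : M} (ξ : Jet1 E x) {α : E → E} {A : E → E →L[ℝ] E}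
    (hα : ContDiff ℝ ∞ α) (hA : ContDiff ℝ ∞ A)
    (hαx : α (extChartAt 𝓘(ℝ, E) x x) = extChartAt 𝓘(ℝ, E) ξ.tgt ξ.tgt)
    (hAx : A (extChartAt 𝓘(ℝ, E) x x) = ξ.coord x ξ.tgt) :
    ∃ b W, x ∈ W ∧ b x = ξ ∧ IsJetRep x ξ.tgt b α A W := by
  classical
  set φ := extChartAt 𝓘(ℝ, E) x with hφ
  set ψ := extChartAt 𝓘(ℝ, E) ξ.tgt with hψ
  have hx : x ∈ φ.source := mem_extChartAt_source x
  have hy : ξ.tgt ∈ ψ.source := mem_extChartAt_source ξ.tgt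
  let P : M → Prop := fun z => z ∈ φ.source ∧ α (φ z) ∈ ψ.target ∧
    ∃ L : E ≃L[ℝ] E, (L : E →L[ℝ] E) = A (φ z)
  -- At `x` the value is `ξ` itself, so that `b x = ξ` holds without comparing jets with different
  -- expressions for their target. Nearby the coordinates prescribe the jet; where they define none,
  -- the identity serves as a default.
  let b : (z : M) → Jet1 E z := fun z =>
    if h : z = x then h ▸ ξ else
    if h : P z then ⟨ψ.symm (α (φ z)),
      ((tcoordEquiv h.1).trans h.2.2.choose).trans (tcoordEquiv (ψ.map_target h.2.1)).symm⟩
    else ⟨z, ContinuousLinearEquiv.refl ℝ _⟩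
  have hbx : b x = ξ := dif_pos rfl
  have hPx : P x := ⟨hx, by rw [hαx]; exact ψ.map_source hy, ξ.coordEquiv hx hy,
    hAx.symm⟩
  have hbP : ∀ z, P z → (b z).tgt = ψ.symm (α (φ z)) ∧ (b z).coord x ξ.tgt = A (φ z) := by
    intro z hz
    by_cases h : z = x
    · subst h
      rw [hbx, hαx, hAx, ψ.left_inv hy]
      exact ⟨rfl, rfl⟩
    · have hb : b z = ⟨ψ.symm (α (φ z)),
          ((tcoordEquiv hz.1).trans hz.2.2.choose).trans
            (tcoordEquiv (ψ.map_target hz.2.1)).symm⟩ :=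
        (dif_neg h).trans (dif_pos hz)
      rw [hb]
      refine ⟨rfl, ?_⟩
      ext v
      exact ((tcoord_tcoordSymm (ψ.map_target hz.2.1) _).trans
        (congrArg hz.2.2.choose (tcoord_tcoordSymm hz.1 v))).trans
        (DFunLike.congr_fun hz.2.2.choose_spec v)
  have hφc : ContinuousAt φ x := continuousAt_extChartAt x
  -- The invertible operators form an open set, so `A` near the invertible `ξ.coord` keeps defining
  -- 1-jets.
  have hPev : ∀ᶠ z in 𝓝 x, P z := by
    have e1 : ∀ᶠ z in 𝓝 x, z ∈ φ.source := eventually_mem_source hx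
    have e2 : ∀ᶠ z in 𝓝 x, α (φ z) ∈ ψ.target :=
      (hα.continuous.continuousAt.comp hφc).preimage_mem_nhds
        ((isOpen_extChartAt_target ξ.tgt).mem_nhds hPx.2.1)
    have e3 : ∀ᶠ z in 𝓝 x, A (φ z) ∈ Set.range ((↑) : (E ≃L[ℝ] E) → E →L[ℝ] E) :=
      (hA.continuous.continuousAt.comp hφc).preimage_mem_nhds (by
        rw [Function.comp, hAx]
        exact ContinuousLinearEquiv.nhds (ξ.coordEquiv hx hy))
    filter_upwards [e1, e2, e3] with z h1 h2 h3 using ⟨h1, h2, h3⟩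
  obtain ⟨W, hW, hWo, hxW⟩ := mem_nhds_iff.1 hPev
  refine ⟨b, W, hxW, hbx, ⟨hWo, fun q hq => (hW hq).1, fun q hq => ?_, fun q hq => ?_⟩,
    fun q hq => (hbP q (hW hq)).2, fun _ _ => hα.contDiffAt, fun _ _ => hA.contDiffAt⟩
  · rw [(hbP q (hW hq)).1]
    exact ψ.map_target (hW hq).2.1
  · change ψ (b q).tgt = _
    rw [(hbP q (hW hq)).1]
    exact ψ.right_inv (hW hq).2.1

variable (cov : CovariantDerivative 𝓘(ℝ, E) E (TangentSpace 𝓘(ℝ, E) : M → Type _))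

/-- The second order part of the affine extension of a 1-jet with linear part `A`, in the preferred
charts at `x₀` and `y₀`. -/
def affineSnd (x₀ y₀ : M) (e e' : E) (A : E →L[ℝ] E) : E →L[ℝ] E →L[ℝ] E :=
  ((ContinuousLinearMap.compL ℝ E E E) A).comp (christoffel cov x₀ e) -
    (((ContinuousLinearMap.compL ℝ E E E).flip A).comp (christoffel cov y₀ e')).comp A

theorem affineSnd_apply (x₀ y₀ : M) (e e' : E) (A : E →L[ℝ] E) (v u : E) :
    affineSnd cov x₀ y₀ e e' A v u =
      A (christoffel cov x₀ e v u) - christoffel cov y₀ e' (A v) (A u) := rfl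

theorem contDiffAt_affineSnd [T2Space M] [cov.ContMDiffCovariantDerivative ∞] {x₀ y₀ : M}
    {α : E → E} {A : E → E →L[ℝ] E} {e : E} (he : e ∈ (extChartAt 𝓘(ℝ, E) x₀).target)
    (he' : α e ∈ (extChartAt 𝓘(ℝ, E) y₀).target) (hα : ContDiffAt ℝ ∞ α e)
    (hA : ContDiffAt ℝ ∞ A e) :
    ContDiffAt ℝ ∞ (fun e => affineSnd cov x₀ y₀ e (α e) (A e)) e := by
  have h1 : ContDiffAt ℝ ∞ (christoffel cov x₀) e :=
    (contDiffOn_christoffel cov x₀).contDiffAt ((isOpen_extChartAt_target x₀).mem_nhds he)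
  have h2 : ContDiffAt ℝ ∞ (christoffel cov y₀) (α e) :=
    (contDiffOn_christoffel cov y₀).contDiffAt ((isOpen_extChartAt_target y₀).mem_nhds he')
  have h3 := h2.comp e hα
  have h4 : ContDiffAt ℝ ∞ (fun e => ContinuousLinearMap.compL ℝ E E E (A e)) e :=
    (ContinuousLinearMap.compL ℝ E E E).contDiff.contDiffAt.comp e hA
  have h5 : ContDiffAt ℝ ∞ (fun e => (ContinuousLinearMap.compL ℝ E E E).flip (A e)) e :=
    (ContinuousLinearMap.compL ℝ E E E).flip.contDiff.contDiffAt.comp e hA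
  exact (h4.clm_comp h1).sub ((h5.clm_comp h3).clm_comp hA)

/-- The coordinates of a smooth vector field. -/
theorem contDiffAt_coord_field {x₀ z : M} (hz : z ∈ (extChartAt 𝓘(ℝ, E) x₀).source)
    {Y : (z : M) → TangentSpace 𝓘(ℝ, E) z}
    (hY : ContMDiffAt 𝓘(ℝ, E) 𝓘(ℝ, E).tangent ∞ (fun z => (⟨z, Y z⟩ : T1 E M)) z) :
    ∃ g : E → E, ContDiffAt ℝ ∞ g (extChartAt 𝓘(ℝ, E) x₀ z) ∧
      ∀ᶠ z' in 𝓝 z, tcoord 𝓘(ℝ, E) x₀ z' (Y z') = g (extChartAt 𝓘(ℝ, E) x₀ z') := by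
  refine ⟨fun e => tcoord 𝓘(ℝ, E) x₀ _ (Y ((extChartAt 𝓘(ℝ, E) x₀).symm e)), ?_, ?_⟩
  · have h1 := (contMDiffAt_field hz).1 hY
    have h2 : ContMDiffAt 𝓘(ℝ, E) 𝓘(ℝ, E) ∞ (extChartAt 𝓘(ℝ, E) x₀).symm
        (extChartAt 𝓘(ℝ, E) x₀ z) :=
      (contMDiffOn_extChartAt_symm x₀).contMDiffAt ((isOpen_extChartAt_target x₀).mem_nhds
        ((extChartAt 𝓘(ℝ, E) x₀).map_source hz))
    refine (ContMDiffAt.comp (I' := 𝓘(ℝ, E))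
      (g := fun z' => tcoord 𝓘(ℝ, E) x₀ z' (Y z')) _ ?_ h2).contDiffAt
    rwa [(extChartAt 𝓘(ℝ, E) x₀).left_inv hz]
  · filter_upwards [eventually_mem_source hz] with z' hz'
    rw [(extChartAt 𝓘(ℝ, E) x₀).left_inv hz']

section

variable {x₀ y₀ : M} {b : (x : M) → Jet1 E x} {α : E → E} {A : E → E →L[ℝ] E} {W : Set M}

theorem IsJetRep.mfderiv_tgt_iff (r : IsJetRep x₀ y₀ b α A W) {z : M} (hz : z ∈ W) :
    (∀ v : TangentSpace 𝓘(ℝ, E) z,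
      mfderiv 𝓘(ℝ, E) 𝓘(ℝ, E) (fun x' => (b x').tgt) z v = (b z).lin v) ↔
      fderiv ℝ α (extChartAt 𝓘(ℝ, E) x₀ z) = A (extChartAt 𝓘(ℝ, E) x₀ z) := by
  have hs := r.tgt.source z hz
  constructor
  · intro h
    ext v
    have h1 := r.tgt.tcoord_mfderiv hz (r.differentiableAt_tgt hz) (tcoordSymm 𝓘(ℝ, E) x₀ z v)
    rw [h, r.tcoord_lin hz, tcoord_tcoordSymm hs] at h1
    exact h1.symm
  · intro h v
    apply tcoord_injective (r.tgt.mapsTo z hz)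
    have h1 := r.tgt.tcoord_mfderiv hz (r.differentiableAt_tgt hz) v
    rw [h, ← r.tcoord_lin hz] at h1
    exact h1

/-- The transported field satisfies `h ∘ α = A · g`. Differentiating this with `Dα = A` gives `Dh(A
X) = DA(X) g + A Dg(X)`; substituting it into the coordinate forms of the two covariant derivatives
cancels `A Dg(X)` and leaves an equation without derivatives of the fields. -/
theorem IsJetRep.cov_eq_iff (r : IsJetRep x₀ y₀ b α A W) {z : M} (hz : z ∈ W)
    (hd : fderiv ℝ α (extChartAt 𝓘(ℝ, E) x₀ z) = A (extChartAt 𝓘(ℝ, E) x₀ z))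
    {Y V : (z : M) → TangentSpace 𝓘(ℝ, E) z} {g h : E → E}
    (hY : ∀ᶠ z' in 𝓝 z, tcoord 𝓘(ℝ, E) x₀ z' (Y z') = g (extChartAt 𝓘(ℝ, E) x₀ z'))
    (hg : DifferentiableAt ℝ g (extChartAt 𝓘(ℝ, E) x₀ z))
    (hV : ∀ᶠ z' in 𝓝 (b z).tgt, tcoord 𝓘(ℝ, E) y₀ z' (V z') = h (extChartAt 𝓘(ℝ, E) y₀ z'))
    (hh : DifferentiableAt ℝ h (extChartAt 𝓘(ℝ, E) y₀ (b z).tgt))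
    (hgh : ∀ᶠ e in 𝓝 (extChartAt 𝓘(ℝ, E) x₀ z), h (α e) = A e (g e))
    (X : TangentSpace 𝓘(ℝ, E) z) :
    (b z).lin (cov Y z X) = cov V (b z).tgt ((b z).lin X) ↔
      fderiv ℝ A (extChartAt 𝓘(ℝ, E) x₀ z) (tcoord 𝓘(ℝ, E) x₀ z X)
          (g (extChartAt 𝓘(ℝ, E) x₀ z)) =
        affineSnd cov x₀ y₀ (extChartAt 𝓘(ℝ, E) x₀ z) (α (extChartAt 𝓘(ℝ, E) x₀ z))
          (A (extChartAt 𝓘(ℝ, E) x₀ z)) (tcoord 𝓘(ℝ, E) x₀ z X)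
          (g (extChartAt 𝓘(ℝ, E) x₀ z)) := by
  have hs := r.tgt.source z hz
  have ht := r.tgt.mapsTo z hz
  rw [← (tcoord_injective ht).eq_iff, r.tcoord_lin hz, tcoord_cov cov hs hY hg,
    tcoord_cov cov ht hV hh, r.tcoord_lin hz, affineSnd_apply]
  have e0 : extChartAt 𝓘(ℝ, E) y₀ (b z).tgt = α (extChartAt 𝓘(ℝ, E) x₀ z) := r.tgt.eq z hz
  rw [e0] at hh ⊢
  set e := extChartAt 𝓘(ℝ, E) x₀ z
  have hα := r.differentiableAt_tgt hz
  have hA := r.differentiableAt_lin hz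
  have h1 : fderiv ℝ (fun e => h (α e)) e = fderiv ℝ (fun e => A e (g e)) e :=
    Filter.EventuallyEq.fderiv_eq hgh
  rw [fderiv_fun_comp e hh hα, fderiv_clm_apply hA hg] at h1
  have h2 := DFunLike.congr_fun h1 (tcoord 𝓘(ℝ, E) x₀ z X)
  simp only [ContinuousLinearMap.comp_apply, add_apply, ContinuousLinearMap.flip_apply, hd] at h2
  rw [h2, hgh.self_of_nhds, map_add, add_assoc]
  constructor
  · intro h
    exact eq_sub_of_add_eq (add_left_cancel h).symm
  · intro h
    rw [h]; abel

/-- Testing the affine condition on constant fields determines the derivative of `A`; this is the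
source of the uniqueness of `S(ξ)`. -/
theorem IsJetRep.fderiv_eq [CompleteSpace E] (r : IsJetRep x₀ y₀ b α A W) {z : M} (hz : z ∈ W)
    (h1 : ∀ v : TangentSpace 𝓘(ℝ, E) z,
      mfderiv 𝓘(ℝ, E) 𝓘(ℝ, E) (fun x' => (b x').tgt) z v = (b z).lin v)
    (h2 : ∀ (Y V : (z : M) → TangentSpace 𝓘(ℝ, E) z),
      ContMDiffAt 𝓘(ℝ, E) 𝓘(ℝ, E).tangent ∞ (fun z => (⟨z, Y z⟩ : T1 E M)) z →
      ContMDiffAt 𝓘(ℝ, E) 𝓘(ℝ, E).tangent ∞ (fun z => (⟨z, V z⟩ : T1 E M)) (b z).tgt →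
      (∀ᶠ x' in 𝓝 z, V (b x').tgt = (b x').lin (Y x')) →
      ∀ X : TangentSpace 𝓘(ℝ, E) z, (b z).lin (cov Y z X) = cov V (b z).tgt ((b z).lin X)) :
    fderiv ℝ A (extChartAt 𝓘(ℝ, E) x₀ z) =
      affineSnd cov x₀ y₀ (extChartAt 𝓘(ℝ, E) x₀ z) (α (extChartAt 𝓘(ℝ, E) x₀ z))
          (A (extChartAt 𝓘(ℝ, E) x₀ z)) := by
  have hs := r.tgt.source z hz
  have ht := r.tgt.mapsTo z hz
  have hd := (r.mfderiv_tgt_iff hz).1 h1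
  have e0 : extChartAt 𝓘(ℝ, E) y₀ (b z).tgt = α (extChartAt 𝓘(ℝ, E) x₀ z) := r.tgt.eq z hz
  have hα := r.smooth_tgt z hz
  have hL : HasFDerivAt α (((b z).coordEquiv hs ht : E ≃L[ℝ] E) : E →L[ℝ] E)
      (extChartAt 𝓘(ℝ, E) x₀ z) := by
    rw [Jet1.coe_coordEquiv, r.coord z hz, ← hd]
    exact (r.differentiableAt_tgt hz).hasFDerivAt
  set e := extChartAt 𝓘(ℝ, E) x₀ z with he
  let β := hα.localInverse hL (by simp)
  have hβ : ContDiffAt ℝ ∞ β (α e) := hα.to_localInverse hL (by simp)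
  have hβα : ∀ᶠ e' in 𝓝 e, β (α e') = e' :=
    (hα.hasStrictFDerivAt' hL (by simp)).eventually_left_inverse
  ext v u
  -- The image of the constant field `u` under `b`. It is a field near the target because the target
  -- map has a local inverse, with expression `β`.
  let V : (z : M) → TangentSpace 𝓘(ℝ, E) z := fun y' =>
    tcoordSymm 𝓘(ℝ, E) y₀ y' (A (β (extChartAt 𝓘(ℝ, E) y₀ y')) u)
  have hV : ∀ᶠ z' in 𝓝 (b z).tgt, tcoord 𝓘(ℝ, E) y₀ z' (V z') =
      A (β (extChartAt 𝓘(ℝ, E) y₀ z')) u := by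
    filter_upwards [eventually_mem_source ht] with z' hz' using tcoord_tcoordSymm hz' _
  have hh : ContDiffAt ℝ ∞ (fun e' => A (β e') u) (α e) := by
    refine ContDiffAt.clm_apply (ContDiffAt.comp _ ?_ hβ) contDiffAt_const
    rw [hβα.self_of_nhds]
    exact r.smooth_lin z hz
  have hVs : ContMDiffAt 𝓘(ℝ, E) 𝓘(ℝ, E).tangent ∞ (fun z => (⟨z, V z⟩ : T1 E M)) (b z).tgt := by
    rw [contMDiffAt_field ht]
    refine ContMDiffAt.congr_of_eventuallyEq ?_ hV
    rw [← e0] at hh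
    exact hh.contMDiffAt.comp _ (contMDiffAt_extChartAt' (by simpa using ht))
  have hαc : ContinuousAt (fun z' => extChartAt 𝓘(ℝ, E) x₀ z') z := continuousAt_extChartAt' hs
  have key := h2 (constField x₀ u) V (contMDiffAt_constField hs u) hVs (by
    filter_upwards [r.tgt.isOpen.mem_nhds hz, hαc.eventually hβα] with x' hx' hβx'
    apply tcoord_injective (r.tgt.mapsTo x' hx')
    have e1 : extChartAt 𝓘(ℝ, E) y₀ (b x').tgt = α (extChartAt 𝓘(ℝ, E) x₀ x') := r.tgt.eq x' hx'
    refine (tcoord_tcoordSymm (r.tgt.mapsTo x' hx') _).trans ?_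
    rw [r.tcoord_lin hx', e1, hβx', constField, tcoord_tcoordSymm (r.tgt.source x' hx')])
    (tcoordSymm 𝓘(ℝ, E) x₀ z v)
  have := (r.cov_eq_iff cov hz hd (Y := constField x₀ u) (V := V) (g := fun _ => u)
    (h := fun e' => A (β e') u)
    (by filter_upwards [eventually_mem_source hs] with z' hz' using tcoord_tcoordSymm hz' u)
    (differentiableAt_const u) hV (by rw [e0]; exact hh.differentiableAt (by simp))
    (by filter_upwards [hβα] with e' he' using by rw [he']) _).1 key
  rwa [tcoord_tcoordSymm hs] at this

/-- The criterion of `cov_eq_iff` involves the field `Y` only through its value at the point, so the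
equation for `DA` settles all fields at once. -/
theorem IsJetRep.isAffine (r : IsJetRep x₀ y₀ b α A W) {z : M} (hz : z ∈ W)
    (hd : fderiv ℝ α (extChartAt 𝓘(ℝ, E) x₀ z) = A (extChartAt 𝓘(ℝ, E) x₀ z))
    (hA : fderiv ℝ A (extChartAt 𝓘(ℝ, E) x₀ z) =
      affineSnd cov x₀ y₀ (extChartAt 𝓘(ℝ, E) x₀ z) (α (extChartAt 𝓘(ℝ, E) x₀ z))
          (A (extChartAt 𝓘(ℝ, E) x₀ z))) (hb : IsBisection₁ b z) :
    IsAffine cov (jet₁ b z hb) := by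
  have hs := r.tgt.source z hz
  have ht := r.tgt.mapsTo z hz
  have e0 : extChartAt 𝓘(ℝ, E) y₀ (b z).tgt = α (extChartAt 𝓘(ℝ, E) x₀ z) := r.tgt.eq z hz
  refine ⟨b, hb, rfl, (r.mfderiv_tgt_iff hz).2 hd, fun Y V hY hV hYV X => ?_⟩
  obtain ⟨g, hg, hYg⟩ := contDiffAt_coord_field hs hY
  obtain ⟨h, hh, hVh⟩ := contDiffAt_coord_field ht hV
  refine (r.cov_eq_iff cov hz hd hYg (hg.differentiableAt (by simp)) hVh
    (hh.differentiableAt (by simp)) ?_ X).2 (by rw [hA])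
  have hc : ContinuousAt (extChartAt 𝓘(ℝ, E) x₀).symm (extChartAt 𝓘(ℝ, E) x₀ z) :=
    continuousAt_extChartAt_symm' hs
  have hcb : ContinuousAt (fun x' => (b x').tgt) z :=
    (r.tgt.contMDiffAt (n := ⊤) hz (r.smooth_tgt z hz)).continuousAt
  have hzz := (extChartAt 𝓘(ℝ, E) x₀).left_inv hs
  have hev : ∀ᶠ z' in 𝓝 z, h (α (extChartAt 𝓘(ℝ, E) x₀ z')) =
      A (extChartAt 𝓘(ℝ, E) x₀ z') (g (extChartAt 𝓘(ℝ, E) x₀ z')) := by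
    filter_upwards [r.tgt.isOpen.mem_nhds hz, hYg, hcb.eventually hVh, hYV] with x' h1 h2 h3 h4
    have e1 : extChartAt 𝓘(ℝ, E) y₀ (b x').tgt = α (extChartAt 𝓘(ℝ, E) x₀ x') := r.tgt.eq x' h1
    rw [h4, r.tcoord_lin h1, h2, e1] at h3
    exact h3.symm
  rw [← hzz] at hev
  filter_upwards [hc.eventually hev, r.tgt.eventually_mem hz] with e he he'
  rwa [(extChartAt 𝓘(ℝ, E) x₀).right_inv he'.1] at he

end

end Affine

/-! ### The jets `S(ξ)` and `𝕊(ξ)` in coordinates -/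

section AffineExtension

variable {E : Type*} [NormedAddCommGroup E] [NormedSpace ℝ E] [FiniteDimensional ℝ E]
  [CompleteSpace E]
  {M : Type*} [TopologicalSpace M] [ChartedSpace E M] [IsManifold 𝓘(ℝ, E) ∞ M]
  (cov : CovariantDerivative 𝓘(ℝ, E) E (TangentSpace 𝓘(ℝ, E) : M → Type _))

/-- The second order part of `S(ξ)` in the preferred charts at the source and the target. -/
def Jet1.snd {x : M} (ξ : Jet1 E x) : E →L[ℝ] E →L[ℝ] E :=
  affineSnd cov x ξ.tgt (extChartAt 𝓘(ℝ, E) x x) (extChartAt 𝓘(ℝ, E) ξ.tgt ξ.tgt)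
    (ξ.coord x ξ.tgt)

theorem exists_isAffine {x : M} (ξ : Jet1 E x) : ∃ j : Jet11 E x, j.fst = ξ ∧ IsAffine cov j := by
  set e₀ := extChartAt 𝓘(ℝ, E) x x with he₀
  set L := ξ.coord x ξ.tgt with hL
  -- Only the first order Taylor data of the field at `x` matter, so polynomials of degree one with
  -- the required value and derivative are enough.
  set α : E → E := fun e => extChartAt 𝓘(ℝ, E) ξ.tgt ξ.tgt + L (e - e₀) with hα
  set A : E → E →L[ℝ] E := fun e => L + ξ.snd cov (e - e₀) with hA
  have hsub : HasFDerivAt (fun e : E => e - e₀) (ContinuousLinearMap.id ℝ E) e₀ :=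
    (hasFDerivAt_id e₀).sub_const e₀
  have hα1 : HasFDerivAt α L e₀ := by
    have := (HasFDerivAt.comp e₀ L.hasFDerivAt hsub).const_add
      (extChartAt 𝓘(ℝ, E) ξ.tgt ξ.tgt)
    exact this
  have hA1 : HasFDerivAt A (ξ.snd cov) e₀ := by
    have := (HasFDerivAt.comp e₀ (ξ.snd cov).hasFDerivAt hsub).const_add L
    exact this
  have hα0 : α e₀ = extChartAt 𝓘(ℝ, E) ξ.tgt ξ.tgt := by simp [hα]
  have hA0 : A e₀ = L := by simp [hA]
  have hsm : ContDiff ℝ ∞ fun e : E => e - e₀ := contDiff_id.sub contDiff_const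
  obtain ⟨b, W, hxW, hbx, r⟩ := exists_isJetRep ξ (α := α) (A := A)
    (contDiff_const.add (L.contDiff.comp hsm))
    (contDiff_const.add ((ξ.snd cov).contDiff.comp hsm)) hα0 hA0
  have hb : IsBisection₁ b x := r.isBisection₁ hxW
    (ξ.coordEquiv (mem_extChartAt_source x) (mem_extChartAt_source ξ.tgt))
    (by rw [Jet1.coe_coordEquiv]; exact hα1.fderiv)
  refine ⟨jet₁ b x hb, hbx, r.isAffine cov hxW (hα1.fderiv.trans hA0.symm) ?_ hb⟩
  refine hA1.fderiv.trans ?_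
  rw [← he₀, hα0, hA0]
  rfl

theorem affineExt_spec {x : M} (ξ : Jet1 E x) :
    (affineExt cov ξ).fst = ξ ∧ IsAffine cov (affineExt cov ξ) :=
  Classical.epsilon_spec (exists_isAffine cov ξ)

/-- The field of the second order parts of the affine extensions of a field of 1-jets. -/
def affineField (x₀ y₀ : M) (α : E → E) (A : E → E →L[ℝ] E) (e : E) : E →L[ℝ] E →L[ℝ] E :=
  affineSnd cov x₀ y₀ e (α e) (A e)

/-- The charts are centred at arbitrary `x₀`, `y₀` so that the affine extensions at all points of a
neighbourhood can be described in one fixed pair of charts. -/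
theorem exists_affineExt_rep {z x₀ y₀ : M} (ξ : Jet1 E z)
    (hz : z ∈ (extChartAt 𝓘(ℝ, E) x₀).source) (hy : ξ.tgt ∈ (extChartAt 𝓘(ℝ, E) y₀).source) :
    ∃ (b : (x : M) → Jet1 E x) (hb : IsBisection₁ b z) (α : E → E) (A : E → E →L[ℝ] E) (W : Set M),
      jet₁ b z hb = affineExt cov ξ ∧ b z = ξ ∧ z ∈ W ∧ IsJetRep x₀ y₀ b α A W ∧
      α (extChartAt 𝓘(ℝ, E) x₀ z) = extChartAt 𝓘(ℝ, E) y₀ ξ.tgt ∧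
      A (extChartAt 𝓘(ℝ, E) x₀ z) = ξ.coord x₀ y₀ ∧
      fderiv ℝ α (extChartAt 𝓘(ℝ, E) x₀ z) = ξ.coord x₀ y₀ ∧
      fderiv ℝ A (extChartAt 𝓘(ℝ, E) x₀ z) = affineSnd cov x₀ y₀ (extChartAt 𝓘(ℝ, E) x₀ z)
        (extChartAt 𝓘(ℝ, E) y₀ ξ.tgt) (ξ.coord x₀ y₀) := by
  obtain ⟨h0, b, hb, hj, h1, h2⟩ := affineExt_spec cov ξ
  have hbz : b z = ξ := by rw [← h0, ← hj]; rfl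
  obtain ⟨α, A, W, hzW, r⟩ := hb.exists_isJetRep hz (by rwa [hbz])
  have e0 : extChartAt 𝓘(ℝ, E) y₀ (b z).tgt = α (extChartAt 𝓘(ℝ, E) x₀ z) := r.tgt.eq z hzW
  have e1 := r.coord z hzW
  have e2 := (r.mfderiv_tgt_iff hzW).1 h1
  have e3 := r.fderiv_eq cov hzW h1 h2
  rw [hbz] at e0 e1
  rw [← e0, ← e1] at e3
  exact ⟨b, hb, α, A, W, hj, hbz, hzW, r, e0.symm, e1.symm, e2.trans e1.symm, e3⟩

/-- The right-hand side involves only `ξ` and the connection, so the choice made in `affineExt` does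
not affect the action. -/
theorem affineExt_act {x : M} (ξ : Jet1 E x) (u v w : E) :
    (affineExt cov ξ).act ⟨pt₂ x u v w, rfl⟩ = pt₂ ξ.tgt (ξ.coord x ξ.tgt u) (ξ.coord x ξ.tgt v)
      (ξ.coord x ξ.tgt w + ξ.snd cov v u) := by
  obtain ⟨b, hb, α, A, W, hj, hbz, hzW, r, e0, e1, e2, e3⟩ := exists_affineExt_rep cov ξ
    (mem_extChartAt_source x) (mem_extChartAt_source ξ.tgt)
  rw [← hj]
  refine (r.hat.tangentMap_pt₂ hzW e0 (r.differentiableAt_tgt hzW)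
    (r.differentiableAt_lin hzW) u v w).trans ?_
  rw [e1, e2, e3]
  rfl

variable {x₀ y₀ : M} {a : (x : M) → Jet1 E x} {α : E → E} {A : E → E →L[ℝ] E} {W : Set M}

/-- Over each point of `W` the jet `S(a(x))` acts as the tangent map of its own representative,
which varies from point to point. The resulting coordinates depend only on the values of `α` and `A`
there, so they assemble into one map. The first order operator occurs twice because affine jets are
semi-holonomic. -/
theorem IsJetRep.hat₂_affineExt (r : IsJetRep x₀ y₀ a α A W) :
    IsRep 𝓘(ℝ, E).tangent.tangent 𝓘(ℝ, E).tangent.tangent (pt₂ x₀ 0 0 0) (pt₂ y₀ 0 0 0)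
      (hat₂ fun x => affineExt cov (a x)) (model₂ α A A (affineField cov x₀ y₀ α A))
      {X : T2 E M | X.1.1 ∈ W} := by
  have key : ∀ X : T2 E M, X.1.1 ∈ W →
      hat₂ (fun x => affineExt cov (a x)) X ∈
        (extChartAt 𝓘(ℝ, E).tangent.tangent (pt₂ y₀ (0 : E) 0 0)).source ∧
      extChartAt 𝓘(ℝ, E).tangent.tangent (pt₂ y₀ (0 : E) 0 0)
        (hat₂ (fun x => affineExt cov (a x)) X) = model₂ α A A (affineField cov x₀ y₀ α A)
          (extChartAt 𝓘(ℝ, E).tangent.tangent (pt₂ x₀ (0 : E) 0 0) X) := by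
    intro X hX
    obtain ⟨b, hb, β, B, V, hj, hbz, hzV, r', e0, e1, e2, e3⟩ := exists_affineExt_rep cov
      (a X.1.1) (r.tgt.source _ hX) (r.tgt.mapsTo _ hX)
    have hact : hat₂ (fun x => affineExt cov (a x)) X =
        tangentMap 𝓘(ℝ, E).tangent 𝓘(ℝ, E).tangent (hat₁ b) X :=
      congrArg (fun j : Jet11 E X.1.1 => j.act ⟨X, rfl⟩) hj.symm
    have f0 : extChartAt 𝓘(ℝ, E) y₀ (a X.1.1).tgt = α (extChartAt 𝓘(ℝ, E) x₀ X.1.1) :=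
      r.tgt.eq _ hX
    have f1 := r.coord _ hX
    have hc : ∀ v : T1 E M, v.1 ∈ V →
        (extChartAt 𝓘(ℝ, E).tangent (pt₁ x₀ (0 : E)) v).1 = extChartAt 𝓘(ℝ, E) x₀ v.1 := fun v hv =>
      congrArg Prod.fst (extChartAt_tangent_apply (p := pt₁ x₀ (0 : E)) (q := v)
        (r'.tgt.source _ hv))
    have R := r'.hat.tangentMap (fun v hv => differentiableAt_model₁
      (by rw [hc v hv]; exact r'.differentiableAt_tgt hv)
      (by rw [hc v hv]; exact r'.differentiableAt_lin hv)) (0 : E × E) (0 : E × E)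
    have hX' : X ∈ {q : T2 E M | q.1 ∈ {v : T1 E M | v.1 ∈ V}} := hzV
    rw [hact]
    refine ⟨R.mapsTo X hX', (R.eq X hX').trans ?_⟩
    have hch : (extChartAt 𝓘(ℝ, E).tangent.tangent (pt₂ x₀ (0 : E) 0 0) X).1 =
        extChartAt 𝓘(ℝ, E).tangent (pt₁ x₀ (0 : E)) X.1 :=
      congrArg Prod.fst (extChartAt_tangent_apply (I := 𝓘(ℝ, E).tangent)
        (p := pt₂ x₀ (0 : E) 0 0) (q := X) (mem_extChartAt_tangent_source.2 (r.tgt.source _ hX)))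
    have h11 := (congrArg Prod.fst hch).trans (hc X.1 hzV)
    change (fun t : (E × E) × (E × E) => (model₁ β B t.1, fderiv ℝ (model₁ β B) t.1 t.2))
      (extChartAt 𝓘(ℝ, E).tangent.tangent (pt₂ x₀ (0 : E) 0 0) X) = _
    generalize extChartAt 𝓘(ℝ, E).tangent.tangent (pt₂ x₀ (0 : E) 0 0) X = t at h11 ⊢
    obtain ⟨⟨e, u⟩, ⟨v, w⟩⟩ := t
    obtain rfl : e = extChartAt 𝓘(ℝ, E) x₀ X.1.1 := h11
    simp only [model₂, affineField]
    rw [fderiv_model₁ (r'.differentiableAt_tgt hzV) (r'.differentiableAt_lin hzV), model₁]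
    simp only
    rw [e0, e1, e2, e3, f0, f1]
  refine ⟨?_, fun X hX => ?_, fun X hX => (key X hX).1, fun X hX => (key X hX).2⟩
  · exact r.hat.isOpen.preimage (FiberBundle.continuous_proj (E × E)
      (TangentSpace 𝓘(ℝ, E).tangent : T1 E M → Type _))
  · exact mem_extChartAt_tangent_source.2 (mem_extChartAt_tangent_source.2 (r.tgt.source _ hX))

/-- Smoothness of the Christoffel symbols enters here; it is what makes `S ∘ a` a bisection of the
`(1,1)`-jets. -/
theorem IsJetRep.contDiffAt_affineField [T2Space M] [cov.ContMDiffCovariantDerivative ∞]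
    (r : IsJetRep x₀ y₀ a α A W) {z : M} (hz : z ∈ W) :
    ContDiffAt ℝ ∞ (affineField cov x₀ y₀ α A) (extChartAt 𝓘(ℝ, E) x₀ z) :=
  contDiffAt_affineSnd cov ((extChartAt 𝓘(ℝ, E) x₀).map_source (r.tgt.source z hz))
    (r.tgt.map_mem_target hz) (r.smooth_tgt z hz) (r.smooth_lin z hz)

theorem IsJetRep.isBisection₂_affineExt [T2Space M] [cov.ContMDiffCovariantDerivative ∞]
    (r : IsJetRep x₀ y₀ a α A W) {z : M} (hz : z ∈ W) (ha : IsBisection₁ a z) :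
    IsBisection₂ (fun x => affineExt cov (a x)) z where
  tgt := by
    have : (fun x' => (affineExt cov (a x')).fst.tgt) = fun x' => (a x').tgt := by
      funext x'
      rw [(affineExt_spec cov (a x')).1]
    rw [this]
    exact ha.tgt
  smooth := by
    refine ⟨W, r.tgt.isOpen, hz, fun X hX => ContMDiffAt.contMDiffWithinAt ?_⟩
    have h1 : (extChartAt 𝓘(ℝ, E).tangent.tangent (pt₂ x₀ (0 : E) 0 0) X).1.1 =
        extChartAt 𝓘(ℝ, E) x₀ X.1.1 := by
      have h := congrArg Prod.fst (extChartAt_tangent_apply (I := 𝓘(ℝ, E).tangent)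
        (p := pt₂ x₀ (0 : E) 0 0) (q := X) (mem_extChartAt_tangent_source.2 (r.tgt.source _ hX)))
      exact (congrArg Prod.fst h).trans (congrArg Prod.fst (extChartAt_tangent_apply
        (p := pt₁ x₀ (0 : E)) (q := X.1) (r.tgt.source _ hX)))
    refine (r.hat₂_affineExt cov).contMDiffAt (n := ⊤) hX (contDiffAt_model₂ ?_ ?_ ?_ ?_) <;> rw [h1]
    · exact r.smooth_tgt _ hX
    · exact r.smooth_lin _ hX
    · exact r.smooth_lin _ hX
    · exact r.contDiffAt_affineField cov hX

theorem exists_isAffineExt₃ [T2Space M] [cov.ContMDiffCovariantDerivative ∞] {x : M}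
    (ξ : Jet1 E x) : ∃ J, IsAffineExt₃ cov ξ J := by
  obtain ⟨b, hb, α, A, W, hj, hbz, hzW, r, -⟩ := exists_affineExt_rep cov ξ
    (mem_extChartAt_source x) (mem_extChartAt_source ξ.tgt)
  exact ⟨_, b, hb, r.isBisection₂_affineExt cov hzW hb, hj, rfl⟩

theorem affineExt₃_spec [T2Space M] [cov.ContMDiffCovariantDerivative ∞] {x : M}
    (ξ : Jet1 E x) : IsAffineExt₃ cov ξ (affineExt₃ cov ξ) :=
  Classical.epsilon_spec (exists_isAffineExt₃ cov ξ)

theorem fderiv_affineField [T2Space M] [cov.ContMDiffCovariantDerivative ∞] {e : E}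
    (he : e ∈ (extChartAt 𝓘(ℝ, E) x₀).target) (he' : α e ∈ (extChartAt 𝓘(ℝ, E) y₀).target)
    (hα : ContDiffAt ℝ ∞ α e) (hA : ContDiffAt ℝ ∞ A e) (p v u : E) :
    fderiv ℝ (affineField cov x₀ y₀ α A) e p v u =
      fderiv ℝ A e p (christoffel cov x₀ e v u) + A e (fderiv ℝ (christoffel cov x₀) e p v u) -
      (fderiv ℝ (christoffel cov y₀) (α e) (fderiv ℝ α e p) (A e v) (A e u) +
        christoffel cov y₀ (α e) (fderiv ℝ A e p v) (A e u) +
        christoffel cov y₀ (α e) (A e v) (fderiv ℝ A e p u)) := by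
  have hG : DifferentiableAt ℝ (affineField cov x₀ y₀ α A) e :=
    (contDiffAt_affineSnd cov he he' hα hA).differentiableAt (by simp)
  have h1 : fderiv ℝ (affineField cov x₀ y₀ α A) e p v u =
      fderiv ℝ (fun e => affineField cov x₀ y₀ α A e v u) e p := by
    rw [fderiv_clm_apply (hG.clm_apply (differentiableAt_const v)) (differentiableAt_const u),
      fderiv_clm_apply hG (differentiableAt_const v)]
    simp
  have hA' := (hA.differentiableAt (by simp)).hasFDerivAt
  have hα' := (hα.differentiableAt (by simp)).hasFDerivAt
  have hΓ := (differentiableAt_christoffel cov x₀ he).hasFDerivAt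
  have hΓ' := HasFDerivAt.comp (g := christoffel cov y₀) (f := α) e
    (differentiableAt_christoffel cov y₀ he').hasFDerivAt hα'
  have hv := hasFDerivAt_const (𝕜 := ℝ) v e
  have hu := hasFDerivAt_const (𝕜 := ℝ) u e
  have h2 := (hA'.clm_apply ((hΓ.clm_apply hv).clm_apply hu)).sub
    ((hΓ'.clm_apply (hA'.clm_apply hv)).clm_apply (hA'.clm_apply hu))
  rw [h1]
  refine (DFunLike.congr_fun h2.fderiv p).trans ?_
  simp
  abel

/-- `C` is the derivative of the second order field along `a`. By the product rule it involves `a`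
only through its 1-jet, which is `S(ξ)`; hence the action does not depend on `a`. -/
theorem affineExt₃_act [T2Space M] [cov.ContMDiffCovariantDerivative ∞] {x : M} (ξ : Jet1 E x) :
    ∃ C : E →L[ℝ] E →L[ℝ] E →L[ℝ] E,
      (∀ p v u, C p v u =
        ξ.snd cov p (christoffel cov x (extChartAt 𝓘(ℝ, E) x x) v u) +
          ξ.coord x ξ.tgt (fderiv ℝ (christoffel cov x) (extChartAt 𝓘(ℝ, E) x x) p v u) -
        (fderiv ℝ (christoffel cov ξ.tgt) (extChartAt 𝓘(ℝ, E) ξ.tgt ξ.tgt) (ξ.coord x ξ.tgt p)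
            (ξ.coord x ξ.tgt v) (ξ.coord x ξ.tgt u) +
          christoffel cov ξ.tgt (extChartAt 𝓘(ℝ, E) ξ.tgt ξ.tgt) (ξ.snd cov p v)
            (ξ.coord x ξ.tgt u) +
          christoffel cov ξ.tgt (extChartAt 𝓘(ℝ, E) ξ.tgt ξ.tgt) (ξ.coord x ξ.tgt v)
            (ξ.snd cov p u))) ∧
      ∀ u v w p q r s, (affineExt₃ cov ξ).act ⟨pt₃ x u v w p q r s, rfl⟩ =
        pt₃ ξ.tgt (ξ.coord x ξ.tgt u) (ξ.coord x ξ.tgt v) (ξ.coord x ξ.tgt w + ξ.snd cov v u)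
          (ξ.coord x ξ.tgt p) (ξ.coord x ξ.tgt q + ξ.snd cov p u)
          (ξ.coord x ξ.tgt r + ξ.snd cov p v)
          ((ξ.coord x ξ.tgt s + ξ.snd cov p w) +
            (ξ.snd cov v q + (ξ.snd cov r u + C p v u))) := by
  obtain ⟨a, ha, hSa, hj, hJ⟩ := affineExt₃_spec cov ξ
  have hax : a x = ξ := by
    rw [← (affineExt_spec cov ξ).1, ← hj]; rfl
  obtain ⟨α, A, W, hxW, r⟩ := ha.exists_isJetRep (mem_extChartAt_source x)
    (y₀ := ξ.tgt) (by rw [hax]; exact mem_extChartAt_source ξ.tgt)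
  set e₀ := extChartAt 𝓘(ℝ, E) x x with he₀
  have e0 : α e₀ = extChartAt 𝓘(ℝ, E) ξ.tgt ξ.tgt := by rw [← r.tgt.eq x hxW, hax]
  have e1 : A e₀ = ξ.coord x ξ.tgt := by rw [← r.coord x hxW, hax]
  have hd := r.differentiableAt_tgt hxW
  have hd' := r.differentiableAt_lin hxW
  -- The action of the jet of `a` is written once through `α`, `A` and once through `S(ξ)`;
  -- comparing components identifies the derivatives of `α` and `A`.
  have hcmp : ∀ u v w, pt₂ ξ.tgt (A e₀ u) (fderiv ℝ α e₀ v) (A e₀ w + fderiv ℝ A e₀ v u) =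
      pt₂ ξ.tgt (ξ.coord x ξ.tgt u) (ξ.coord x ξ.tgt v)
      (ξ.coord x ξ.tgt w + ξ.snd cov v u) := fun u v w =>
    (r.hat.tangentMap_pt₂ hxW e0 hd hd' u v w).symm.trans
      ((congrArg (fun j : Jet11 E x => j.act ⟨pt₂ x u v w, rfl⟩) hj).trans
        (affineExt_act cov ξ u v w))
  have e2 : fderiv ℝ α e₀ = ξ.coord x ξ.tgt := by
    ext v
    exact (pt₂_inj.1 (hcmp 0 v 0)).2.1
  have e3 : fderiv ℝ A e₀ = ξ.snd cov := by
    ext v u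
    have := (pt₂_inj.1 (hcmp u v 0)).2.2
    simpa using this
  have he : e₀ ∈ (extChartAt 𝓘(ℝ, E) x).target := mem_extChartAt_target x
  have he' : α e₀ ∈ (extChartAt 𝓘(ℝ, E) ξ.tgt).target := r.tgt.map_mem_target hxW
  have e4 : affineField cov x ξ.tgt α A e₀ = ξ.snd cov := by
    rw [affineField, e0, e1]
    rfl
  refine ⟨fderiv ℝ (affineField cov x ξ.tgt α A) e₀, fun p v u => ?_, fun u v w p q t s => ?_⟩
  · rw [fderiv_affineField cov he he' (r.smooth_tgt x hxW) (r.smooth_lin x hxW), e0, e1, e2, e3]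
  · rw [← hJ]
    refine ((r.hat₂_affineExt cov).tangentMap_pt₃ hxW e0 hd hd' hd'
      ((r.contDiffAt_affineField cov hxW).differentiableAt (by simp)) u v w p q t s).trans ?_
    rw [← he₀, e1, e2, e3, e4]

end AffineExtension

/-! ### Symmetry defects as defects of invariance of `T`, `∇T` and `R` -/

section Invariants

variable {E : Type*} [NormedAddCommGroup E] [NormedSpace ℝ E] [FiniteDimensional ℝ E]
  [CompleteSpace E]
  {M : Type*} [TopologicalSpace M] [ChartedSpace E M] [IsManifold 𝓘(ℝ, E) ∞ M]
  (cov : CovariantDerivative 𝓘(ℝ, E) E (TangentSpace 𝓘(ℝ, E) : M → Type _))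

theorem fderiv_torsionCoord [T2Space M] [cov.ContMDiffCovariantDerivative ∞] (x₀ : M) {e : E}
    (he : e ∈ (extChartAt 𝓘(ℝ, E) x₀).target) (p v u : E) :
    fderiv ℝ (torsionCoord cov x₀) e p v u =
      fderiv ℝ (christoffel cov x₀) e p v u - fderiv ℝ (christoffel cov x₀) e p u v := by
  have h := (differentiableAt_christoffel cov x₀ he).hasFDerivAt
  have h' := h.sub (HasFDerivAt.comp (g := fun Γ : E →L[ℝ] E →L[ℝ] E =>
    ContinuousLinearMap.flipₗᵢ ℝ E E E Γ) e
    (ContinuousLinearMap.flipₗᵢ ℝ E E E).toContinuousLinearEquiv.hasFDerivAt h)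
  exact congrArg (fun D : E →L[ℝ] E →L[ℝ] E →L[ℝ] E => D p v u) h'.fderiv

theorem Jet1.snd_apply {x : M} (ξ : Jet1 E x) (v u : E) :
    ξ.snd cov v u = ξ.coord x ξ.tgt (christoffel cov x (extChartAt 𝓘(ℝ, E) x x) v u) -
      christoffel cov ξ.tgt (extChartAt 𝓘(ℝ, E) ξ.tgt ξ.tgt) (ξ.coord x ξ.tgt v)
        (ξ.coord x ξ.tgt u) := rfl

/-- `G(v, u) - G(u, v) = L T(v, u) - T'(L v, L u)`, since torsion is the antisymmetric part of the
Christoffel symbols. -/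
theorem preservesTorsion_iff {x : M} (ξ : Jet1 E x) :
    PreservesTorsion cov ξ ↔ ∀ v u, ξ.snd cov v u = ξ.snd cov u v := by
  have h : ∀ v u : E, (ξ.lin (cov.torsion x v u) : E) =
      ξ.coord x ξ.tgt (torsionCoord cov x (extChartAt 𝓘(ℝ, E) x x) v u) := fun v u =>
    (ξ.coord_self _).symm.trans (congrArg (ξ.coord x ξ.tgt) (torsion_eq cov x v u))
  have h' : ∀ v u : E, (cov.torsion ξ.tgt (ξ.lin (v : TangentSpace 𝓘(ℝ, E) x))
      (ξ.lin (u : TangentSpace 𝓘(ℝ, E) x)) : E) =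
      torsionCoord cov ξ.tgt (extChartAt 𝓘(ℝ, E) ξ.tgt ξ.tgt) (ξ.coord x ξ.tgt v)
        (ξ.coord x ξ.tgt u) := fun v u =>
    (torsion_eq cov ξ.tgt _ _).trans (congrArg₂ (fun a b : E => torsionCoord cov ξ.tgt
      (extChartAt 𝓘(ℝ, E) ξ.tgt ξ.tgt) a b) (ξ.coord_self v).symm (ξ.coord_self u).symm)
  have key : ∀ v u : E, ξ.coord x ξ.tgt (torsionCoord cov x (extChartAt 𝓘(ℝ, E) x x) v u) =
      torsionCoord cov ξ.tgt (extChartAt 𝓘(ℝ, E) ξ.tgt ξ.tgt) (ξ.coord x ξ.tgt v)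
        (ξ.coord x ξ.tgt u) ↔ ξ.snd cov v u = ξ.snd cov u v := by
    intro v u
    rw [torsionCoord_apply, torsionCoord_apply, Jet1.snd_apply, Jet1.snd_apply, map_sub,
      sub_eq_sub_iff_sub_eq_sub]
  constructor
  · intro H v u
    exact (key v u).1 ((h v u).symm.trans ((H v u).trans (h' v u)))
  · intro H v u
    exact (h v u).trans (((key v u).2 (H v u)).trans (h' v u).symm)

/-- The third order part of the jet `𝕊(ξ)` in the preferred charts at the source and the
target. -/
def IsThird {x : M} (ξ : Jet1 E x) (C : E →L[ℝ] E →L[ℝ] E →L[ℝ] E) : Prop :=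
  ∀ p v u, C p v u =
    ξ.snd cov p (christoffel cov x (extChartAt 𝓘(ℝ, E) x x) v u) +
      ξ.coord x ξ.tgt (fderiv ℝ (christoffel cov x) (extChartAt 𝓘(ℝ, E) x x) p v u) -
    (fderiv ℝ (christoffel cov ξ.tgt) (extChartAt 𝓘(ℝ, E) ξ.tgt ξ.tgt) (ξ.coord x ξ.tgt p)
        (ξ.coord x ξ.tgt v) (ξ.coord x ξ.tgt u) +
      christoffel cov ξ.tgt (extChartAt 𝓘(ℝ, E) ξ.tgt ξ.tgt) (ξ.snd cov p v)
        (ξ.coord x ξ.tgt u) +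
      christoffel cov ξ.tgt (extChartAt 𝓘(ℝ, E) ξ.tgt ξ.tgt) (ξ.coord x ξ.tgt v)
        (ξ.snd cov p u))

/-- The derivatives of `Γ`, `Γ'` antisymmetrize to derivatives of the torsions. The remaining
products match after replacing `L Γ` by `G + Γ'(L, L)`; symmetry of `G` removes what is left. -/
theorem third_sub_swap_right [T2Space M] [cov.ContMDiffCovariantDerivative ∞] {x : M}
    (ξ : Jet1 E x) (hG : ∀ v u, ξ.snd cov v u = ξ.snd cov u v)
    {C : E →L[ℝ] E →L[ℝ] E →L[ℝ] E} (hC : IsThird cov ξ C) (p v u : E) :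
    C p v u - C p u v = (ξ.lin (covTorsion cov x p v u)
      - covTorsion cov ξ.tgt (ξ.lin (p : TangentSpace 𝓘(ℝ, E) x))
        (ξ.lin (v : TangentSpace 𝓘(ℝ, E) x)) (ξ.lin (u : TangentSpace 𝓘(ℝ, E) x)) : E) := by
  have h1 := (ξ.coord_self (covTorsion cov x p v u : E)).symm.trans
    (congrArg (ξ.coord x ξ.tgt) (covTorsion_eq cov x p v u))
  have h2 : (covTorsion cov ξ.tgt (ξ.lin (p : TangentSpace 𝓘(ℝ, E) x))
      (ξ.lin (v : TangentSpace 𝓘(ℝ, E) x)) (ξ.lin (u : TangentSpace 𝓘(ℝ, E) x)) : E) =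
      covTorsion cov ξ.tgt (ξ.coord x ξ.tgt p : E) (ξ.coord x ξ.tgt v : E)
        (ξ.coord x ξ.tgt u : E) := by
    rw [ξ.coord_self, ξ.coord_self, ξ.coord_self]
  refine Eq.trans ?_ (congrArg₂ (fun a b : E => a - b) h1
    (h2.trans (covTorsion_eq cov ξ.tgt _ _ _))).symm
  have hs := ξ.snd_apply cov
  rw [hC p v u, hC p u v, fderiv_torsionCoord cov x (mem_extChartAt_target x),
    fderiv_torsionCoord cov ξ.tgt (mem_extChartAt_target ξ.tgt)]
  generalize ξ.coord x ξ.tgt = L at hs ⊢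
  generalize ξ.snd cov = G at hG hs ⊢
  simp only [torsionCoord_apply]
  generalize christoffel cov x (extChartAt 𝓘(ℝ, E) x x) = Γ at hs ⊢
  generalize christoffel cov ξ.tgt (extChartAt 𝓘(ℝ, E) ξ.tgt ξ.tgt) = Γ' at hs ⊢
  -- As a rewriting rule this moves every Christoffel symbol under `L` to the target, after which
  -- the identity is additive.
  have hL : ∀ v u, L (Γ v u) = G v u + Γ' (L v) (L u) := fun v u => by rw [hs]; abel
  simp only [map_sub, map_add, hL, add_apply, hG u v, hG (Γ p v) u, hG (Γ p u) v]
  abel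

/-- Exchanging the direction of differentiation with the first slot of `Γ` produces the curvature
expressions. Symmetry of `G` is needed only to cancel `Γ'(G(p, v), L u)` against `Γ'(G(v, p), L u)`.
-/
theorem third_sub_swap_left [T2Space M] [cov.ContMDiffCovariantDerivative ∞] {x : M}
    (ξ : Jet1 E x) (hG : ∀ v u, ξ.snd cov v u = ξ.snd cov u v)
    {C : E →L[ℝ] E →L[ℝ] E →L[ℝ] E} (hC : IsThird cov ξ C) (p v u : E) :
    C p v u - C v p u = (ξ.lin (curvature cov x p v u)
      - curvature cov ξ.tgt (ξ.lin (p : TangentSpace 𝓘(ℝ, E) x))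
        (ξ.lin (v : TangentSpace 𝓘(ℝ, E) x)) (ξ.lin (u : TangentSpace 𝓘(ℝ, E) x)) : E) := by
  have h1 := (ξ.coord_self (curvature cov x p v u : E)).symm.trans
    (congrArg (ξ.coord x ξ.tgt) (curvature_eq cov x p v u))
  have h2 : (curvature cov ξ.tgt (ξ.lin (p : TangentSpace 𝓘(ℝ, E) x))
      (ξ.lin (v : TangentSpace 𝓘(ℝ, E) x)) (ξ.lin (u : TangentSpace 𝓘(ℝ, E) x)) : E) =
      curvature cov ξ.tgt (ξ.coord x ξ.tgt p : E) (ξ.coord x ξ.tgt v : E)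
        (ξ.coord x ξ.tgt u : E) := by
    rw [ξ.coord_self, ξ.coord_self, ξ.coord_self]
  refine Eq.trans ?_ (congrArg₂ (fun a b : E => a - b) h1
    (h2.trans (curvature_eq cov ξ.tgt _ _ _))).symm
  have hs := ξ.snd_apply cov
  rw [hC p v u, hC v p u]
  generalize ξ.coord x ξ.tgt = L at hs ⊢
  generalize ξ.snd cov = G at hG hs ⊢
  generalize christoffel cov x (extChartAt 𝓘(ℝ, E) x x) = Γ at hs ⊢
  generalize christoffel cov ξ.tgt (extChartAt 𝓘(ℝ, E) ξ.tgt ξ.tgt) = Γ' at hs ⊢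
  have hL : ∀ v u, L (Γ v u) = G v u + Γ' (L v) (L u) := fun v u => by rw [hs]; abel
  simp only [map_sub, map_add, hL, hG v p]
  abel

end Invariants

/-! ### Tangent maps of projections and of smooth maps -/

section Functoriality

variable {F : Type*} [NormedAddCommGroup F] [NormedSpace ℝ F]
  {H : Type*} [TopologicalSpace H] {I : ModelWithCorners ℝ F H} [I.Boundaryless]
  {N : Type*} [TopologicalSpace N] [ChartedSpace H N] [IsManifold I ∞ N]
  {F' : Type*} [NormedAddCommGroup F'] [NormedSpace ℝ F']
  {H' : Type*} [TopologicalSpace H'] {I' : ModelWithCorners ℝ F' H'} [I'.Boundaryless]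
  {N' : Type*} [TopologicalSpace N'] [ChartedSpace H' N'] [IsManifold I' ∞ N']

theorem isRep_proj (x : N) (u : F) : IsRep I.tangent I (⟨x, u⟩ : TangentBundle I N) x
    (fun v : TangentBundle I N => v.1) Prod.fst {v | v.1 ∈ (extChartAt I x).source} where
  isOpen := (isOpen_extChartAt_source x).preimage (FiberBundle.continuous_proj F (TangentSpace I))
  source _ hv := mem_extChartAt_tangent_source.2 hv
  mapsTo _ hv := hv
  eq _ hv := (congrArg Prod.fst (extChartAt_tangent_apply (I := I) (p := ⟨x, u⟩) hv)).symm

theorem tangentMap_proj (x : N) (u v w : F) :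
    tangentMap I.tangent I (fun v : TangentBundle I N => v.1)
      (⟨⟨x, u⟩, (v, w)⟩ : TangentBundle I.tangent (TangentBundle I N)) = ⟨x, v⟩ := by
  have e := (isRep_proj (I := I) x u).tangentMap_eq (q := (⟨x, u⟩ : TangentBundle I N)) (q' := x)
    (mem_extChartAt_source (I := I) x) rfl rfl rfl differentiableAt_fst (v, w)
  refine e.trans (congrArg (Bundle.TotalSpace.mk x) ?_)
  exact congrArg (fun L : F × F →L[ℝ] F => L (v, w)) fderiv_fst

theorem mdifferentiableAt_proj (v : TangentBundle I N) :
    MDifferentiableAt I.tangent I (fun v : TangentBundle I N => v.1) v :=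
  (isRep_proj (I := I) v.1 v.2).mdifferentiableAt (mem_extChartAt_source (I := I) v.1)
    differentiableAt_fst

theorem exists_isRep_of_contMDiffAt {h : N → N'} {q : N} {n : ℕ} (hh : ContMDiffAt I I' n h q)
    {x₀ : N} {y₀ : N'} (hq : q ∈ (extChartAt I x₀).source) (hy : h q ∈ (extChartAt I' y₀).source) :
    ∃ g W, q ∈ W ∧ IsRep I I' x₀ y₀ h g W ∧ ∀ q ∈ W, ContDiffAt ℝ n g (extChartAt I x₀ q) := by
  have := IsManifold.of_le (I := I) (M := N) (m := n) (n := ∞) (by exact_mod_cast le_top)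
  have := IsManifold.of_le (I := I') (M := N') (m := n) (n := ∞) (by exact_mod_cast le_top)
  obtain ⟨U, hU, hUo, hqU⟩ := mem_nhds_iff.1 ((contMDiffAt_iff_contMDiffAt_nhds (n := n)
    (by simp)).1 hh)
  have hc : ContinuousOn h U := fun z hz => (hU hz).continuousAt.continuousWithinAt
  have r : IsRep I I' x₀ y₀ h (fun e => extChartAt I' y₀ (h ((extChartAt I x₀).symm e)))
      ((extChartAt I x₀).source ∩ (U ∩ h ⁻¹' (extChartAt I' y₀).source)) :=
    ⟨(isOpen_extChartAt_source x₀).inter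
      (hc.isOpen_inter_preimage hUo (isOpen_extChartAt_source y₀)), fun q hq => hq.1,
      fun q hq => hq.2.2, fun q hq => by rw [(extChartAt I x₀).left_inv hq.1]⟩
  exact ⟨_, (extChartAt I x₀).source ∩ (U ∩ h ⁻¹' (extChartAt I' y₀).source), ⟨hq, hqU, hy⟩, r,
    fun q hq => r.contDiffAt (n := n) hq (hU hq.2.1)⟩

theorem mdifferentiableAt_tangentMap {h : N → N'} {q : N}
    (hh : ContMDiffAt I I' 2 h q) (v : F) :
    MDifferentiableAt I.tangent I'.tangent (tangentMap I I' h) (⟨q, v⟩ : TangentBundle I N) := by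
  obtain ⟨g, W, hqW, r, hg⟩ := exists_isRep_of_contMDiffAt (n := 2) hh
    (mem_extChartAt_source (I := I) q) (mem_extChartAt_source (I := I') (h q))
  have R := r.tangentMap (fun z hz => (hg z hz).differentiableAt (by simp)) (0 : F) (0 : F')
  refine R.mdifferentiableAt (q := (⟨q, v⟩ : TangentBundle I N)) hqW ?_
  have e1 := extChartAt_tangent_apply_self (I := I) q (0 : F) v
  rw [e1]
  have h1 : DifferentiableAt ℝ g (extChartAt I q q) := (hg q hqW).differentiableAt (by simp)
  have h2 : DifferentiableAt ℝ (fderiv ℝ g) (extChartAt I q q) :=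
    ((hg q hqW).fderiv_right (m := 1) (by norm_num)).differentiableAt (by simp)
  exact (DifferentiableAt.comp (g := g) (f := Prod.fst) (extChartAt I q q, v) h1
    differentiableAt_fst).prodMk ((DifferentiableAt.comp (g := fderiv ℝ g) (f := Prod.fst)
    (extChartAt I q q, v) h2 differentiableAt_fst).clm_apply differentiableAt_snd)

end Functoriality

/-! ### Projections of `Y_* Z` and `X_** Y_* Z` -/

section Fields

variable {E : Type*} [NormedAddCommGroup E] [NormedSpace ℝ E]
  {M : Type*} [TopologicalSpace M] [ChartedSpace E M] [IsManifold 𝓘(ℝ, E) ∞ M]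

theorem pStar_pt₂ (x : M) (u v w : E) : pStar E (pt₂ x u v w) = pt₁ x v :=
  tangentMap_proj x u v w

theorem pStar₃_pt₃ (x : M) (u v w p q r s : E) :
    pStar₃ E (pt₃ x u v w p q r s) = pt₂ x u p q :=
  tangentMap_proj (I := 𝓘(ℝ, E).tangent) (pt₁ x u) (v, w) (p, q) (r, s)

theorem pStar_tangentMap {X : (z : M) → TangentSpace 𝓘(ℝ, E) z} {x : M}
    (hX : ContMDiffAt 𝓘(ℝ, E) 𝓘(ℝ, E).tangent ∞ (fun z => (⟨z, X z⟩ : T1 E M)) x)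
    (v : TangentSpace 𝓘(ℝ, E) x) :
    pStar E (tangentMap 𝓘(ℝ, E) 𝓘(ℝ, E).tangent (fun z => (⟨z, X z⟩ : T1 E M)) ⟨x, v⟩) =
      ⟨x, v⟩ := by
  have h := tangentMap_comp_at (I := 𝓘(ℝ, E)) (I' := 𝓘(ℝ, E).tangent) (I'' := 𝓘(ℝ, E))
    (f := fun z => (⟨z, X z⟩ : T1 E M)) (g := fun v : T1 E M => v.1) (⟨x, v⟩ : T1 E M)
    (mdifferentiableAt_proj _) (hX.mdifferentiableAt (by simp))
  exact h.symm.trans (congrFun (tangentMap_id (I := 𝓘(ℝ, E)) (M := M)) _)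

/-- By functoriality the left side is the tangent map of `p ∘ p ∘ X_*` at `Y_* Z`. Since `p ∘ X_*`
is `X` after the base projection, this composite is the projection of `TM` itself, which reduces the
claim to `pStar_tangentMap`. -/
theorem pStar_pStar₃_tangentMap {X Y : (z : M) → TangentSpace 𝓘(ℝ, E) z} {x : M}
    (hX : ContMDiffAt 𝓘(ℝ, E) 𝓘(ℝ, E).tangent ∞ (fun z => (⟨z, X z⟩ : T1 E M)) x)
    (hY : ContMDiffAt 𝓘(ℝ, E) 𝓘(ℝ, E).tangent ∞ (fun z => (⟨z, Y z⟩ : T1 E M)) x)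
    (v : TangentSpace 𝓘(ℝ, E) x) :
    pStar E (pStar₃ E (tangentMap 𝓘(ℝ, E).tangent 𝓘(ℝ, E).tangent.tangent
      (tangentMap 𝓘(ℝ, E) 𝓘(ℝ, E).tangent (fun z => (⟨z, X z⟩ : T1 E M)))
      (tangentMap 𝓘(ℝ, E) 𝓘(ℝ, E).tangent (fun z => (⟨z, Y z⟩ : T1 E M)) ⟨x, v⟩))) = ⟨x, v⟩ := by
  have hT := mdifferentiableAt_tangentMap (I := 𝓘(ℝ, E)) (I' := 𝓘(ℝ, E).tangent)
    (contMDiffAt_infty.1 hX 2) (Y x)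
  set t := tangentMap 𝓘(ℝ, E) 𝓘(ℝ, E).tangent (fun z => (⟨z, Y z⟩ : T1 E M)) ⟨x, v⟩ with ht
  have h1 := tangentMap_comp_at (I := 𝓘(ℝ, E).tangent) (I' := 𝓘(ℝ, E).tangent.tangent)
    (I'' := 𝓘(ℝ, E).tangent)
    (f := tangentMap 𝓘(ℝ, E) 𝓘(ℝ, E).tangent (fun z => (⟨z, X z⟩ : T1 E M)))
    (g := fun v : T2 E M => v.1) t (mdifferentiableAt_proj (I := 𝓘(ℝ, E).tangent) _) hT
  have hT' : MDifferentiableAt 𝓘(ℝ, E).tangent 𝓘(ℝ, E).tangent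
      ((fun v : T2 E M => v.1) ∘
        tangentMap 𝓘(ℝ, E) 𝓘(ℝ, E).tangent (fun z => (⟨z, X z⟩ : T1 E M))) t.1 :=
    (mdifferentiableAt_proj (I := 𝓘(ℝ, E).tangent) _).comp _ hT
  have h2 := tangentMap_comp_at (I := 𝓘(ℝ, E).tangent) (I' := 𝓘(ℝ, E).tangent) (I'' := 𝓘(ℝ, E))
    (f := (fun v : T2 E M => v.1) ∘
        tangentMap 𝓘(ℝ, E) 𝓘(ℝ, E).tangent (fun z => (⟨z, X z⟩ : T1 E M)))
    (g := fun v : T1 E M => v.1) t (mdifferentiableAt_proj _) hT'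
  exact ((congrArg (pStar E) h1).symm.trans h2.symm).trans (pStar_tangentMap hY v)

end Fields

/-! ### Genuine jets: symmetric derivatives and polynomial models -/

section Holonomic

variable {E : Type*} [NormedAddCommGroup E] [NormedSpace ℝ E]
  {M : Type*} [TopologicalSpace M] [ChartedSpace E M] [IsManifold 𝓘(ℝ, E) ∞ M]

theorem exists_isRep_of_isLocalDiffeomorphAt {f : M → M} {x x₀ y₀ : M}
    (hf : IsLocalDiffeomorphAt 𝓘(ℝ, E) 𝓘(ℝ, E) ∞ f x) (hx : x ∈ (extChartAt 𝓘(ℝ, E) x₀).source)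
    (hy : f x ∈ (extChartAt 𝓘(ℝ, E) y₀).source) :
    ∃ α W, x ∈ W ∧ IsRep 𝓘(ℝ, E) 𝓘(ℝ, E) x₀ y₀ f α W ∧
      ∀ q ∈ W, ContDiffAt ℝ ∞ α (extChartAt 𝓘(ℝ, E) x₀ q) := by
  obtain ⟨Φ, hxΦ, hΦ⟩ := hf
  have hcont : ContMDiffOn 𝓘(ℝ, E) 𝓘(ℝ, E) ∞ f Φ.source := Φ.contMDiffOn_toFun.congr hΦ
  have r : IsRep 𝓘(ℝ, E) 𝓘(ℝ, E) x₀ y₀ f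
      (fun e => extChartAt 𝓘(ℝ, E) y₀ (f ((extChartAt 𝓘(ℝ, E) x₀).symm e)))
      ((extChartAt 𝓘(ℝ, E) x₀).source ∩ (Φ.source ∩ f ⁻¹' (extChartAt 𝓘(ℝ, E) y₀).source)) :=
    ⟨(isOpen_extChartAt_source x₀).inter
      (hcont.continuousOn.isOpen_inter_preimage Φ.open_source (isOpen_extChartAt_source y₀)),
      fun q hq => hq.1, fun q hq => hq.2.2, fun q hq => by
        rw [(extChartAt 𝓘(ℝ, E) x₀).left_inv hq.1]⟩
  exact ⟨_, (extChartAt 𝓘(ℝ, E) x₀).source ∩ (Φ.source ∩ f ⁻¹' (extChartAt 𝓘(ℝ, E) y₀).source),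
    ⟨hx, hxΦ, hy⟩, r, fun q hq =>
    r.contDiffAt (n := ⊤) hq (hcont.contMDiffAt (Φ.open_source.mem_nhds hq.2.1))⟩

variable {x y : M} {f : M → M} {α : E → E} {W : Set M}

theorem contDiffAt_fderiv_infty {G : Type*} [NormedAddCommGroup G] [NormedSpace ℝ G] {g : E → G}
    {e : E} (h : ContDiffAt ℝ ∞ g e) : ContDiffAt ℝ ∞ (fderiv ℝ g) e :=
  h.fderiv_right (m := ∞) (by simp)

theorem IsRep.tangentMap_model₁ (r : IsRep 𝓘(ℝ, E) 𝓘(ℝ, E) x y f α W)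
    (hα : ∀ q ∈ W, ContDiffAt ℝ ∞ α (extChartAt 𝓘(ℝ, E) x q)) :
    IsRep 𝓘(ℝ, E).tangent 𝓘(ℝ, E).tangent (pt₁ x 0) (pt₁ y 0)
      (_root_.tangentMap 𝓘(ℝ, E) 𝓘(ℝ, E) f) (model₁ α (fderiv ℝ α)) {v : T1 E M | v.1 ∈ W} :=
  r.tangentMap (fun q hq => (hα q hq).differentiableAt (by simp)) (0 : E) (0 : E)

theorem IsRep.tangentMap_model₂ (r : IsRep 𝓘(ℝ, E) 𝓘(ℝ, E) x y f α W)
    (hα : ∀ q ∈ W, ContDiffAt ℝ ∞ α (extChartAt 𝓘(ℝ, E) x q)) :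
    IsRep 𝓘(ℝ, E).tangent.tangent 𝓘(ℝ, E).tangent.tangent (pt₂ x 0 0 0) (pt₂ y 0 0 0)
      (_root_.tangentMap 𝓘(ℝ, E).tangent 𝓘(ℝ, E).tangent
        (_root_.tangentMap 𝓘(ℝ, E) 𝓘(ℝ, E) f))
      (model₂ α (fderiv ℝ α) (fderiv ℝ α) (fderiv ℝ (fderiv ℝ α))) {v : T2 E M | v.1.1 ∈ W} := by
  have r₁ := r.tangentMap_model₁ hα
  have h0 : ∀ q ∈ W, DifferentiableAt ℝ α (extChartAt 𝓘(ℝ, E) x q) := fun q hq =>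
    (hα q hq).differentiableAt (by simp)
  have h1 : ∀ q ∈ W, DifferentiableAt ℝ (fderiv ℝ α) (extChartAt 𝓘(ℝ, E) x q) := fun q hq =>
    (contDiffAt_fderiv_infty (hα q hq)).differentiableAt (by simp)
  have hc : ∀ v : T1 E M, v.1 ∈ W →
      (extChartAt 𝓘(ℝ, E).tangent (pt₁ x (0 : E)) v).1 = extChartAt 𝓘(ℝ, E) x v.1 := fun v hv =>
    congrArg Prod.fst (extChartAt_tangent_apply (p := pt₁ x (0 : E)) (q := v) (r.source _ hv))
  have R := r₁.tangentMap (fun v hv => differentiableAt_model₁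
    (by rw [hc v hv]; exact h0 _ hv) (by rw [hc v hv]; exact h1 _ hv)) (0 : E × E) (0 : E × E)
  refine ⟨R.isOpen, R.source, R.mapsTo, fun X hX => (R.eq X hX).trans ?_⟩
  have hch : (extChartAt 𝓘(ℝ, E).tangent.tangent (pt₂ x (0 : E) 0 0) X).1 =
      extChartAt 𝓘(ℝ, E).tangent (pt₁ x (0 : E)) X.1 :=
    congrArg Prod.fst (extChartAt_tangent_apply (I := 𝓘(ℝ, E).tangent)
      (p := pt₂ x (0 : E) 0 0) (q := X) (mem_extChartAt_tangent_source.2 (r.source _ hX)))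
  have h11 := (congrArg Prod.fst hch).trans (hc X.1 hX)
  change (fun t : (E × E) × (E × E) => (model₁ α (fderiv ℝ α) t.1,
    fderiv ℝ (model₁ α (fderiv ℝ α)) t.1 t.2))
    (extChartAt 𝓘(ℝ, E).tangent.tangent (pt₂ x (0 : E) 0 0) X) = _
  generalize extChartAt 𝓘(ℝ, E).tangent.tangent (pt₂ x (0 : E) 0 0) X = t at h11 ⊢
  obtain ⟨⟨e, u⟩, ⟨v, w⟩⟩ := t
  obtain rfl : e = extChartAt 𝓘(ℝ, E) x X.1.1 := h11
  simp only [model₂]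
  rw [fderiv_model₁ (h0 _ hX) (h1 _ hX), model₁]

theorem isSymmSnd_fderiv {e : E} (h : ContDiffAt ℝ ∞ α e) (v u : E) :
    fderiv ℝ (fderiv ℝ α) e v u = fderiv ℝ (fderiv ℝ α) e u v :=
  (h.isSymmSndFDerivAt (by
    rw [minSmoothness_of_isRCLikeNormedField]; exact WithTop.coe_le_coe.2 le_top)).eq v u

theorem third_fderiv_swap_left {e : E} (h : ContDiffAt ℝ ∞ α e) (p v u : E) :
    fderiv ℝ (fderiv ℝ (fderiv ℝ α)) e p v u = fderiv ℝ (fderiv ℝ (fderiv ℝ α)) e v p u :=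
  DFunLike.congr_fun (((contDiffAt_fderiv_infty h).isSymmSndFDerivAt (by
    rw [minSmoothness_of_isRCLikeNormedField]; exact WithTop.coe_le_coe.2 le_top)).eq p v) u

/-- Symmetry of the second derivative is an identity on a neighbourhood, so it may be
differentiated. Exchanging the first two arguments is instead the symmetry theorem applied to
`fderiv ℝ α`. -/
theorem third_fderiv_swap_right {e : E} (h : ∀ᶠ e' in 𝓝 e, ContDiffAt ℝ ∞ α e') (p v u : E) :
    fderiv ℝ (fderiv ℝ (fderiv ℝ α)) e p v u = fderiv ℝ (fderiv ℝ (fderiv ℝ α)) e p u v := by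
  have hd : DifferentiableAt ℝ (fderiv ℝ (fderiv ℝ α)) e :=
    (contDiffAt_fderiv_infty (contDiffAt_fderiv_infty h.self_of_nhds)).differentiableAt (by simp)
  have h1 : ∀ v u, fderiv ℝ (fderiv ℝ (fderiv ℝ α)) e p v u =
      fderiv ℝ (fun e' => fderiv ℝ (fderiv ℝ α) e' v u) e p := by
    intro v u
    rw [fderiv_clm_apply (hd.clm_apply (differentiableAt_const v)) (differentiableAt_const u),
      fderiv_clm_apply hd (differentiableAt_const v)]
    simp
  rw [h1, h1]
  congr 1
  refine Filter.EventuallyEq.fderiv_eq ?_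
  filter_upwards [h] with e' he' using isSymmSnd_fderiv he' v u

/-- The polynomial with given derivatives at `e₀`. -/
def cubic (e₀ c : E) (L : E →L[ℝ] E) (G : E →L[ℝ] E →L[ℝ] E) (C : E →L[ℝ] E →L[ℝ] E →L[ℝ] E)
    (e : E) : E :=
  c + L (e - e₀) + (1 / 2 : ℝ) • G (e - e₀) (e - e₀) +
    (1 / 6 : ℝ) • C (e - e₀) (e - e₀) (e - e₀)

/-! ### The cubic with prescribed symmetric derivatives -/

section Cubic

variable {e₀ c : E} {L : E →L[ℝ] E} {G : E →L[ℝ] E →L[ℝ] E} {C : E →L[ℝ] E →L[ℝ] E →L[ℝ] E}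

theorem contDiff_cubic : ContDiff ℝ ∞ (cubic e₀ c L G C) := by
  unfold cubic
  fun_prop

/-- Symmetry makes the two product rule terms of `G` equal, and the three terms of `C` equal, which
turns the factors `1 / 2` and `1 / 6` into `1` and `1 / 2`. -/
theorem fderiv_cubic (hG : ∀ v u, G v u = G u v) (h₁ : ∀ p v u, C p v u = C v p u)
    (h₂ : ∀ p v u, C p v u = C p u v) :
    fderiv ℝ (cubic e₀ c L G C) =
      fun e => L + G (e - e₀) + (1 / 2 : ℝ) • C (e - e₀) (e - e₀) := by
  funext e
  have hs : HasFDerivAt (fun e : E => e - e₀) (ContinuousLinearMap.id ℝ E) e :=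
    (hasFDerivAt_id e).sub_const e₀
  have hL := HasFDerivAt.comp e L.hasFDerivAt hs
  have hG' := HasFDerivAt.comp (g := fun h => G h) e G.hasFDerivAt hs
  have hC' := HasFDerivAt.comp (g := fun h => C h) e C.hasFDerivAt hs
  have H := ((hL.const_add c).add ((hG'.clm_apply hs).const_smul (1 / 2 : ℝ))).add
    (((hC'.clm_apply hs).clm_apply hs).const_smul (1 / 6 : ℝ))
  refine H.fderiv.trans ?_
  ext v
  simp [-map_sub]
  rw [hG v, h₁ v, h₂ _ v]
  module

theorem fderiv_fderiv_cubic (hG : ∀ v u, G v u = G u v) (h₁ : ∀ p v u, C p v u = C v p u)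
    (h₂ : ∀ p v u, C p v u = C p u v) :
    fderiv ℝ (fderiv ℝ (cubic e₀ c L G C)) = fun e => G + C (e - e₀) := by
  rw [fderiv_cubic hG h₁ h₂]
  funext e
  have hs : HasFDerivAt (fun e : E => e - e₀) (ContinuousLinearMap.id ℝ E) e :=
    (hasFDerivAt_id e).sub_const e₀
  have hG' := HasFDerivAt.comp (g := fun h => G h) e G.hasFDerivAt hs
  have hC' := HasFDerivAt.comp (g := fun h => C h) e C.hasFDerivAt hs
  have H := (hG'.const_add L).add ((hC'.clm_apply hs).const_smul (1 / 2 : ℝ))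
  refine H.fderiv.trans ?_
  ext v u
  simp [-map_sub]
  rw [h₁ v]
  module

theorem fderiv_fderiv_fderiv_cubic (hG : ∀ v u, G v u = G u v) (h₁ : ∀ p v u, C p v u = C v p u)
    (h₂ : ∀ p v u, C p v u = C p u v) (e : E) :
    fderiv ℝ (fderiv ℝ (fderiv ℝ (cubic e₀ c L G C))) e = C := by
  rw [fderiv_fderiv_cubic hG h₁ h₂]
  have hs : HasFDerivAt (fun e : E => e - e₀) (ContinuousLinearMap.id ℝ E) e :=
    (hasFDerivAt_id e).sub_const e₀
  exact ((HasFDerivAt.comp (g := fun h => C h) e C.hasFDerivAt hs).const_add G).fderiv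

end Cubic

end Holonomic

/-! ### `κ_*`-invariance and holonomy in terms of components -/

section Main

variable {E : Type*} [NormedAddCommGroup E] [NormedSpace ℝ E]
  {M : Type*} [TopologicalSpace M] [ChartedSpace E M] [IsManifold 𝓘(ℝ, E) ∞ M]

theorem exists_eq_pt₃ {x : M} (X : T3At E x) :
    ∃ u v w p q r s, X = ⟨pt₃ x u v w p q r s, rfl⟩ := by
  obtain ⟨⟨⟨⟨z, u⟩, ⟨v, w⟩⟩, ⟨⟨p, q⟩, ⟨r, s⟩⟩⟩, rfl⟩ := X
  exact ⟨u, v, w, p, q, r, s, rfl⟩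

/-- The jet `J` has components `L`, `G` and `C` in the preferred charts at `x` and `y`. -/
def Jet111.HasCoord {x : M} (J : Jet111 E x) (y : M) (L : E →L[ℝ] E) (G : E →L[ℝ] E →L[ℝ] E)
    (C : E →L[ℝ] E →L[ℝ] E →L[ℝ] E) : Prop :=
  ∀ u v w p q r s, J.act ⟨pt₃ x u v w p q r s, rfl⟩ =
    pt₃ y (L u) (L v) (L w + G v u) (L p) (L q + G p u) (L r + G p v)
      ((L s + G p w) + (G v q + (G r u + C p v u)))

namespace Jet111.HasCoord

variable {x y : M} {J : Jet111 E x} {L : E →L[ℝ] E} {G : E →L[ℝ] E →L[ℝ] E}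
  {C : E →L[ℝ] E →L[ℝ] E →L[ℝ] E}

theorem kappaStarAct_pt₃ (h : J.HasCoord y L G C) (u v w p q r s : E) :
    J.kappaStarAct ⟨pt₃ x u v w p q r s, rfl⟩ =
      pt₃ y (L u) (L v) (L w + G u v) (L p) (L q + G p u) (L r + G p v)
        ((L s + G p w) + (G u r + (G q v + C p u v))) := by
  have h1 : J.act ⟨kappaStar E (pt₃ x u v w p q r s), rfl⟩ =
      J.act ⟨pt₃ x v u w p r q s, rfl⟩ :=
    congrArg J.act (Subtype.ext (kappaStar_pt₃ u v w p q r s))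
  refine (congrArg (kappaStar E) (h1.trans (h v u w p r q s))).trans ?_
  exact kappaStar_pt₃ _ _ _ _ _ _ _

/-- The two actions differ only in the components that contain `G` and `C` with `v` and `u`
exchanged. Taking `q = r = 0` isolates the condition on `C`. -/
theorem kappaStarAct_eq_iff (h : J.HasCoord y L G C) :
    J.kappaStarAct = J.act ↔
      (∀ v u, G v u = G u v) ∧ ∀ p v u, C p v u = C p u v := by
  constructor
  · intro H
    have H' : ∀ u v p q r, G u v = G v u ∧
        G u r + (G q v + C p u v) = G v q + (G r u + C p v u) := by
      intro u v p q r
      have := (h.kappaStarAct_pt₃ u v 0 p q r 0).symm.trans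
        ((congrFun H _).trans (h u v 0 p q r 0))
      have := pt₃_inj.1 this
      simpa using And.intro this.1.2.2 this.2.2.2.2
    exact ⟨fun v u => (H' v u 0 0 0).1, fun p v u => by simpa using (H' v u p 0 0).2⟩
  · rintro ⟨hG, hC⟩
    funext X
    obtain ⟨u, v, w, p, q, r, s, rfl⟩ := exists_eq_pt₃ X
    rw [h.kappaStarAct_pt₃, h, hG u v, hC p u v, hG u r, hG q v]
    congr 1
    abel

/-- Symmetry of `G` makes the components other than the last agree, so `Π` is defined, and it
cancels all of the last component but the difference of the `C` terms. -/
theorem piEq (h : J.HasCoord y L G C) (hG : ∀ v u, G v u = G u v) (u v w p q r s : E)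
    {V : TangentSpace 𝓘(ℝ, E) y} (hV : C p v u - C p u v = V) :
    PiEq E (J.act ⟨pt₃ x u v w p q r s, rfl⟩) (J.kappaStarAct ⟨pt₃ x u v w p q r s, rfl⟩)
      ⟨y, V⟩ := by
  rw [h.kappaStarAct_pt₃, h]
  refine ⟨V, rfl, ?_⟩
  subst hV
  have htr : ∀ u v w p q r s V : E, translate₃ E (pt₃ y u v w p q r s) V =
      pt₃ y u v w p q r (s + V) := by
    intro u v w p q r s V
    refine congrArg (Bundle.TotalSpace.mk (pt₂ y u v w))
      (Prod.ext (Prod.ext ?_ ?_) (Prod.ext ?_ rfl))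
    · exact add_zero p
    · exact add_zero q
    · exact add_zero r
  refine Eq.trans ?_ (htr _ _ _ _ _ _ _ _).symm
  rw [hG u v, hG u r, hG q v]
  congr 1
  abel

theorem congr_coord (h : J.HasCoord y L G C) {L' : E →L[ℝ] E} {G' : E →L[ℝ] E →L[ℝ] E}
    {C' : E →L[ℝ] E →L[ℝ] E →L[ℝ] E} (h' : J.HasCoord y L' G' C') : G = G' ∧ C = C' := by
  have H := fun u v w p q r s => pt₃_inj.1 ((h u v w p q r s).symm.trans (h' u v w p q r s))
  have hL : ∀ u, L u = L' u := fun u => (H u 0 0 0 0 0 0).1.1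
  have hG : G = G' := by
    ext v u
    simpa using (H u v 0 0 0 0 0).1.2.2
  refine ⟨hG, ?_⟩
  ext p v u
  simpa using (H u v 0 p 0 0 0).2.2.2.2

end Jet111.HasCoord

theorem Jet111.hasCoord_of_isRep {x y : M} {J : Jet111 E x} {f : M → M} {α : E → E} {W : Set M}
    (r : IsRep 𝓘(ℝ, E) 𝓘(ℝ, E) x y f α W) (hx : x ∈ W)
    (hy : α (extChartAt 𝓘(ℝ, E) x x) = extChartAt 𝓘(ℝ, E) y y)
    (hα : ∀ q ∈ W, ContDiffAt ℝ ∞ α (extChartAt 𝓘(ℝ, E) x q))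
    (hJ : ∀ X, J.act X = tangentMap 𝓘(ℝ, E).tangent.tangent 𝓘(ℝ, E).tangent.tangent
      (tangentMap 𝓘(ℝ, E).tangent 𝓘(ℝ, E).tangent (tangentMap 𝓘(ℝ, E) 𝓘(ℝ, E) f)) X.1) :
    J.HasCoord y (fderiv ℝ α (extChartAt 𝓘(ℝ, E) x x))
      (fderiv ℝ (fderiv ℝ α) (extChartAt 𝓘(ℝ, E) x x))
      (fderiv ℝ (fderiv ℝ (fderiv ℝ α)) (extChartAt 𝓘(ℝ, E) x x)) := by
  intro u v w p q t s
  have h0 := hα x hx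
  have h1 := contDiffAt_fderiv_infty h0
  have h2 := contDiffAt_fderiv_infty h1
  exact (hJ _).trans ((r.tangentMap_model₂ hα).tangentMap_pt₃ hx hy
    (h0.differentiableAt (by simp)) (h1.differentiableAt (by simp))
    (h1.differentiableAt (by simp)) (h2.differentiableAt (by simp)) u v w p q t s)

theorem Jet11.isSymm_of_isHolonomic {x y : M} {j : Jet11 E x} {L : E →L[ℝ] E}
    {G : E →L[ℝ] E →L[ℝ] E}
    (h : ∀ u v w, j.act ⟨pt₂ x u v w, rfl⟩ = pt₂ y (L u) (L v) (L w + G v u))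
    (hj : j.IsHolonomic) (v u : E) : G v u = G u v := by
  obtain ⟨f, hf, hact⟩ := hj
  have hfx : f x = y := congrArg (fun X : T2 E M => X.1.1)
    ((hact ⟨pt₂ x 0 0 0, rfl⟩).symm.trans (h 0 0 0))
  obtain ⟨α, W, hx, r, hα⟩ := exists_isRep_of_isLocalDiffeomorphAt hf (mem_extChartAt_source x)
    (y₀ := y) (by rw [hfx]; exact mem_extChartAt_source y)
  have hy : α (extChartAt 𝓘(ℝ, E) x x) = extChartAt 𝓘(ℝ, E) y y := by rw [← r.eq x hx, hfx]
  have h0 := hα x hx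
  have h1 := contDiffAt_fderiv_infty h0
  have H : ∀ u v, G v u = fderiv ℝ (fderiv ℝ α) (extChartAt 𝓘(ℝ, E) x x) v u := by
    intro u v
    have := (h u v 0).symm.trans ((hact ⟨pt₂ x u v 0, rfl⟩).trans
      ((r.tangentMap_model₁ hα).tangentMap_pt₂ hx hy (h0.differentiableAt (by simp))
        (h1.differentiableAt (by simp)) u v 0))
    simpa using (pt₂_inj.1 this).2.2
  rw [H, H, isSymmSnd_fderiv h0]

theorem Jet11.isSymm_of_kappaAct {x y : M} {j : Jet11 E x} {L : E →L[ℝ] E}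
    {G : E →L[ℝ] E →L[ℝ] E}
    (h : ∀ u v w, j.act ⟨pt₂ x u v w, rfl⟩ = pt₂ y (L u) (L v) (L w + G v u))
    (hj : j.kappaAct = j.act) (v u : E) : G v u = G u v := by
  have h1 : j.kappaAct ⟨pt₂ x u v 0, rfl⟩ = pt₂ y (L u) (L v) (L 0 + G u v) :=
    congrArg (kappa 𝓘(ℝ, E)) (h v u 0)
  have := (h u v 0).symm.trans ((congrFun hj _).symm.trans h1)
  simpa using (pt₂_inj.1 this).2.2

/-- A genuine 3-jet has the first three derivatives of a map as its components, so symmetry is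
necessary. It is sufficient because a polynomial realizes any symmetric data, and invertibility of
the linear part makes that map a local diffeomorphism. -/
theorem Jet111.isHolonomic_iff [CompleteSpace E] {x : M} {J : Jet111 E x} {ξ : Jet1 E x}
    {G : E →L[ℝ] E →L[ℝ] E} {C : E →L[ℝ] E →L[ℝ] E →L[ℝ] E}
    (h : J.HasCoord ξ.tgt (ξ.coord x ξ.tgt) G C) :
    J.IsHolonomic ↔ (∀ v u, G v u = G u v) ∧ (∀ p v u, C p v u = C p u v) ∧
      ∀ p v u, C p v u = C v p u := by
  set φ := extChartAt 𝓘(ℝ, E) x with hφ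
  set ψ := extChartAt 𝓘(ℝ, E) ξ.tgt with hψ
  have hxs : x ∈ φ.source := mem_extChartAt_source x
  have hys : ξ.tgt ∈ ψ.source := mem_extChartAt_source ξ.tgt
  constructor
  · rintro ⟨f, hf, hact⟩
    have hfx : f x = ξ.tgt := congrArg (fun X : T3 E M => X.1.1.1)
      ((hact ⟨pt₃ x 0 0 0 0 0 0 0, rfl⟩).symm.trans (h 0 0 0 0 0 0 0))
    obtain ⟨α, W, hx, r, hα⟩ := exists_isRep_of_isLocalDiffeomorphAt hf hxs
      (y₀ := ξ.tgt) (by rw [hfx]; exact hys)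
    have hy : α (φ x) = ψ ξ.tgt := by rw [← r.eq x hx, hfx]
    obtain ⟨hG, hC⟩ := h.congr_coord (Jet111.hasCoord_of_isRep r hx hy hα hact)
    have hev : ∀ᶠ e in 𝓝 (φ x), ContDiffAt ℝ ∞ α e := by
      filter_upwards [r.eventually_mem hx] with e he
      have := hα _ he.2
      rwa [(extChartAt 𝓘(ℝ, E) x).right_inv he.1] at this
    rw [hG, hC]
    exact ⟨isSymmSnd_fderiv (hα x hx), third_fderiv_swap_right hev,
      third_fderiv_swap_left (hα x hx)⟩
  · rintro ⟨hG, h₂, h₁⟩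
    -- The Taylor polynomial dictated by the components of the jet.
    set α := cubic (φ x) (ψ ξ.tgt) (ξ.coord x ξ.tgt) G C with hα
    have hαs : ContDiff ℝ ∞ α := contDiff_cubic
    have hαx : α (φ x) = ψ ξ.tgt := by simp [hα, cubic]
    have hd1 : fderiv ℝ α (φ x) = ξ.coord x ξ.tgt := by
      rw [hα, fderiv_cubic hG h₁ h₂]; simp
    have hd2 : fderiv ℝ (fderiv ℝ α) (φ x) = G := by
      rw [hα, fderiv_fderiv_cubic hG h₁ h₂]; simp
    have hd3 : fderiv ℝ (fderiv ℝ (fderiv ℝ α)) (φ x) = C :=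
      fderiv_fderiv_fderiv_cubic hG h₁ h₂ _
    let f : M → M := fun z => ψ.symm (α (φ z))
    have r : IsRep 𝓘(ℝ, E) 𝓘(ℝ, E) x ξ.tgt f α
        (φ.source ∩ (fun z => α (φ z)) ⁻¹' ψ.target) :=
      ⟨(hαs.continuous.comp_continuousOn (continuousOn_extChartAt x)).isOpen_inter_preimage
        (isOpen_extChartAt_source x) (isOpen_extChartAt_target ξ.tgt), fun q hq => hq.1,
        fun q hq => ψ.map_target hq.2, fun q hq => ψ.right_inv hq.2⟩
    have hx : x ∈ φ.source ∩ (fun z => α (φ z)) ⁻¹' ψ.target :=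
      ⟨hxs, by rw [Set.mem_preimage, hαx]; exact ψ.map_source hys⟩
    refine ⟨f, isLocalDiffeomorphAt_of_isRep r hx (fun _ _ => hαs.contDiffAt)
      (ξ.coordEquiv hxs hys) hd1, fun X => ?_⟩
    obtain ⟨u, v, w, p, q, t, s, rfl⟩ := exists_eq_pt₃ X
    rw [h]
    have h0 := fun e => hαs.contDiffAt (x := e)
    have h1 := contDiffAt_fderiv_infty (h0 (φ x))
    have h2 := contDiffAt_fderiv_infty h1
    have := (r.tangentMap_model₂ fun q _ => h0 _).tangentMap_pt₃ hx hαx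
      ((h0 _).differentiableAt (by simp)) (h1.differentiableAt (by simp))
      (h1.differentiableAt (by simp)) (h2.differentiableAt (by simp)) u v w p q t s
    rw [← hφ, hd1, hd2, hd3] at this
    exact this.symm

end Main

/-! ### The criteria for the affine extensions -/

section Affine

variable {E : Type*} [NormedAddCommGroup E] [NormedSpace ℝ E] [FiniteDimensional ℝ E]
  [CompleteSpace E]
  {M : Type*} [TopologicalSpace M] [T2Space M] [ChartedSpace E M] [IsManifold 𝓘(ℝ, E) ∞ M]
  (cov : CovariantDerivative 𝓘(ℝ, E) E (TangentSpace 𝓘(ℝ, E) : M → Type _))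
  [cov.ContMDiffCovariantDerivative ∞]

theorem exists_hasCoord_affineExt₃ {x : M} (ξ : Jet1 E x) :
    ∃ C, IsThird cov ξ C ∧
      (affineExt₃ cov ξ).HasCoord ξ.tgt (ξ.coord x ξ.tgt) (ξ.snd cov) C :=
  affineExt₃_act cov ξ

theorem preservesCovTorsion_iff {x : M} (ξ : Jet1 E x)
    (hG : ∀ v u, ξ.snd cov v u = ξ.snd cov u v) {C : E →L[ℝ] E →L[ℝ] E →L[ℝ] E}
    (hC : IsThird cov ξ C) : PreservesCovTorsion cov ξ ↔ ∀ p v u, C p v u = C p u v := by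
  refine forall_congr' fun p => forall_congr' fun v => forall_congr' fun u => ?_
  rw [← sub_eq_zero (a := C p v u)]
  have := third_sub_swap_right cov ξ hG hC p v u
  rw [this]
  exact sub_eq_zero.symm

theorem preservesCurvature_iff {x : M} (ξ : Jet1 E x)
    (hG : ∀ v u, ξ.snd cov v u = ξ.snd cov u v) {C : E →L[ℝ] E →L[ℝ] E →L[ℝ] E}
    (hC : IsThird cov ξ C) : PreservesCurvature cov ξ ↔ ∀ p v u, C p v u = C v p u := by
  refine forall_congr' fun p => forall_congr' fun v => forall_congr' fun u => ?_
  rw [← sub_eq_zero (a := C p v u)]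
  have := third_sub_swap_left cov ξ hG hC p v u
  rw [this]
  exact sub_eq_zero.symm

/-- The coordinate torsion vanishes on the whole chart target, a neighbourhood of the point, so its
derivative vanishes as well. -/
theorem covTorsion_eq_zero (h : cov.torsion = 0) (x : M) (Z Y X : E) :
    (covTorsion cov x Z Y X : E) = 0 := by
  have h0 : ∀ e ∈ (extChartAt 𝓘(ℝ, E) x).target, torsionCoord cov x e = 0 := by
    intro e he
    have hs := (extChartAt 𝓘(ℝ, E) x).map_target he
    ext u v
    have h1 := tcoord_torsion cov hs (tcoordSymm 𝓘(ℝ, E) x _ u) (tcoordSymm 𝓘(ℝ, E) x _ v)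
    rw [tcoord_tcoordSymm hs, tcoord_tcoordSymm hs, (extChartAt 𝓘(ℝ, E) x).right_inv he] at h1
    have h2 : cov.torsion ((extChartAt 𝓘(ℝ, E) x).symm e) (tcoordSymm 𝓘(ℝ, E) x _ u)
        (tcoordSymm 𝓘(ℝ, E) x _ v) = 0 := by rw [h]; rfl
    rw [h2, map_zero] at h1
    exact h1.symm
  have h1 : fderiv ℝ (torsionCoord cov x) (extChartAt 𝓘(ℝ, E) x x) = 0 := by
    have : torsionCoord cov x =ᶠ[𝓝 (extChartAt 𝓘(ℝ, E) x x)] fun _ => 0 := by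
      filter_upwards [extChartAt_target_mem_nhds x] with e he using h0 e he
    rw [this.fderiv_eq]
    simp
  refine (covTorsion_eq cov x Z Y X).trans ?_
  rw [h1, h0 _ (mem_extChartAt_target x)]
  simp
  rfl

end Affine

end JetAffine

end

open JetAffine in
theorem proposition7p1 {E : Type*} [NormedAddCommGroup E] [NormedSpace ℝ E]
    [FiniteDimensional ℝ E] [CompleteSpace E]
    {M : Type*} [TopologicalSpace M] [T2Space M] [ChartedSpace E M] [IsManifold 𝓘(ℝ, E) ∞ M]
    (cov : CovariantDerivative 𝓘(ℝ, E) E (TangentSpace 𝓘(ℝ, E) : M → Type _))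
    [cov.ContMDiffCovariantDerivative ∞] :
    -- the defect of `κ_*`-invariance is the defect of invariance of `∇T`
    (∀ (x : M) (ξ : Jet1 E x), (affineExt cov ξ).IsHolonomic →
      (∀ (X Y Z : TangentSpace 𝓘(ℝ, E) x) (𝔛 : T3At E x),
        𝔛.1.1.1 = ⟨x, X⟩ → pStar E 𝔛.1.1 = ⟨x, Y⟩ → pStar E (pStar₃ E 𝔛.1) = ⟨x, Z⟩ →
        PiEq E ((affineExt₃ cov ξ).act 𝔛) ((affineExt₃ cov ξ).kappaStarAct 𝔛)
          ⟨ξ.tgt, ξ.lin (covTorsion cov x Z Y X)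
            - covTorsion cov ξ.tgt (ξ.lin Z) (ξ.lin Y) (ξ.lin X)⟩) ∧
      -- in particular for `𝔛 = X_** Y_* Z`
      (∀ (X Y : (z : M) → TangentSpace 𝓘(ℝ, E) z) (Z : TangentSpace 𝓘(ℝ, E) x),
        ContMDiffAt 𝓘(ℝ, E) 𝓘(ℝ, E).tangent ∞ (fun z => (⟨z, X z⟩ : T1 E M)) x →
        ContMDiffAt 𝓘(ℝ, E) 𝓘(ℝ, E).tangent ∞ (fun z => (⟨z, Y z⟩ : T1 E M)) x →
        let 𝔛 : T3At E x :=
          ⟨tangentMap 𝓘(ℝ, E).tangent 𝓘(ℝ, E).tangent.tangent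
            (tangentMap 𝓘(ℝ, E) 𝓘(ℝ, E).tangent (fun z => (⟨z, X z⟩ : T1 E M)))
            (tangentMap 𝓘(ℝ, E) 𝓘(ℝ, E).tangent (fun z => (⟨z, Y z⟩ : T1 E M)) ⟨x, Z⟩), rfl⟩
        PiEq E ((affineExt₃ cov ξ).act 𝔛) ((affineExt₃ cov ξ).kappaStarAct 𝔛)
          ⟨ξ.tgt, ξ.lin (covTorsion cov x Z (Y x) (X x))
            - covTorsion cov ξ.tgt (ξ.lin Z) (ξ.lin (Y x)) (ξ.lin (X x))⟩)) ∧
    -- if `S(ξ)` is `κ`-invariant, then `𝕊(ξ)` is `κ_*`-invariant iff `ξ` preserves `∇T`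
    (∀ (x : M) (ξ : Jet1 E x), (affineExt cov ξ).kappaAct = (affineExt cov ξ).act →
      ((affineExt₃ cov ξ).kappaStarAct = (affineExt₃ cov ξ).act ↔ PreservesCovTorsion cov ξ)) ∧
    -- `𝕊(ξ)` is a genuine 3-jet iff `ξ` preserves `T`, `∇T` and `R`
    (∀ (x : M) (ξ : Jet1 E x), (affineExt₃ cov ξ).IsHolonomic ↔
      PreservesTorsion cov ξ ∧ PreservesCovTorsion cov ξ ∧ PreservesCurvature cov ξ) ∧
    -- the torsion-free case
    (cov.torsion = 0 → ∀ (x : M) (ξ : Jet1 E x),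
      (affineExt₃ cov ξ).kappaStarAct = (affineExt₃ cov ξ).act) := by
  have part1 : ∀ (x : M) (ξ : Jet1 E x), (affineExt cov ξ).IsHolonomic →
      ∀ (X Y Z : TangentSpace 𝓘(ℝ, E) x) (𝔛 : T3At E x),
        𝔛.1.1.1 = ⟨x, X⟩ → pStar E 𝔛.1.1 = ⟨x, Y⟩ → pStar E (pStar₃ E 𝔛.1) = ⟨x, Z⟩ →
        PiEq E ((affineExt₃ cov ξ).act 𝔛) ((affineExt₃ cov ξ).kappaStarAct 𝔛)
          ⟨ξ.tgt, ξ.lin (covTorsion cov x Z Y X)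
            - covTorsion cov ξ.tgt (ξ.lin Z) (ξ.lin Y) (ξ.lin X)⟩ := by
    intro x ξ hξ X Y Z 𝔛 hX hY hZ
    have hG := Jet11.isSymm_of_isHolonomic (affineExt_act cov ξ) hξ
    obtain ⟨C, hC, hJ⟩ := exists_hasCoord_affineExt₃ cov ξ
    obtain ⟨u, v, w, p, q, r, s, rfl⟩ := exists_eq_pt₃ 𝔛
    have hX' : u = X := pt₁_inj.1 hX
    have hY' : v = Y := pt₁_inj.1 ((pStar_pt₂ x u v w).symm.trans hY)
    have hZ' : p = Z := pt₁_inj.1 (((congrArg (pStar E) (pStar₃_pt₃ x u v w p q r s)).trans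
      (pStar_pt₂ x u p q)).symm.trans hZ)
    subst hX' hY' hZ'
    exact hJ.piEq hG u v w p q r s (third_sub_swap_right cov ξ hG hC p v u)
  refine ⟨fun x ξ hξ => ⟨part1 x ξ hξ, fun X Y Z hX hY => ?_⟩, fun x ξ hξ => ?_, fun x ξ => ?_,
    fun hT x ξ => ?_⟩
  -- The three projections of `X_** Y_* Z` are the values `X x`, `Y x` and `Z`, so this is a special
  -- case.
  · exact part1 x ξ hξ (X x) (Y x) Z _ rfl (pStar_tangentMap hX (Y x))
      (pStar_pStar₃_tangentMap hX hY Z)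
  · have hG := Jet11.isSymm_of_kappaAct (affineExt_act cov ξ) hξ
    obtain ⟨C, hC, hJ⟩ := exists_hasCoord_affineExt₃ cov ξ
    rw [hJ.kappaStarAct_eq_iff, preservesCovTorsion_iff cov ξ hG hC, and_iff_right hG]
  · obtain ⟨C, hC, hJ⟩ := exists_hasCoord_affineExt₃ cov ξ
    rw [Jet111.isHolonomic_iff hJ, preservesTorsion_iff]
    -- Preservation of `T` is the symmetry of `G`, under which the symmetry conditions on `C` become
    -- those on `∇T` and `R`.
    refine and_congr_right fun hG => ?_
    rw [preservesCovTorsion_iff cov ξ hG hC, preservesCurvature_iff cov ξ hG hC]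
  · obtain ⟨C, hC, hJ⟩ := exists_hasCoord_affineExt₃ cov ξ
    -- Zero torsion is preserved by every `ξ`, so `G` is symmetric without further assumption.
    have hG := (preservesTorsion_iff cov ξ).1 fun X Y => by
      rw [hT]
      exact map_zero ξ.lin
    refine hJ.kappaStarAct_eq_iff.2 ⟨hG, (preservesCovTorsion_iff cov ξ hG hC).1 fun Z Y X => ?_⟩
    exact (congrArg ξ.lin (covTorsion_eq_zero cov hT x Z Y X)).trans
      ((map_zero ξ.lin).trans (covTorsion_eq_zero cov hT ξ.tgt _ _ _).symm)
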